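/- **Setting.** Let $k$ be a field, $n\ge 0$, $I=\{1,\dots,n\}$, let $\alpha_1,\dots,\alpha_n$ be the standard basis of $\mathbb Z^n$, and let $\chi:\mathbb Z^n\times\mathbb Z^n\to k^\times$ be a bicharacter whose matrix $q_{ij}=\chi(\alpha_i,\alpha_j)$ is symmetric. Let $\tau:I\to I$ be a bijection with $\tau^2=\mathrm{id}$ and $q_{\tau(i)\tau(j)}=q_{ij}$; write $\tau$ also for the induced automorphism of $\mathbb Z^n$. Let $T(V^+)$ be the tensor algebra on $E_1,\dots,E_n$, a braided Hopf algebra with primitive generators $E_i$ and braiding $E_i\otimes E_j\mapsto q_{ij}E_j\otimes E_i$, and let $\mathcal I\subseteq\bigoplus_{m\ge2}T(V^+)_m$ be a $\mathbb Z^n$-graded biideal with $\tau(\mathcal I)=\mathcal I$. Let $U(\chi)$ be the algebra generated by $E_i,F_i$ $(i\in I)$ and $K_a$ $(a\in\mathbb Z^n)$, with $K_i=K_{\alpha_i}$, subject to $$K_0=1,\quad K_{a+b}=K_aK_b,\quad K_aE_i=\chi(a,\alpha_i)E_iK_a,\quad K_aF_i=\chi(a,\alpha_i)^{-1}F_iK_a,\quad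 E_iF_j-F_jE_i=\delta_{ij}(K_i-K_i^{-1}),$$ and $p(E_1,\dots,E_n)=0=p(F_1,\dots,F_n)$ for all $p\in\mathcal I$. Let $U^\pm$, $H$ be the subalgebras generated by all $E_i$, by all $F_i$, and by all $K_a$, respectively; $U^-$ is graded with $\deg F_i=-\alpha_i$ and $U^+$ with $\deg E_i=\alpha_i$. The coproduct is $\Delta(E_i)=E_i\otimes1+K_i\otimes E_i$, $\Delta(F_i)=F_i\otimes K_i^{-1}+1\otimes F_i$, $\Delta(K_a)=K_a\otimes K_a$. The subscript $\max$ denotes the same objects for the maximal such biideal $\mathcal I_{\max}$; let $\pi_{\max}:H\ltimes U^-\to H\ltimes U^-_{\max}$ be the projection. Put $\mathbb Z^n_\theta=\{a\in\mathbb Z^n: -\tau(a)=a\}$, let $H_\theta$ be the subalgebra generated by all $K_iK_{\tau(i)}^{-1}$, and let $H_\theta\ltimes U^-\subseteq U(\chi)$ be the subalgebra generated by $H_\theta$ and $U^-$, which is $\mathbb N$-graded with $\deg H_\theta=0$ and $\deg F_i=1$. Fix $\mathbf c=(c_1,\dots,c_n)\in k^n$. **Objects in the formula.** There is a unique bilinear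 pairing $\langle\,,\rangle$ of $H\ltimes U^-_{\max}$ with $U^+_{\max}\rtimes H$ such that $\langle y,xx'\rangle=\langle y_{(1)},x'\rangle\langle y_{(2)},x\rangle$, $\langle yy',x\rangle=\langle y,x_{(1)}\rangle\langle y',x_{(2)}\rangle$, $\langle y,1\rangle=\varepsilon(y)$, $\langle 1,x\rangle=\varepsilon(x)$, $\langle F_i,E_j\rangle=\delta_{ij}$, $\langle K_i,K_j\rangle=q_{ij}^{-1}$, $\langle F_i,K_j\rangle=\langle K_i,E_j\rangle=0$. For $\rho\in\mathbb N^n$ there are finite dual bases $\{F_{\rho,j}\}$ of $(U^-_{\max})_{-\rho}$ and $\{E_{\rho,j}\}$ of $(U^+_{\max})_\rho$; write $F_\rho\otimes E_\rho=\sum_jF_{\rho,j}\otimes E_{\rho,j}$ and $|\rho|=\sum_i\rho_i$. For $e\in U^+_{\max}\rtimes H$ and $f\in H\ltimes U^-$ let $e\triangleright f=\langle\pi_{\max}(f_{(1)}),e\rangle f_{(2)}$ and $f\triangleleft e=\langle\pi_{\max}(f_{(2)}),e\rangle f_{(1)}$. The Hopf algebra $U^+_{\max}\rtimes H$ has a bijective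 antipode $S$, and $\overline\sigma:U^-_{\max}\to U^+_{\max}\rtimes H$ denotes the algebra homomorphism with $\overline\sigma(F_i)=c_{\tau(i)}K_iE_{\tau(i)}$. There are unique linear maps $\partial_i^L,\partial_i^R:U^-\to U^-$ with $E_if-fE_i=K_i\partial_i^L(f)-\partial_i^R(f)K_i^{-1}$ for all $f\in U^-$. **Theorem.** For $f,g\in U^-$ put $$f\star g=\sum_{\rho\in\mathbb N^n}(-1)^{|\rho|}\,(\overline\sigma(F_\rho)\triangleright f)\,K_\rho\,[\,g\triangleleft(S^{-1}(E_\rho)K_\rho)\,].$$ The sum has only finitely many nonzero terms, and there is a unique bilinear operation $\star$ on $H_\theta\ltimes U^-$, independent of the choice of dual bases, with $$(K_af)\star(K_bg)=\chi(\alpha,b)\,K_{a+b}\,(f\star g)\qquad(a,b\in\mathbb Z^n_\theta,\ f\in U^-_{-\alpha},\ g\in U^-).$$ 1. The operation $\star$ is associative and is a $0$-equivariant star product on $A=H_\theta\ltimes U^-$, that is, $a\star b-ab\in\bigoplus_{j<m+m'}A_j$ for $a\in A_m$, $b\in A_{m'}$, and $a\star h=ah$, $h\star a=ha$ for $h\in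 A_0$, $a\in A$. Moreover $F_i\star u=F_iu+c_iq_{i\tau(i)}K_{\tau(i)}K_i^{-1}\partial^L_{\tau(i)}(u)$ for $i\in I$, $u\in U^-$. 2. Let $B_{\mathbf c}\subseteq U(\chi)$ be the subalgebra generated by $H_\theta$ and all $B_i=F_i+c_iE_{\tau(i)}K_i^{-1}$, filtered by $\deg H_\theta=0$, $\deg B_i=1$. Let $U(\chi)^{\mathrm{poly}}$ be the subalgebra generated by all $F_i$, $E_iK_i^{-1}$, $K_i^{-1}$, $K_iK_{\tau(i)}^{-1}$. Then $U(\chi)^{\mathrm{poly}}$ is the direct sum of $A$ and its left ideal generated by all $E_iK_i^{-1}$ and $K_i^{-1}$; let $\psi:U(\chi)^{\mathrm{poly}}\to A$ be the projection along this left ideal. If the homomorphism $\varphi:\mathrm{gr}(B_{\mathbf c})\to A$ of graded algebras with $\varphi(B_i)=F_i$ and $\varphi(h)=h$ for $h\in H_\theta$ is an isomorphism, then $\psi|_{B_{\mathbf c}}:B_{\mathbf c}\to A$ is bijective. Whenever $\psi|_{B_{\mathbf c}}$ is bijective, the product $a*b=\psi\big((\psi|_{B_{\mathbf c}})^{-1}(a)\,(\psi|_{B_{\mathbf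 c}})^{-1}(b)\big)$ on $A$ coincides with $\star$. -/

import Mathlib

open scoped TensorProduct

namespace PartialBosonization

section Setting

variable {k : Type*} [Field k] {n : ℕ}

/-- The `i`-th vector `α_i` of the standard basis of `ℤⁿ`. -/
def simpleRoot (i : Fin n) : Fin n → ℤ := Pi.single i 1

/-- A bicharacter `χ : ℤⁿ × ℤⁿ → kˣ` whose matrix `q i j = χ(α_i, α_j)` is symmetric, together with
an involutive bijection `τ` of the index set that leaves the matrix invariant. -/
structure Datum (k : Type*) [Field k] (n : ℕ) where
  χ : (Fin n → ℤ) → (Fin n → ℤ) → kˣ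
  χ_add_left : ∀ a b c, χ (a + b) c = χ a c * χ b c
  χ_add_right : ∀ a b c, χ a (b + c) = χ a b * χ a c
  χ_symm : ∀ i j, χ (simpleRoot i) (simpleRoot j) = χ (simpleRoot j) (simpleRoot i)
  τ : Equiv.Perm (Fin n)
  τ_involutive : ∀ i, τ (τ i) = i
  χ_τ : ∀ i j, χ (simpleRoot (τ i)) (simpleRoot (τ j)) = χ (simpleRoot i) (simpleRoot j)

/-- The matrix entries `q i j = χ(α_i, α_j)`. -/
def Datum.q (d : Datum k n) (i j : Fin n) : k := (d.χ (simpleRoot i) (simpleRoot j) : k)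

theorem Datum.q_symm (d : Datum k n) (i j : Fin n) : d.q i j = d.q j i := by
  simp [Datum.q, d.χ_symm i j]

theorem Datum.q_τ (d : Datum k n) (i j : Fin n) : d.q (d.τ i) (d.τ j) = d.q i j := by
  simp [Datum.q, d.χ_τ i j]

/-- The tensor algebra of a vector space with basis indexed by `Fin n`. It serves both for
`T(V⁺(χ))`, with basis `E_i`, and for `T(V⁻(χ))`, with basis `F_i`; the identification is
`ω : E_i ↦ F_i`. -/
abbrev Tens (k : Type*) [Field k] (n : ℕ) := FreeAlgebra k (Fin n)

/-- The noncommutative monomial `x_{l₁} x_{l₂} ⋯`. -/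
def word (k : Type*) [Field k] {n : ℕ} (l : List (Fin n)) : Tens k n :=
  (l.map (FreeAlgebra.ι k)).prod

/-- The weight in `ℕⁿ` of a monomial. -/
def wt (l : List (Fin n)) : Fin n → ℕ := fun i => l.count i

/-- The homogeneous component of the tensor algebra of degree `μ ∈ ℕⁿ`. -/
def homog (k : Type*) [Field k] {n : ℕ} (μ : Fin n → ℕ) : Submodule k (Tens k n) :=
  Submodule.span k (word k '' {l | wt l = μ})

/-- The action of `K_i` on the Yetter-Drinfeld module algebra `T(V⁺(χ))`:
`K_i · E_j = q i j E_j`. -/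
def braidAction (d : Datum k n) (i : Fin n) : Tens k n →ₐ[k] Tens k n :=
  FreeAlgebra.lift k fun j => d.q i j • FreeAlgebra.ι k j

/-- Left multiplication by `E_i ⊗ 1 + 1 ⊗ E_i` on the braided tensor product
`T(V⁺(χ)) ⊗ T(V⁺(χ))`, in which `(1 ⊗ E_i)(u ⊗ v) = (K_i · u) ⊗ E_i v`. -/
def braidedComulGen (d : Datum k n) (i : Fin n) : Module.End k (Tens k n ⊗[k] Tens k n) :=
  TensorProduct.map (LinearMap.mulLeft k (FreeAlgebra.ι k i)) LinearMap.id +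
    TensorProduct.map (braidAction d i).toLinearMap (LinearMap.mulLeft k (FreeAlgebra.ι k i))

/-- The braided coproduct of `T(V⁺(χ))`: the algebra homomorphism to the braided tensor product
for which the `E_i` are primitive. -/
def braidedComul (d : Datum k n) : Tens k n →ₗ[k] Tens k n ⊗[k] Tens k n :=
  (LinearMap.applyₗ (1 ⊗ₜ[k] 1)).comp (FreeAlgebra.lift k (braidedComulGen d)).toLinearMap

/-- `ℤⁿ`-graded biideals of the braided Hopf algebra `T(V⁺(χ))` contained in the sum of the
components of degree at least two. -/
structure IsGradedBiideal (d : Datum k n) (J : Submodule k (Tens k n)) : Prop where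
  mul_left : ∀ a, ∀ p ∈ J, a * p ∈ J
  mul_right : ∀ a, ∀ p ∈ J, p * a ∈ J
  comul : ∀ p ∈ J, braidedComul d p ∈
    LinearMap.range (TensorProduct.map J.subtype (LinearMap.id : Tens k n →ₗ[k] Tens k n)) ⊔
      LinearMap.range (TensorProduct.map (LinearMap.id : Tens k n →ₗ[k] Tens k n) J.subtype)
  graded : J ≤ ⨆ μ, J ⊓ homog k μ
  two_le : J ≤ Submodule.span k (word k '' {l | 2 ≤ l.length})

/-- The diagram automorphism `τ` of the tensor algebra. -/
def tauTens (d : Datum k n) : Tens k n →ₐ[k] Tens k n :=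
  FreeAlgebra.lift k fun i => FreeAlgebra.ι k (d.τ i)

/-- The ideals that define pre-Nichols algebras: `τ`-stable graded biideals. -/
structure PreNicholsIdeal (d : Datum k n) where
  carrier : Submodule k (Tens k n)
  biideal : IsGradedBiideal d carrier
  τ_stable : carrier.map (tauTens d).toLinearMap = carrier

/-- The sum of all graded biideals, that is, the maximal graded biideal. -/
def maxCarrier (d : Datum k n) : Submodule k (Tens k n) := sSup {J | IsGradedBiideal d J}

theorem range_sup_mono {J J' : Submodule k (Tens k n)} (h : J ≤ J') :
    LinearMap.range (TensorProduct.map J.subtype (LinearMap.id : Tens k n →ₗ[k] Tens k n)) ⊔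
      LinearMap.range (TensorProduct.map (LinearMap.id : Tens k n →ₗ[k] Tens k n) J.subtype) ≤
    LinearMap.range (TensorProduct.map J'.subtype (LinearMap.id : Tens k n →ₗ[k] Tens k n)) ⊔
      LinearMap.range (TensorProduct.map (LinearMap.id : Tens k n →ₗ[k] Tens k n) J'.subtype) := by
  have e : J.subtype = J'.subtype.comp (Submodule.inclusion h) := rfl
  refine sup_le_sup ?_ ?_
  · rw [e, ← LinearMap.comp_id LinearMap.id, TensorProduct.map_comp]
    exact LinearMap.range_comp_le_range _ _
  · rw [e, ← LinearMap.comp_id LinearMap.id, TensorProduct.map_comp]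
    exact LinearMap.range_comp_le_range _ _

theorem isGradedBiideal_maxCarrier (d : Datum k n) : IsGradedBiideal d (maxCarrier d) where
  mul_left a := by
    suffices h : maxCarrier d ≤ (maxCarrier d).comap (LinearMap.mulLeft k a) from h
    exact sSup_le fun J hJ p hp => (le_sSup hJ : J ≤ maxCarrier d) (hJ.mul_left a p hp)
  mul_right a := by
    suffices h : maxCarrier d ≤ (maxCarrier d).comap (LinearMap.mulRight k a) from h
    exact sSup_le fun J hJ p hp => (le_sSup hJ : J ≤ maxCarrier d) (hJ.mul_right a p hp)
  comul := by
    intro p hp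
    have h : maxCarrier d ≤ Submodule.comap (braidedComul d) (LinearMap.range (TensorProduct.map (maxCarrier d).subtype (LinearMap.id : Tens k n →ₗ[k] Tens k n)) ⊔
      LinearMap.range (TensorProduct.map (LinearMap.id : Tens k n →ₗ[k] Tens k n) (maxCarrier d).subtype)) :=
      sSup_le fun J hJ p hp => range_sup_mono (le_sSup hJ : J ≤ maxCarrier d) (hJ.comul p hp)
    exact h hp
  graded := sSup_le fun J hJ => hJ.graded.trans
    (iSup_mono fun μ => inf_le_inf_right _ (le_sSup hJ))
  two_le := sSup_le fun J hJ => hJ.two_le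

theorem tauTens_ι (d : Datum k n) (i : Fin n) :
    tauTens d (FreeAlgebra.ι k i) = FreeAlgebra.ι k (d.τ i) := by
  simp [tauTens]

theorem tauTens_word (d : Datum k n) (l : List (Fin n)) :
    tauTens d (word k l) = word k (l.map d.τ) := by
  simp [word, tauTens, map_list_prod, Function.comp_def]

theorem tauTens_tauTens (d : Datum k n) (p : Tens k n) : tauTens d (tauTens d p) = p := by
  have : (tauTens d).comp (tauTens d) = AlgHom.id k _ := by
    ext i
    simp [tauTens, d.τ_involutive]
  exact congrArg (fun f => f p) this

theorem tauTens_braidAction (d : Datum k n) (i : Fin n) (p : Tens k n) :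
    tauTens d (braidAction d i p) = braidAction d (d.τ i) (tauTens d p) := by
  have : (tauTens d).comp (braidAction d i) = (braidAction d (d.τ i)).comp (tauTens d) := by
    ext j
    simp [tauTens, braidAction, d.q_τ]
  exact congrArg (fun f => f p) this

theorem braidedComul_tauTens (d : Datum k n) (p : Tens k n) :
    braidedComul d (tauTens d p) =
      TensorProduct.map (tauTens d).toLinearMap (tauTens d).toLinearMap (braidedComul d p) := by
  suffices h : ∀ z, (FreeAlgebra.lift k (braidedComulGen d) (tauTens d p))
      (TensorProduct.map (tauTens d).toLinearMap (tauTens d).toLinearMap z) =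
      TensorProduct.map (tauTens d).toLinearMap (tauTens d).toLinearMap
        (FreeAlgebra.lift k (braidedComulGen d) p z) by
    have := h (1 ⊗ₜ 1)
    simpa [braidedComul] using this
  induction p using FreeAlgebra.induction with
  | grade0 r => intro z; simp
  | grade1 i =>
    intro z
    induction z with
    | zero => simp
    | add x y hx hy => rw [map_add, map_add, hx, hy, map_add, map_add]
    | tmul u v =>
      simp [tauTens_ι, braidedComulGen, tauTens_braidAction]
  | mul a b ha hb =>
    intro z
    rw [map_mul, map_mul, map_mul, Module.End.mul_apply, hb, ha, Module.End.mul_apply]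
  | add a b ha hb =>
    intro z
    rw [map_add, map_add, map_add, LinearMap.add_apply, hb, ha, LinearMap.add_apply, map_add]

theorem IsGradedBiideal.map_tauTens {d : Datum k n} {J : Submodule k (Tens k n)}
    (hJ : IsGradedBiideal d J) : IsGradedBiideal d (J.map (tauTens d).toLinearMap) where
  mul_left := by
    rintro a _ ⟨p, hp, rfl⟩
    exact ⟨tauTens d a * p, hJ.mul_left _ p hp, by simp [tauTens_tauTens]⟩
  mul_right := by
    rintro a _ ⟨p, hp, rfl⟩
    exact ⟨p * tauTens d a, hJ.mul_right _ p hp, by simp [tauTens_tauTens]⟩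
  comul := by
    rintro _ ⟨p, hp, rfl⟩
    have key : TensorProduct.map (tauTens d).toLinearMap (tauTens d).toLinearMap
        (braidedComul d p) = braidedComul d (tauTens d p) := (braidedComul_tauTens d p).symm
    change braidedComul d (tauTens d p) ∈ _
    rw [← key]
    have h := hJ.comul p hp
    have hsub : ∀ x : J, tauTens d x ∈ J.map (tauTens d).toLinearMap := fun x => ⟨x, x.2, rfl⟩
    obtain ⟨_, ⟨y, rfl⟩, _, ⟨z, rfl⟩, hyz⟩ := Submodule.mem_sup.mp h
    rw [← hyz, map_add]
    clear hyz h
    refine Submodule.add_mem_sup ?_ ?_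
    · induction y with
      | zero => simp
      | add a b ha hb => rw [map_add, map_add]; exact Submodule.add_mem _ ha hb
      | tmul a b => exact ⟨⟨_, hsub a⟩ ⊗ₜ tauTens d b, by simp⟩
    · induction z with
      | zero => simp
      | add a b ha hb => rw [map_add, map_add]; exact Submodule.add_mem _ ha hb
      | tmul a b => exact ⟨tauTens d a ⊗ₜ ⟨_, hsub b⟩, by simp⟩
  graded := by
    refine (Submodule.map_mono hJ.graded).trans ?_
    rw [Submodule.map_iSup]
    refine iSup_le fun μ => le_trans ?_ (le_iSup _ fun i => μ (d.τ i))
    refine (Submodule.map_inf_le _).trans (inf_le_inf_left _ ?_)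
    rw [homog, Submodule.map_span_le]
    rintro _ ⟨l, rfl, rfl⟩
    refine Submodule.subset_span ⟨l.map d.τ, ?_, (tauTens_word d l).symm⟩
    funext i
    conv_lhs => rw [wt, ← d.τ_involutive i]
    exact List.count_map_of_injective l d.τ d.τ.injective _
  two_le := by
    refine (Submodule.map_mono hJ.two_le).trans ?_
    rw [Submodule.map_span_le]
    rintro _ ⟨l, hl, rfl⟩
    exact Submodule.subset_span ⟨l.map d.τ, by simpa using hl, (tauTens_word d l).symm⟩

/-- The maximal graded biideal `I_max(χ)`, which defines the Nichols algebras. -/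
def maxIdeal (d : Datum k n) : PreNicholsIdeal d where
  carrier := maxCarrier d
  biideal := isGradedBiideal_maxCarrier d
  τ_stable := by
    have h : (maxCarrier d).map (tauTens d).toLinearMap ≤ maxCarrier d :=
      le_sSup (isGradedBiideal_maxCarrier d).map_tauTens
    refine le_antisymm h fun p hp => ⟨tauTens d p, h ⟨p, hp, rfl⟩, tauTens_tauTens d p⟩

theorem PreNicholsIdeal.le_max {d : Datum k n} (J : PreNicholsIdeal d) :
    J.carrier ≤ (maxIdeal d).carrier := le_sSup J.biideal

theorem lift_zero {d : Datum k n} {J : Submodule k (Tens k n)} (hJ : IsGradedBiideal d J)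
    {p : Tens k n} (hp : p ∈ J) : FreeAlgebra.lift k (fun _ => (0 : k)) p = 0 := by
  have h : J ≤ LinearMap.ker (FreeAlgebra.lift k fun _ : Fin n => (0 : k)).toLinearMap := by
    refine hJ.two_le.trans (Submodule.span_le.mpr ?_)
    rintro _ ⟨l, hl, rfl⟩
    cases l with
    | nil => simp at hl
    | cons i l => simp [word]
  exact h hp

/-- The scalar `∏_{a < b} s(l_a, l_b)`. -/
def pairCoeff (s : Fin n → Fin n → k) : List (Fin n) → k
  | [] => 1
  | i :: l => pairCoeff s l * (l.map (s i)).prod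

theorem pairCoeff_perm {s : Fin n → Fin n → k} (hs : ∀ i j, s i j = s j i) {l l' : List (Fin n)}
    (h : l.Perm l') : pairCoeff s l = pairCoeff s l' := by
  induction h with
  | nil => rfl
  | cons i h ih => rw [pairCoeff, pairCoeff, ih, (h.map (s i)).prod_eq]
  | swap i j l => simp only [pairCoeff, List.map_cons, List.prod_cons, hs j i]; ring
  | trans _ _ h1 h2 => exact h1.trans h2

/-- If `lift y` annihilates a graded biideal, then so does `lift (g * y)` for commuting elements
`g i` that commute with the `y j` up to symmetric scalars. -/
theorem lift_mul_eq_zero {d : Datum k n} {J : Submodule k (Tens k n)} (hJ : IsGradedBiideal d J)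
    {A : Type*} [Ring A] [Algebra k A] (g y : Fin n → A) (s : Fin n → Fin n → k)
    (hs : ∀ i j, s i j = s j i) (hyg : ∀ i j, y i * g j = s i j • (g j * y i))
    (hgg : ∀ i j, g i * g j = g j * g i) (h0 : ∀ p ∈ J, FreeAlgebra.lift k y p = 0)
    {p : Tens k n} (hp : p ∈ J) : FreeAlgebra.lift k (fun i => g i * y i) p = 0 := by
  have hG : ∀ i (l : List (Fin n)), y i * (l.map g).prod =
      (l.map (s i)).prod • ((l.map g).prod * y i) := by
    intro i l
    induction l with
    | nil => simp
    | cons j l ih =>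
      simp only [List.map_cons, List.prod_cons]
      rw [← mul_assoc, hyg, smul_mul_assoc, mul_assoc, ih, mul_smul_comm, smul_smul, mul_assoc]
  have hword : ∀ l, FreeAlgebra.lift k (fun i => g i * y i) (word k l) =
      pairCoeff s l • ((l.map g).prod * FreeAlgebra.lift k y (word k l)) := by
    intro l
    induction l with
    | nil => simp [word, pairCoeff]
    | cons i l ih =>
      have e : word k (i :: l) = FreeAlgebra.ι k i * word k l := by simp [word]
      rw [e, map_mul, map_mul, ih, pairCoeff]
      simp only [FreeAlgebra.lift_ι_apply, List.map_cons, List.prod_cons]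
      rw [mul_smul_comm, mul_assoc (g i), ← mul_assoc (y i), hG]
      simp only [smul_mul_assoc, mul_smul_comm, smul_smul, mul_assoc]
  have hperm : ∀ l l' : List (Fin n), l.Perm l' → (l.map g).prod = (l'.map g).prod := by
    intro l l' h
    induction h with
    | nil => rfl
    | cons i h ih => simp [ih]
    | swap i j l => simp only [List.map_cons, List.prod_cons, ← mul_assoc, hgg i j]
    | trans _ _ h1 h2 => exact h1.trans h2
  have hle : J ≤ LinearMap.ker (FreeAlgebra.lift k fun i => g i * y i).toLinearMap := by
    refine hJ.graded.trans (iSup_le fun μ p hp => ?_)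
    obtain ⟨hpJ, hpμ⟩ := hp
    by_cases hμ : ∃ l₀ : List (Fin n), wt l₀ = μ
    · obtain ⟨l₀, rfl⟩ := hμ
      suffices h : FreeAlgebra.lift k (fun i => g i * y i) p =
          pairCoeff s l₀ • ((l₀.map g).prod * FreeAlgebra.lift k y p) by
        change FreeAlgebra.lift k (fun i => g i * y i) p = 0
        rw [h, h0 p hpJ, mul_zero, smul_zero]
      clear hpJ
      induction hpμ using Submodule.span_induction with
      | mem q hq =>
        obtain ⟨l, hl, rfl⟩ := hq
        have hl' : l.Perm l₀ := List.perm_iff_count.mpr fun i => congrFun hl i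
        rw [hword, pairCoeff_perm hs hl', hperm l l₀ hl']
      | zero => simp
      | add a b _ _ ha hb => rw [map_add, map_add, ha, hb, mul_add, smul_add]
      | smul c a _ ha => rw [map_smul, map_smul, ha, mul_smul_comm, smul_comm]
    · have : {l : List (Fin n) | wt l = μ} = ∅ := by
        ext l
        exact ⟨fun h => hμ ⟨l, h⟩, fun h => h.elim⟩
      simp only [SetLike.mem_coe, homog, this, Set.image_empty, Submodule.span_empty,
        Submodule.mem_bot] at hpμ
      simp [hpμ]
  exact hle hp

/-- If `b i a_j = q i j a_j b_i`, and `lift a` and `lift b` annihilate a graded biideal, then so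
does `lift (a + b)`. -/
theorem lift_add_eq_zero {d : Datum k n} {J : Submodule k (Tens k n)} (hJ : IsGradedBiideal d J)
    {A : Type*} [Ring A] [Algebra k A] (a b : Fin n → A)
    (hba : ∀ i j, b i * a j = d.q i j • (a j * b i))
    (ha : ∀ p ∈ J, FreeAlgebra.lift k a p = 0) (hb : ∀ p ∈ J, FreeAlgebra.lift k b p = 0)
    {p : Tens k n} (hp : p ∈ J) : FreeAlgebra.lift k (fun i => a i + b i) p = 0 := by
  let Φ : Tens k n ⊗[k] Tens k n →ₗ[k] A := LinearMap.mul' k A ∘ₗ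
    TensorProduct.map (FreeAlgebra.lift k a).toLinearMap (FreeAlgebra.lift k b).toLinearMap
  have hbr : ∀ i u, b i * FreeAlgebra.lift k a u =
      FreeAlgebra.lift k a (braidAction d i u) * b i := by
    intro i u
    induction u using FreeAlgebra.induction with
    | grade0 r => simp [Algebra.commutes]
    | grade1 j => simp [braidAction, hba]
    | mul u v hu hv => rw [map_mul, ← mul_assoc, hu, mul_assoc, hv, map_mul, map_mul, mul_assoc]
    | add u v hu hv => rw [map_add, mul_add, hu, hv, map_add, map_add, add_mul]
  have hΦ : ∀ p z, Φ (FreeAlgebra.lift k (braidedComulGen d) p z) =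
      FreeAlgebra.lift k (fun i => a i + b i) p * Φ z := by
    intro p
    induction p using FreeAlgebra.induction with
    | grade0 r => intro z; simp [Algebra.smul_def]
    | grade1 i =>
      intro z
      induction z with
      | zero => simp
      | add x y hx hy => rw [map_add, map_add, hx, hy, map_add, mul_add]
      | tmul u v =>
        simp [Φ, braidedComulGen, add_mul, mul_assoc]
        rw [← mul_assoc (b i), hbr, mul_assoc]
    | mul u v hu hv => intro z; rw [map_mul, map_mul, Module.End.mul_apply, hu, hv, mul_assoc]
    | add u v hu hv =>
      intro z; rw [map_add, map_add, LinearMap.add_apply, map_add, hu, hv, add_mul]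
  have h1 : FreeAlgebra.lift k (fun i => a i + b i) p = Φ (braidedComul d p) := by
    have := hΦ p (1 ⊗ₜ 1)
    rw [braidedComul, LinearMap.comp_apply]
    simpa [Φ] using this.symm
  rw [h1]
  have hle : LinearMap.range
        (TensorProduct.map J.subtype (LinearMap.id : Tens k n →ₗ[k] Tens k n)) ⊔
      LinearMap.range (TensorProduct.map (LinearMap.id : Tens k n →ₗ[k] Tens k n) J.subtype) ≤
      LinearMap.ker Φ := by
    refine sup_le ?_ ?_
    · rintro _ ⟨z, rfl⟩
      induction z with
      | zero => simp
      | add x y hx hy => rw [map_add]; exact add_mem hx hy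
      | tmul u v => simp [Φ, ha u.1 u.2]
    · rintro _ ⟨z, rfl⟩
      induction z with
      | zero => simp
      | add x y hx hy => rw [map_add]; exact add_mem hx hy
      | tmul u v => simp [Φ, hb v.1 v.2]
  exact hle (hJ.comul p hp)

/-- The algebra with generators indexed by `X` and relations `r`. -/
def Presented {X : Type*} (r : FreeAlgebra k X → FreeAlgebra k X → Prop) := RingQuot r

namespace Presented

variable {X : Type*} (r : FreeAlgebra k X → FreeAlgebra k X → Prop)

instance : Ring (Presented r) := inferInstanceAs (Ring (RingQuot r))

instance : Algebra k (Presented r) := inferInstanceAs (Algebra k (RingQuot r))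

/-- The projection of the free algebra onto the presented algebra. -/
def mk : FreeAlgebra k X →ₐ[k] Presented r := RingQuot.mkAlgHom k r

variable {r}

theorem mk_rel {x y : FreeAlgebra k X} (h : r x y) : mk r x = mk r y := RingQuot.mkAlgHom_rel k h

/-- The universal property of the presented algebra. -/
def lift {A : Type*} [Ring A] [Algebra k A] (f : FreeAlgebra k X →ₐ[k] A)
    (h : ∀ ⦃x y⦄, r x y → f x = f y) : Presented r →ₐ[k] A :=
  RingQuot.liftAlgHom k ⟨f, h⟩

theorem lift_mk {A : Type*} [Ring A] [Algebra k A] (f : FreeAlgebra k X →ₐ[k] A)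
    (h : ∀ ⦃x y⦄, r x y → f x = f y) (x : FreeAlgebra k X) : lift f h (mk r x) = f x :=
  RingQuot.liftAlgHom_mkAlgHom_apply k f h x

end Presented

/-- The relations defining the pre-Nichols algebra of an ideal. -/
inductive PreRel {d : Datum k n} (J : PreNicholsIdeal d) : Tens k n → Tens k n → Prop
  | of (p : Tens k n) (hp : p ∈ J.carrier) : PreRel J p 0

/-- The pre-Nichols algebra `T(V) / J`. It serves both as `U⁺ = T(V⁺(χ)) / J` and as
`U⁻ = T(V⁻(χ)) / ω(J)`. -/
abbrev Pre {d : Datum k n} (J : PreNicholsIdeal d) := Presented (PreRel J)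

/-- The projection of the tensor algebra onto a pre-Nichols algebra. -/
def Pre.mk {d : Datum k n} (J : PreNicholsIdeal d) : Tens k n →ₐ[k] Pre J :=
  Presented.mk (PreRel J)

/-- The generators of a pre-Nichols algebra: `E_i` in `U⁺`, and `F_i` in `U⁻`. -/
def Pre.x {d : Datum k n} (J : PreNicholsIdeal d) (i : Fin n) : Pre J :=
  Pre.mk J (FreeAlgebra.ι k i)

/-- The component of `U⁺` of degree `μ`, and the component of `U⁻` of degree `-μ`. -/
def Pre.deg {d : Datum k n} (J : PreNicholsIdeal d) (μ : Fin n → ℕ) : Submodule k (Pre J) :=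
  (homog k μ).map (Pre.mk J).toLinearMap

/-- The algebra homomorphism out of a pre-Nichols algebra given by values on generators. -/
def Pre.lift {d : Datum k n} (J : PreNicholsIdeal d) {A : Type*} [Ring A] [Algebra k A]
    (x : Fin n → A) (hJ : ∀ p ∈ J.carrier, FreeAlgebra.lift k x p = 0) : Pre J →ₐ[k] A :=
  Presented.lift (FreeAlgebra.lift k x) (by
    rintro _ _ h
    cases h with
    | of hp => rw [hJ _ hp, map_zero])

/-- Generators of the bosonizations: the generators `X i` of the pre-Nichols algebra, and the
group-like elements `K a` for `a ∈ ℤⁿ`. -/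
inductive BorelGen (n : ℕ)
  | X (i : Fin n)
  | K (a : Fin n → ℤ)

/-- The defining relations of the bosonization of a pre-Nichols algebra on which `K a` acts by
`x_i ↦ s a i x_i`. -/
inductive BorelRel {d : Datum k n} (s : (Fin n → ℤ) → Fin n → k) (J : PreNicholsIdeal d) :
    FreeAlgebra k (BorelGen n) → FreeAlgebra k (BorelGen n) → Prop
  | K_zero : BorelRel s J (FreeAlgebra.ι k (.K 0)) 1
  | K_add (a b : Fin n → ℤ) : BorelRel s J (FreeAlgebra.ι k (.K (a + b)))
      (FreeAlgebra.ι k (.K a) * FreeAlgebra.ι k (.K b))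
  | K_X (a : Fin n → ℤ) (i : Fin n) :
      BorelRel s J (FreeAlgebra.ι k (.K a) * FreeAlgebra.ι k (.X i))
        (s a i • (FreeAlgebra.ι k (.X i) * FreeAlgebra.ι k (.K a)))
  | ideal (p : Tens k n) (hp : p ∈ J.carrier) :
      BorelRel s J (FreeAlgebra.lift k (fun i => FreeAlgebra.ι k (BorelGen.X i)) p) 0

/-- The bosonization of a pre-Nichols algebra. -/
abbrev Borel {d : Datum k n} (s : (Fin n → ℤ) → Fin n → k) (J : PreNicholsIdeal d) :=
  Presented (BorelRel s J)

namespace Borel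

variable {d : Datum k n} (s : (Fin n → ℤ) → Fin n → k) (J : PreNicholsIdeal d)

/-- The generator `X i`. -/
def X (i : Fin n) : Borel s J := Presented.mk (BorelRel s J) (FreeAlgebra.ι k (.X i))

/-- The group-like element `K a`. -/
def K (a : Fin n → ℤ) : Borel s J := Presented.mk (BorelRel s J) (FreeAlgebra.ι k (.K a))

theorem K_zero : K s J 0 = 1 := by
  rw [K, Presented.mk_rel BorelRel.K_zero, map_one]

theorem K_add (a b : Fin n → ℤ) : K s J (a + b) = K s J a * K s J b := by
  rw [K, Presented.mk_rel (BorelRel.K_add a b), map_mul, K, K]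

theorem K_mul_X (a : Fin n → ℤ) (i : Fin n) : K s J a * X s J i = s a i • (X s J i * K s J a) := by
  rw [K, X, ← map_mul, Presented.mk_rel (BorelRel.K_X a i), map_smul, map_mul]

theorem lift_X {p : Tens k n} (hp : p ∈ J.carrier) : FreeAlgebra.lift k (X s J) p = 0 := by
  have h : FreeAlgebra.lift k (X s J) = (Presented.mk (BorelRel s J)).comp
      (FreeAlgebra.lift k fun i => FreeAlgebra.ι k (BorelGen.X i)) := by
    ext i
    simp [X]
  rw [h, AlgHom.comp_apply, Presented.mk_rel (BorelRel.ideal p hp), map_zero]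

/-- The algebra homomorphism out of a bosonization given by values on generators. -/
def lift {A : Type*} [Ring A] [Algebra k A] (x : Fin n → A) (g : (Fin n → ℤ) → A) (h0 : g 0 = 1)
    (hadd : ∀ a b, g (a + b) = g a * g b) (hx : ∀ a i, g a * x i = s a i • (x i * g a))
    (hJ : ∀ p ∈ J.carrier, FreeAlgebra.lift k x p = 0) : Borel s J →ₐ[k] A :=
  Presented.lift (FreeAlgebra.lift k fun
      | .X i => x i
      | .K a => g a) (by
    rintro _ _ (_ | ⟨a, b⟩ | ⟨a, i⟩ | ⟨p, hp⟩)
    · simp [h0]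
    · simp [hadd]
    · simp [hx]
    · rw [map_zero, ← hJ p hp, ← AlgHom.comp_apply]
      congr 1
      ext i
      simp)

/-- The inclusion of the pre-Nichols algebra into its bosonization. -/
def ofPre : Pre J →ₐ[k] Borel s J := Pre.lift J (X s J) fun _ hp => lift_X s J hp

/-- The canonical projection onto the bosonization of the Nichols algebra. -/
def toMax : Borel s J →ₐ[k] Borel s (maxIdeal d) :=
  lift s J (X s _) (K s _) (K_zero s _) (K_add s _) (K_mul_X s _)
    fun _ hp => lift_X s _ (J.le_max hp)

/-- The counit: `ε(X i) = 0` and `ε(K a) = 1`. -/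
def counit : Borel s J →ₐ[k] k :=
  lift s J (fun _ => 0) (fun _ => 1) rfl (by simp) (by simp) fun _ hp => lift_zero J.biideal hp

end Borel


/-- The scalar by which `K a` commutes past `E_i`: `K_a E_i = χ(a, α_i) E_i K_a`. -/
def plusScalar (d : Datum k n) (a : Fin n → ℤ) (i : Fin n) : k := (d.χ a (simpleRoot i) : k)

/-- The scalar by which `K a` commutes past `F_i`: `K_a F_i = χ(a, α_i)⁻¹ F_i K_a`. -/
def minusScalar (d : Datum k n) (a : Fin n → ℤ) (i : Fin n) : k :=
  ((d.χ a (simpleRoot i))⁻¹ : kˣ)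

theorem minusScalar_neg (d : Datum k n) (i j : Fin n) :
    minusScalar d (-simpleRoot i) j = d.q i j := by
  have h0 : d.χ 0 (simpleRoot j) = 1 := by
    have := d.χ_add_left 0 0 (simpleRoot j)
    rw [add_zero] at this
    exact (mul_eq_left.mp this.symm)
  have h := d.χ_add_left (-simpleRoot i) (simpleRoot i) (simpleRoot j)
  rw [neg_add_cancel, h0] at h
  rw [minusScalar, Datum.q, inv_eq_of_mul_eq_one_right h.symm]

/-- The Hopf algebra `U⁺ ⋊ H`, with generators `E_i = X i` and `K a`. -/
abbrev BPlus {d : Datum k n} (J : PreNicholsIdeal d) := Borel (plusScalar d) J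

/-- The Hopf algebra `H ⋉ U⁻ = (U⁻ ⋊ H)^cop`, with generators `F_i = X i` and `K a`. -/
abbrev BMinus {d : Datum k n} (J : PreNicholsIdeal d) := Borel (minusScalar d) J

theorem lift_includeLeft {A B : Type*} [Ring A] [Algebra k A] [Ring B] [Algebra k B]
    (x : Fin n → A) (p : Tens k n) : FreeAlgebra.lift k (fun i => x i ⊗ₜ[k] (1 : B)) p =
      FreeAlgebra.lift k x p ⊗ₜ 1 := by
  have h : FreeAlgebra.lift k (fun i => x i ⊗ₜ[k] (1 : B)) =
      (Algebra.TensorProduct.includeLeft : A →ₐ[k] A ⊗[k] B).comp (FreeAlgebra.lift k x) := by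
    ext i
    simp
  rw [h]
  simp

theorem lift_includeRight {A B : Type*} [Ring A] [Algebra k A] [Ring B] [Algebra k B]
    (x : Fin n → B) (p : Tens k n) : FreeAlgebra.lift k (fun i => (1 : A) ⊗ₜ[k] x i) p =
      1 ⊗ₜ FreeAlgebra.lift k x p := by
  have h : FreeAlgebra.lift k (fun i => (1 : A) ⊗ₜ[k] x i) =
      (Algebra.TensorProduct.includeRight : B →ₐ[k] A ⊗[k] B).comp (FreeAlgebra.lift k x) := by
    ext i
    simp
  rw [h]
  simp

theorem Borel.K_comm {d : Datum k n} (s : (Fin n → ℤ) → Fin n → k) (J : PreNicholsIdeal d)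
    (a b : Fin n → ℤ) : Borel.K s J a * Borel.K s J b = Borel.K s J b * Borel.K s J a := by
  rw [← Borel.K_add, add_comm, Borel.K_add]

/-- The coproduct of `U⁺ ⋊ H`: `Δ(E_i) = E_i ⊗ 1 + K_i ⊗ E_i` and `Δ(K_a) = K_a ⊗ K_a`. -/
def comulPlus {d : Datum k n} (J : PreNicholsIdeal d) : BPlus J →ₐ[k] BPlus J ⊗[k] BPlus J :=
  Borel.lift _ J
    (fun i => Borel.X _ J i ⊗ₜ 1 + Borel.K _ J (simpleRoot i) ⊗ₜ Borel.X _ J i)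
    (fun a => Borel.K _ J a ⊗ₜ Borel.K _ J a)
    (by rw [Borel.K_zero]; exact Algebra.TensorProduct.one_def.symm)
    (by intro a b; rw [Borel.K_add, Algebra.TensorProduct.tmul_mul_tmul])
    (by
      intro a i
      simp only [mul_add, add_mul, Algebra.TensorProduct.tmul_mul_tmul, Borel.K_mul_X, mul_one,
        one_mul, smul_add, TensorProduct.smul_tmul', TensorProduct.tmul_smul,
        Borel.K_comm _ J a (simpleRoot i)])
    (by
      intro p hp
      refine lift_add_eq_zero J.biideal _ _ ?_ ?_ ?_ hp
      · intro i j
        simp only [Algebra.TensorProduct.tmul_mul_tmul, Borel.K_mul_X, mul_one, one_mul,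
          TensorProduct.smul_tmul']
        rfl
      · intro p hp
        rw [lift_includeLeft, Borel.lift_X _ J hp, TensorProduct.zero_tmul]
      · intro p hp
        have := lift_mul_eq_zero J.biideal (A := BPlus J ⊗[k] BPlus J)
          (fun i => Borel.K _ J (simpleRoot i) ⊗ₜ 1) (fun i => 1 ⊗ₜ Borel.X _ J i)
          (fun _ _ => 1) (fun _ _ => rfl) (by simp)
          (by intro i j; simp [Borel.K_comm _ J (simpleRoot i)])
          (fun p hp => by rw [lift_includeRight, Borel.lift_X _ J hp, TensorProduct.tmul_zero]) hp
        simpa using this)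

/-- The coproduct of `H ⋉ U⁻`: `Δ(F_i) = F_i ⊗ K_i⁻¹ + 1 ⊗ F_i` and `Δ(K_a) = K_a ⊗ K_a`. -/
def comulMinus {d : Datum k n} (J : PreNicholsIdeal d) : BMinus J →ₐ[k] BMinus J ⊗[k] BMinus J :=
  Borel.lift _ J
    (fun i => 1 ⊗ₜ Borel.X _ J i + Borel.X _ J i ⊗ₜ Borel.K _ J (-simpleRoot i))
    (fun a => Borel.K _ J a ⊗ₜ Borel.K _ J a)
    (by rw [Borel.K_zero]; exact Algebra.TensorProduct.one_def.symm)
    (by intro a b; rw [Borel.K_add, Algebra.TensorProduct.tmul_mul_tmul])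
    (by
      intro a i
      simp only [mul_add, add_mul, Algebra.TensorProduct.tmul_mul_tmul, Borel.K_mul_X, mul_one,
        one_mul, smul_add, TensorProduct.smul_tmul', TensorProduct.tmul_smul,
        Borel.K_comm _ J a (-simpleRoot i)])
    (by
      intro p hp
      refine lift_add_eq_zero J.biideal _ _ ?_ ?_ ?_ hp
      · intro i j
        simp only [Algebra.TensorProduct.tmul_mul_tmul, Borel.K_mul_X, mul_one, one_mul,
          TensorProduct.tmul_smul]
        rw [minusScalar_neg]
      · intro p hp
        rw [lift_includeRight, Borel.lift_X _ J hp, TensorProduct.tmul_zero]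
      · intro p hp
        have := lift_mul_eq_zero J.biideal (A := BMinus J ⊗[k] BMinus J)
          (fun i => 1 ⊗ₜ Borel.K _ J (-simpleRoot i)) (fun i => Borel.X _ J i ⊗ₜ 1)
          (fun _ _ => 1) (fun _ _ => rfl) (by simp)
          (by intro i j; simp [Borel.K_comm _ J (-simpleRoot i)])
          (fun p hp => by rw [lift_includeLeft, Borel.lift_X _ J hp, TensorProduct.zero_tmul]) hp
        simpa using this)

/-- The homomorphism `σ̄ : U⁻_max → U⁺_max ⋊ H` with `σ̄(F_i) = c_{τ(i)} K_i E_{τ(i)}`. -/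
def sigmaBar (d : Datum k n) (c : Fin n → k) : Pre (maxIdeal d) →ₐ[k] BPlus (maxIdeal d) :=
  Pre.lift _ (fun i => (c (d.τ i) • Borel.K _ _ (simpleRoot i)) * Borel.X _ _ (d.τ i)) (by
    intro p hp
    refine lift_mul_eq_zero (maxIdeal d).biideal _ _
      (fun i j => (d.q j (d.τ i))⁻¹) ?_ ?_ ?_ ?_ hp
    · intro i j
      rw [← d.q_τ, d.τ_involutive, d.q_symm]
    · intro i j
      rw [smul_mul_assoc, Borel.K_mul_X, mul_smul_comm, smul_smul, smul_smul, mul_comm]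
      congr 1
      have : d.q j (d.τ i) ≠ 0 := Units.ne_zero _
      change _ = d.q j (d.τ i) * _
      field_simp
    · intro i j
      simp [Borel.K_comm _ _ (simpleRoot i), smul_smul, mul_comm]
    · intro p hp
      have h : FreeAlgebra.lift k (fun i => Borel.X (plusScalar d) (maxIdeal d) (d.τ i)) =
          (FreeAlgebra.lift k (Borel.X (plusScalar d) (maxIdeal d))).comp (tauTens d) := by
        ext i
        simp [tauTens_ι]
      rw [h, AlgHom.comp_apply, Borel.lift_X]
      have := (maxIdeal d).τ_stable
      rw [← this]
      exact ⟨p, hp, rfl⟩)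

/-! ### The skew Hopf pairing, the antipode and the two actions -/

/-- The conditions that characterize the skew Hopf pairing
`⟨ , ⟩_max : (U⁻_max ⋊ H)^cop ⊗ (U⁺_max ⋊ H) → k`. -/
structure IsSkewHopfPairing (d : Datum k n)
    (P : BMinus (maxIdeal d) →ₗ[k] BPlus (maxIdeal d) →ₗ[k] k) : Prop where
  apply_mul : ∀ y x x', P y (x * x') =
    LinearMap.mul' k k (TensorProduct.map (P.flip x') (P.flip x) (comulMinus _ y))
  mul_apply : ∀ y y' x, P (y * y') x =
    LinearMap.mul' k k (TensorProduct.map (P y) (P y') (comulPlus _ x))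
  apply_one : ∀ y, P y 1 = Borel.counit _ _ y
  one_apply : ∀ x, P 1 x = Borel.counit _ _ x
  F_E : ∀ i j, P (Borel.X _ _ i) (Borel.X _ _ j) = if i = j then 1 else 0
  K_K : ∀ i j, P (Borel.K _ _ (simpleRoot i)) (Borel.K _ _ (simpleRoot j)) = (d.q i j)⁻¹
  F_K : ∀ i j, P (Borel.X _ _ i) (Borel.K _ _ (simpleRoot j)) = 0
  K_E : ∀ i j, P (Borel.K _ _ (simpleRoot i)) (Borel.X _ _ j) = 0

/-- The skew Hopf pairing `⟨ , ⟩_max`. -/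
noncomputable def pairing (d : Datum k n) :
    BMinus (maxIdeal d) →ₗ[k] BPlus (maxIdeal d) →ₗ[k] k :=
  Classical.epsilon (IsSkewHopfPairing d)

/-- The left action `e ▷ f = ⟨π_max(f₍₁₎), e⟩ f₍₂₎` of `U⁺_max ⋊ H` on `H ⋉ U⁻`. -/
noncomputable def actL {d : Datum k n} (J : PreNicholsIdeal d) (e : BPlus (maxIdeal d))
    (f : BMinus J) : BMinus J :=
  TensorProduct.lid k (BMinus J) (TensorProduct.map
    ((pairing d).flip e ∘ₗ (Borel.toMax (minusScalar d) J).toLinearMap) LinearMap.id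
    (comulMinus J f))

/-- The right action `f ◁ e = ⟨π_max(f₍₂₎), e⟩ f₍₁₎` of `U⁺_max ⋊ H` on `H ⋉ U⁻`. -/
noncomputable def actR {d : Datum k n} (J : PreNicholsIdeal d) (f : BMinus J)
    (e : BPlus (maxIdeal d)) : BMinus J :=
  TensorProduct.rid k (BMinus J) (TensorProduct.map LinearMap.id
    ((pairing d).flip e ∘ₗ (Borel.toMax (minusScalar d) J).toLinearMap) (comulMinus J f))

/-- `S` is an antipode of `U⁺ ⋊ H`: a two-sided convolution inverse of the identity. -/
def IsAntipode {d : Datum k n} (J : PreNicholsIdeal d) (S : BPlus J →ₗ[k] BPlus J) : Prop :=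
  ∀ x, LinearMap.mul' k (BPlus J) (TensorProduct.map S LinearMap.id (comulPlus J x)) =
      algebraMap k _ (Borel.counit _ J x) ∧
    LinearMap.mul' k (BPlus J) (TensorProduct.map LinearMap.id S (comulPlus J x)) =
      algebraMap k _ (Borel.counit _ J x)

/-- `T` is the compositional inverse of the antipode of `U⁺_max ⋊ H`. -/
def IsAntipodeInv (d : Datum k n) (T : BPlus (maxIdeal d) →ₗ[k] BPlus (maxIdeal d)) : Prop :=
  ∃ S, IsAntipode (maxIdeal d) S ∧ S ∘ₗ T = LinearMap.id ∧ T ∘ₗ S = LinearMap.id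

/-- The inverse `S⁻¹` of the antipode of `U⁺_max ⋊ H`. -/
noncomputable def antipodeInv (d : Datum k n) : BPlus (maxIdeal d) →ₗ[k] BPlus (maxIdeal d) :=
  Classical.epsilon (IsAntipodeInv d)

/-! ### The quasi R-matrix and the twist product of elements of `U⁻` -/

/-- Bases `F_{μ,j}` of `(U⁻_max)_{-μ}` and `E_{μ,j}` of `(U⁺_max)_μ` for all `μ ∈ ℕⁿ` that are dual
with respect to the pairing. The quasi R-matrix is `Θ = ∑_μ (-1)^|μ| ∑_j F_{μ,j} ⊗ E_{μ,j}`. -/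
structure DualBases (d : Datum k n) where
  dim : (Fin n → ℕ) → ℕ
  F : ∀ μ, Module.Basis (Fin (dim μ)) k (Pre.deg (maxIdeal d) μ)
  E : ∀ μ, Module.Basis (Fin (dim μ)) k (Pre.deg (maxIdeal d) μ)
  dual : ∀ μ i j, pairing d (Borel.ofPre _ _ (F μ i : Pre (maxIdeal d)))
    (Borel.ofPre _ _ (E μ j : Pre (maxIdeal d))) = if i = j then 1 else 0

/-- The inclusion `ℕⁿ → ℤⁿ`. -/
def natWeight (μ : Fin n → ℕ) : Fin n → ℤ := fun i => (μ i : ℤ)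

/-- The summand of the twist product that belongs to `ρ ∈ ℕⁿ`. -/
noncomputable def twistTerm {d : Datum k n} (J : PreNicholsIdeal d) (c : Fin n → k)
    (D : DualBases d) (f g : Pre J) (ρ : Fin n → ℕ) : BMinus J :=
  (-1 : k) ^ (∑ i, ρ i) • ∑ j, actL J (sigmaBar d c (D.F ρ j)) (Borel.ofPre _ J f) *
    Borel.K _ J (natWeight ρ) *
    actR J (Borel.ofPre _ J g)
      (antipodeInv d (Borel.ofPre _ _ (D.E ρ j : Pre (maxIdeal d))) * Borel.K _ _ (natWeight ρ))

/-- The twist product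
`f ⋆ g = ∑_ρ (-1)^|ρ| (σ̄(F_ρ) ▷ f) K_ρ [g ◁ (S⁻¹(E_ρ) K_ρ)]` of `f, g ∈ U⁻`. -/
noncomputable def twist {d : Datum k n} (J : PreNicholsIdeal d) (c : Fin n → k)
    (D : DualBases d) (f g : Pre J) : BMinus J :=
  ∑ᶠ ρ : Fin n → ℕ, twistTerm J c D f g ρ

/-! ### The Drinfeld double and its subalgebras -/

/-- Generators of the Drinfeld double: `E i`, `F i`, and `K a` for `a ∈ ℤⁿ`. -/
inductive DoubleGen (n : ℕ)
  | E (i : Fin n)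
  | F (i : Fin n)
  | K (a : Fin n → ℤ)

/-- The defining relations of `U(χ) = Ũ(χ) / (J, ω(J))`. -/
inductive DoubleRel {d : Datum k n} (J : PreNicholsIdeal d) :
    FreeAlgebra k (DoubleGen n) → FreeAlgebra k (DoubleGen n) → Prop
  | K_zero : DoubleRel J (FreeAlgebra.ι k (.K 0)) 1
  | K_add (a b : Fin n → ℤ) : DoubleRel J (FreeAlgebra.ι k (.K (a + b)))
      (FreeAlgebra.ι k (.K a) * FreeAlgebra.ι k (.K b))
  | K_E (a : Fin n → ℤ) (i : Fin n) :
      DoubleRel J (FreeAlgebra.ι k (.K a) * FreeAlgebra.ι k (.E i))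
        (plusScalar d a i • (FreeAlgebra.ι k (.E i) * FreeAlgebra.ι k (.K a)))
  | K_F (a : Fin n → ℤ) (i : Fin n) :
      DoubleRel J (FreeAlgebra.ι k (.K a) * FreeAlgebra.ι k (.F i))
        (minusScalar d a i • (FreeAlgebra.ι k (.F i) * FreeAlgebra.ι k (.K a)))
  | E_F (i j : Fin n) :
      DoubleRel J
        (FreeAlgebra.ι k (.E i) * FreeAlgebra.ι k (.F j) -
          FreeAlgebra.ι k (.F j) * FreeAlgebra.ι k (.E i))
        (if i = j then
          FreeAlgebra.ι k (.K (simpleRoot i)) - FreeAlgebra.ι k (.K (-simpleRoot i)) else 0)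
  | ideal_E (p : Tens k n) (hp : p ∈ J.carrier) :
      DoubleRel J (FreeAlgebra.lift k (fun i => FreeAlgebra.ι k (DoubleGen.E i)) p) 0
  | ideal_F (p : Tens k n) (hp : p ∈ J.carrier) :
      DoubleRel J (FreeAlgebra.lift k (fun i => FreeAlgebra.ι k (DoubleGen.F i)) p) 0

/-- The Drinfeld double `U(χ)` of the pre-Nichols algebra defined by `J`. -/
abbrev Double {d : Datum k n} (J : PreNicholsIdeal d) := Presented (DoubleRel J)

namespace Double

variable {d : Datum k n} (J : PreNicholsIdeal d)

/-- The generator `E_i`. -/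
def E (i : Fin n) : Double J := Presented.mk (DoubleRel J) (FreeAlgebra.ι k (.E i))

/-- The generator `F_i`. -/
def F (i : Fin n) : Double J := Presented.mk (DoubleRel J) (FreeAlgebra.ι k (.F i))

/-- The group-like element `K_a = K_1^{a_1} ⋯ K_n^{a_n}`. -/
def K (a : Fin n → ℤ) : Double J := Presented.mk (DoubleRel J) (FreeAlgebra.ι k (.K a))

/-- The homomorphism `H ⋉ U⁻ → U(χ)`. -/
def ofBMinus : BMinus J →ₐ[k] Double J :=
  Borel.lift _ J (F J) (K J)
    (by rw [K, Presented.mk_rel DoubleRel.K_zero, map_one])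
    (by intro a b; rw [K, Presented.mk_rel (DoubleRel.K_add a b), map_mul, K, K])
    (by
      intro a i
      rw [K, F, ← map_mul, Presented.mk_rel (DoubleRel.K_F a i), map_smul, map_mul])
    (by
      intro p hp
      have h : FreeAlgebra.lift k (F J) = (Presented.mk (DoubleRel J)).comp
          (FreeAlgebra.lift k fun i => FreeAlgebra.ι k (DoubleGen.F i)) := by
        ext i
        simp [F]
      rw [h, AlgHom.comp_apply, Presented.mk_rel (DoubleRel.ideal_F p hp), map_zero])

/-- The homomorphism `U⁻ → U(χ)`. -/
def ofUMinus : Pre J →ₐ[k] Double J := (ofBMinus J).comp (Borel.ofPre _ J)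

/-- The algebra `H_θ`, generated by the elements `K_i K_{τ(i)}⁻¹`. -/
def Hθ : Subalgebra k (Double J) :=
  Algebra.adjoin k (Set.range fun i => K J (simpleRoot i - simpleRoot (d.τ i)))

/-- The partial bosonization `H_θ ⋉ U⁻`, the subalgebra generated by `H_θ` and `U⁻`. -/
def partialBos : Subalgebra k (Double J) :=
  Algebra.adjoin k ((Hθ J : Set (Double J)) ∪ Set.range (F J))

/-- The generators `B_i = F_i + c_i E_{τ(i)} K_i⁻¹` of the coideal subalgebra. -/
def B (c : Fin n → k) (i : Fin n) : Double J :=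
  F J i + c i • (E J (d.τ i) * K J (-simpleRoot i))

/-- The coideal subalgebra `B_c`. -/
def coideal (c : Fin n → k) : Subalgebra k (Double J) :=
  Algebra.adjoin k ((Hθ J : Set (Double J)) ∪ Set.range (B J c))

/-- The monomial `F_l = F_{l₁} F_{l₂} ⋯`. -/
def Fword (l : List (Fin n)) : Double J := (l.map (F J)).prod

/-- The monomial `B_l = B_{l₁} B_{l₂} ⋯`. -/
def Bword (c : Fin n → k) (l : List (Fin n)) : Double J := (l.map (B J c)).prod

/-- The component of degree `m` of the `ℕ`-graded algebra `H_θ ⋉ U⁻`, in which `H_θ` has degree `0`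
and the `F_i` have degree `1`. -/
def grade (m : ℕ) : Submodule k (partialBos J) :=
  Submodule.span k {x | ∃ h ∈ Hθ J, ∃ l : List (Fin n), l.length = m ∧ (x : Double J) = h * Fword J l}

/-- The part of filtration degree at most `m` of `B_c`, where `H_θ` has degree `0` and the `B_i`
have degree `1`. -/
def filtLE (c : Fin n → k) (m : ℕ) : Submodule k (Double J) :=
  Submodule.span k {x | ∃ h ∈ Hθ J, ∃ l : List (Fin n), l.length ≤ m ∧ x = h * Bword J c l}

/-- The part of filtration degree less than `m` of `B_c`. -/
def filtLT (c : Fin n → k) (m : ℕ) : Submodule k (Double J) :=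
  Submodule.span k {x | ∃ h ∈ Hθ J, ∃ l : List (Fin n), l.length < m ∧ x = h * Bword J c l}

/-- The component of degree `m` of the associated graded algebra `gr(B_c)`. -/
abbrev Gr (c : Fin n → k) (m : ℕ) :=
  filtLE J c m ⧸ (filtLT J c m).comap (filtLE J c m).subtype

/-- The homomorphism `φ : gr(B_c) → H_θ ⋉ U⁻` of graded algebras with `φ(B_i) = F_i` and `φ(h) = h`
is an isomorphism. In degree `m` the map `φ` is determined by `φ(h B_l) = h F_l` for words `l` of
length `m`, since the classes of the `h B_l` span that component. -/
def PhiIsIso (c : Fin n → k) : Prop :=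
  ∃ φ : ∀ m, Gr J c m ≃ₗ[k] grade J m, ∀ m, ∀ h ∈ Hθ J, ∀ l : List (Fin n), l.length = m →
    ∀ x : filtLE J c m, (x : Double J) = h * Bword J c l →
      ((φ m (Submodule.Quotient.mk x) : partialBos J) : Double J) = h * Fword J l

/-- The subalgebra `U(χ)^poly`, generated by all `F_i`, `E_i K_i⁻¹`, `K_i⁻¹`, `K_i K_{τ(i)}⁻¹`. -/
def poly : Subalgebra k (Double J) :=
  Algebra.adjoin k (Set.range (F J) ∪ (Set.range fun i => E J i * K J (-simpleRoot i)) ∪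
    (Set.range fun i => K J (-simpleRoot i)) ∪
    Set.range fun i => K J (simpleRoot i - simpleRoot (d.τ i)))

/-- The left ideal of `U(χ)^poly` generated by all `E_i K_i⁻¹` and `K_i⁻¹`. -/
def polyKer : Submodule k (Double J) :=
  Submodule.span k {x | ∃ u ∈ poly J, ∃ i : Fin n,
    x = u * (E J i * K J (-simpleRoot i)) ∨ x = u * K J (-simpleRoot i)}

/-- The projection `ψ : U(χ)^poly → H_θ ⋉ U⁻` along the left ideal generated by all `E_i K_i⁻¹` and
`K_i⁻¹`: the element `ψ(x)` is the element of `H_θ ⋉ U⁻` with `x - ψ(x)` in that left ideal. -/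
noncomputable def psi (x : Double J) : partialBos J :=
  Classical.epsilon fun a : partialBos J => x - (a : Double J) ∈ polyKer J

/-- The restriction `ψ : B_c → H_θ ⋉ U⁻`. -/
noncomputable def psiB (c : Fin n → k) (b : coideal J c) : partialBos J := psi J (b : Double J)

/-- The product `a * b = ψ(ψ⁻¹(a) ψ⁻¹(b))` on `H_θ ⋉ U⁻`, which is defined when `ψ : B_c → H_θ ⋉ U⁻`
is bijective. -/
noncomputable def firstStar (c : Fin n → k) (a b : partialBos J) : partialBos J :=
  psiB J c (Function.invFun (psiB J c) a * Function.invFun (psiB J c) b)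

/-- The skew derivations `∂_i^L` and `∂_i^R` of `U⁻`:
`[E_i, f] = K_i ∂_i^L(f) - ∂_i^R(f) K_i⁻¹` for all `f ∈ U⁻`. -/
def IsSkewDerivations (δ : (Fin n → Pre J →ₗ[k] Pre J) × (Fin n → Pre J →ₗ[k] Pre J)) : Prop :=
  ∀ i f, E J i * ofUMinus J f - ofUMinus J f * E J i =
    K J (simpleRoot i) * ofUMinus J (δ.1 i f) - ofUMinus J (δ.2 i f) * K J (-simpleRoot i)

/-- The group `ℤⁿ_θ` of all `a ∈ ℤⁿ` with `-τ(a) = a`. -/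
def Zθ (d : Datum k n) : Set (Fin n → ℤ) := {a | -(a ∘ d.τ.symm) = a}

/-- The bilinear operation `⋆` on `H_θ ⋉ U⁻` is given by
`(K_a f) ⋆ (K_b g) = χ(α, b) K_{a+b} (f ⋆ g)` for `a, b ∈ ℤⁿ_θ`, `f ∈ U⁻_{-α}` and `g ∈ U⁻`. -/
def IsTwistProduct (c : Fin n → k) (D : DualBases d)
    (star : partialBos J →ₗ[k] partialBos J →ₗ[k] partialBos J) : Prop :=
  ∀ a ∈ Zθ d, ∀ b ∈ Zθ d, ∀ α : Fin n → ℕ, ∀ f ∈ Pre.deg J α, ∀ g : Pre J,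
    ∀ x y : partialBos J, (x : Double J) = K J a * ofUMinus J f →
      (y : Double J) = K J b * ofUMinus J g →
      (star x y : Double J) =
        (d.χ (natWeight α) b : k) • (K J (a + b) * ofBMinus J (twist J c D f g))

end Double

end Setting

/-- A star product on an `ℕ`-graded algebra `A = ⨁ A_j`: an associative bilinear operation with
`a * b - a b ∈ A_{< m + n}` for `a ∈ A_m` and `b ∈ A_n`. -/
structure IsStarProduct {k A : Type*} [Field k] [Ring A] [Algebra k A] (𝒜 : ℕ → Submodule k A)
    (star : A →ₗ[k] A →ₗ[k] A) : Prop where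
  assoc : ∀ a b c, star (star a b) c = star a (star b c)
  sub_mem : ∀ m n, ∀ a ∈ 𝒜 m, ∀ b ∈ 𝒜 n, star a b - a * b ∈ ⨆ j < m + n, 𝒜 j

/-- The operation is `0`-equivariant: it agrees with multiplication if one factor is in `A_0`. -/
def IsZeroEquivariant {k A : Type*} [Field k] [Ring A] [Algebra k A] (𝒜 : ℕ → Submodule k A)
    (star : A →ₗ[k] A →ₗ[k] A) : Prop :=
  ∀ h ∈ 𝒜 0, ∀ a, star a h = a * h ∧ star h a = h * a

end PartialBosonization

open PartialBosonization

/-! The proof never manipulates the sum over `ρ` more than once: it extracts from it the operators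
of left multiplication by generators, and everything else is induction on the left factor.

Extend the formula for `⋆` to a bilinear operation `starB` on all of H ⋉ U⁻, and let `starGen i` be
the operator y ↦ F_i y + c_i q_{iτ(i)} K_{τ(i)} K_i⁻¹ (y ◁ E_{τ(i)}). The central identity
`starB_starGen` reads (starGen_i y) ⋆ z = starGen_i (y ⋆ z). To see it, move F_i out of σ̄(F_ρ) ▷
(F_i y); the price is a term with ∂^L_{τ(i)}(F_ρ) in place of F_ρ (`twistL_X_mul`). Since ∂_i^L is
adjoint to left multiplication by E_i, the canonical element F_ρ ⊗ E_ρ converts this derivation into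
a factor E_{τ(i)} on the other side, which acts on z as ◁ E_{τ(i)} (`canonicalSum_shift`). After
shifting ρ by α_{τ(i)} these are exactly the terms that the skew Leibniz rule produces in starGen_i
(y ⋆ z).

Since 1 ⋆ z = z, and since the starGen_i together with the K_a for τ(a) = -a generate H_θ ⋉ U⁻ from
1 (`bosθ_le_of_starGen`), induction on the left factor yields stability of H_θ ⋉ U⁻, associativity
and independence of the dual bases; a refined induction on length controls the leading term.

For the second part, left multiplication by B_i on U(χ)^poly induces modulo the left ideal the same
operator starGen_i on H_θ ⋉ U⁻ (`B_mul_sub_mem_polyKer`). Hence ψ(xy) = ψ(x) ⋆ ψ(y) on B_c and ψ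
maps B_c onto H_θ ⋉ U⁻. If φ is an isomorphism, an element of the kernel of ψ has zero leading term
in every filtration degree, so ψ is injective on B_c (`eq_zero_of_mem_filtLT`).

All objects are given by generators and relations, so their structure has to be established as well.
The maximal biideal is the radical of an explicit form on the tensor algebra
(`maxIdeal_carrier_eq`). Two families of commuting skew derivations `RR`, `CC` of H ⋉ U⁻ satisfy the
relations of the maximal biideal, because their counits compute this form; they give the two actions
of U⁺_max ⋊ H, and ⟨y, x⟩ = ε(x ▷ y) is the pairing. Finally U(χ) acts on H ⋉ U⁻ (`verma`). Acting
on 1 embeds H ⋉ U⁻ into U(χ) and shows that the decomposition of U(χ)^poly is direct: H_θ ⋉ U⁻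
produces weights with a + τ(a) = 0, the left ideal weights with a + τ(a) < 0. -/

namespace PartialBosonization

/-! ### Bicharacter identities on ℤⁿ -/

section Scalars

variable {k : Type*} [Field k] {n : ℕ}

/-- The simple roots generate ℤⁿ as a group; this carries the hypotheses on the matrix `q` over to
the whole bicharacter. -/
theorem lattice_induction {p : (Fin n → ℤ) → Prop} (zero : p 0) (simple : ∀ i, p (simpleRoot i))
    (add : ∀ a b, p a → p b → p (a + b)) (neg : ∀ a, p a → p (-a)) (a : Fin n → ℤ) : p a := by
  let S : AddSubgroup (Fin n → ℤ) :=
    { carrier := {a | p a}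
      zero_mem' := zero
      add_mem' := fun {a b} ha hb => add a b ha hb
      neg_mem' := fun {a} ha => neg a ha }
  have h : a = ∑ i, a i • simpleRoot i := by
    funext j
    simp [simpleRoot, Finset.sum_apply, Pi.single_apply]
  have : a ∈ S := by
    rw [h]
    exact sum_mem fun i _ => zsmul_mem (simple i : simpleRoot i ∈ S) _
  exact this

namespace Datum

/-- The bicharacter with values in the field. -/
def chi (d : Datum k n) (a b : Fin n → ℤ) : k := (d.χ a b : k)

variable (d : Datum k n)

theorem chi_ne_zero (a b : Fin n → ℤ) : d.chi a b ≠ 0 := Units.ne_zero _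

theorem chi_add_left (a b c : Fin n → ℤ) : d.chi (a + b) c = d.chi a c * d.chi b c := by
  simp [chi, d.χ_add_left]

theorem chi_add_right (a b c : Fin n → ℤ) : d.chi a (b + c) = d.chi a b * d.chi a c := by
  simp [chi, d.χ_add_right]

theorem chi_zero_left (a : Fin n → ℤ) : d.chi 0 a = 1 := by
  have h := d.chi_add_left 0 0 a
  rw [add_zero] at h
  exact mul_left_cancel₀ (d.chi_ne_zero 0 a) (by rw [← h, mul_one])

theorem chi_zero_right (a : Fin n → ℤ) : d.chi a 0 = 1 := by
  have h := d.chi_add_right a 0 0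
  rw [add_zero] at h
  exact mul_left_cancel₀ (d.chi_ne_zero a 0) (by rw [← h, mul_one])

theorem chi_neg_left (a b : Fin n → ℤ) : d.chi (-a) b = (d.chi a b)⁻¹ := by
  refine eq_inv_of_mul_eq_one_left ?_
  rw [← chi_add_left, neg_add_cancel, chi_zero_left]

theorem chi_neg_right (a b : Fin n → ℤ) : d.chi a (-b) = (d.chi a b)⁻¹ := by
  refine eq_inv_of_mul_eq_one_left ?_
  rw [← chi_add_right, neg_add_cancel, chi_zero_right]

theorem chi_simple (i j : Fin n) : d.chi (simpleRoot i) (simpleRoot j) = d.q i j := rfl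

theorem q_ne_zero (i j : Fin n) : d.q i j ≠ 0 := Units.ne_zero _

theorem chi_comm (a b : Fin n → ℤ) : d.chi a b = d.chi b a := by
  induction a using lattice_induction with
  | zero => rw [chi_zero_left, chi_zero_right]
  | simple i =>
    induction b using lattice_induction with
    | zero => rw [chi_zero_left, chi_zero_right]
    | simple j => exact d.q_symm i j
    | add a b ha hb => rw [chi_add_left, chi_add_right, ha, hb]
    | neg a ha => rw [chi_neg_left, chi_neg_right, ha]
  | add a b ha hb => rw [chi_add_left, chi_add_right, ha, hb]
  | neg a ha => rw [chi_neg_left, chi_neg_right, ha]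

theorem τ_symm (i : Fin n) : d.τ.symm i = d.τ i := by
  rw [Equiv.symm_apply_eq, d.τ_involutive]

/-- The involution `τ` of `ℤⁿ`. -/
def tau (a : Fin n → ℤ) : Fin n → ℤ := a ∘ d.τ

theorem tau_simple (i : Fin n) : d.tau (simpleRoot i) = simpleRoot (d.τ i) := by
  funext j
  simp only [tau, simpleRoot, Function.comp_apply, Pi.single_apply]
  congr 1
  exact propext ⟨fun h => by rw [← h, d.τ_involutive], fun h => by rw [h, d.τ_involutive]⟩

theorem tau_add (a b : Fin n → ℤ) : d.tau (a + b) = d.tau a + d.tau b := rfl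

theorem tau_neg (a : Fin n → ℤ) : d.tau (-a) = -d.tau a := rfl

theorem tau_zero : d.tau 0 = 0 := rfl

theorem tau_tau (a : Fin n → ℤ) : d.tau (d.tau a) = a := by
  funext j
  simp [tau, d.τ_involutive]

theorem chi_tau (a b : Fin n → ℤ) : d.chi (d.tau a) (d.tau b) = d.chi a b := by
  induction a using lattice_induction with
  | zero => rw [tau_zero, chi_zero_left, chi_zero_left]
  | simple i =>
    induction b using lattice_induction with
    | zero => rw [tau_zero, chi_zero_right, chi_zero_right]
    | simple j => rw [tau_simple, tau_simple]; exact d.q_τ i j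
    | add a b ha hb => rw [tau_add, chi_add_right, chi_add_right, ha, hb]
    | neg a ha => rw [tau_neg, chi_neg_right, chi_neg_right, ha]
  | add a b ha hb => rw [tau_add, chi_add_left, chi_add_left, ha, hb]
  | neg a ha => rw [tau_neg, chi_neg_left, chi_neg_left, ha]

theorem minusScalar_eq (a : Fin n → ℤ) (i : Fin n) :
    minusScalar d a i = (d.chi a (simpleRoot i))⁻¹ := by
  simp [minusScalar, chi]

theorem plusScalar_eq (a : Fin n → ℤ) (i : Fin n) :
    plusScalar d a i = d.chi a (simpleRoot i) := rfl

end Datum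

/-- Every element of `ℤⁿ_θ` is orthogonal to the `a + τ(a)`. -/
theorem Datum.chi_θ (d : Datum k n) {a : Fin n → ℤ} (ha : d.tau a = -a) (b : Fin n → ℤ) :
    d.chi (d.tau b) a = (d.chi b a)⁻¹ := by
  rw [← d.chi_tau, d.tau_tau, ha, d.chi_neg_right]

theorem mem_Zθ_iff (d : Datum k n) (a : Fin n → ℤ) : a ∈ Double.Zθ d ↔ d.tau a = -a := by
  have h : a ∘ d.τ.symm = d.tau a := by
    funext j
    simp [Datum.tau, d.τ_symm]
  rw [Double.Zθ, Set.mem_ofPred_eq, h, neg_eq_iff_eq_neg]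

/-- The weight of a word, as an element of `ℤⁿ`. -/
def zwt (l : List (Fin n)) : Fin n → ℤ := fun i => (l.count i : ℤ)

theorem zwt_nil : zwt ([] : List (Fin n)) = 0 := rfl

theorem zwt_cons (i : Fin n) (l : List (Fin n)) : zwt (i :: l) = simpleRoot i + zwt l := by
  funext j
  simp only [zwt, List.count_cons, Pi.add_apply, simpleRoot, Pi.single_apply, beq_iff_eq]
  by_cases h : i = j
  · subst h; simp [add_comm]
  · simp [h, Ne.symm h]

theorem zwt_eq (l : List (Fin n)) : zwt l = natWeight (wt l) := rfl

end Scalars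

/-! ### Words and skew derivations of the tensor algebra -/

section Words

variable {k : Type*} [Field k] {n : ℕ}

theorem word_nil : word k ([] : List (Fin n)) = 1 := rfl

theorem word_cons (i : Fin n) (l : List (Fin n)) :
    word k (i :: l) = FreeAlgebra.ι k i * word k l := by simp [word]

theorem word_append (l l' : List (Fin n)) : word k (l ++ l') = word k l * word k l' := by
  simp [word]

theorem lift_word {A : Type*} [Ring A] [Algebra k A] (x : Fin n → A) (l : List (Fin n)) :
    FreeAlgebra.lift k x (word k l) = (l.map x).prod := by
  simp [word, map_list_prod, Function.comp_def]

theorem span_words : Submodule.span k (Set.range (word k (n := n))) = ⊤ := by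
  rw [eq_top_iff]
  rintro p -
  have hmul : ∀ u ∈ Submodule.span k (Set.range (word k (n := n))),
      ∀ v ∈ Submodule.span k (Set.range (word k (n := n))),
      u * v ∈ Submodule.span k (Set.range (word k (n := n))) := by
    intro u hu v hv
    have := Submodule.mul_mem_mul hu hv
    rw [Submodule.span_mul_span] at this
    refine Submodule.span_mono ?_ this
    rintro _ ⟨_, ⟨l, rfl⟩, _, ⟨l', rfl⟩, rfl⟩
    exact ⟨l ++ l', word_append l l'⟩
  induction p using FreeAlgebra.induction with
  | grade0 r =>
    rw [Algebra.algebraMap_eq_smul_one]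
    exact Submodule.smul_mem _ _ (Submodule.subset_span ⟨[], rfl⟩)
  | grade1 i => exact Submodule.subset_span ⟨[i], by simp [word]⟩
  | mul u v hu hv => exact hmul u hu v hv
  | add u v hu hv => exact add_mem hu hv

/-- Two linear maps on the tensor algebra agree if they agree on words. -/
theorem tens_ext {M : Type*} [AddCommMonoid M] [Module k M] {f g : Tens k n →ₗ[k] M}
    (h : ∀ l, f (word k l) = g (word k l)) : f = g :=
  LinearMap.ext_on_range span_words h

/-- The operators below are specified by their effect on `E_i u`, so the multiplicative step adds a
single letter on the left. -/
theorem tens_induction {p : Tens k n → Prop} (zero : p 0) (one : p 1)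
    (mul : ∀ i u, p u → p (FreeAlgebra.ι k i * u)) (add : ∀ u v, p u → p v → p (u + v))
    (smul : ∀ (c : k) u, p u → p (c • u)) (u : Tens k n) : p u := by
  have hw : ∀ l, p (word k l) := by
    intro l
    induction l with
    | nil => exact one
    | cons i l ih => rw [word_cons]; exact mul i _ ih
  have hu : u ∈ Submodule.span k (Set.range (word k (n := n))) := by rw [span_words]; trivial
  induction hu using Submodule.span_induction with
  | mem _ h => obtain ⟨l, rfl⟩ := h; exact hw l
  | zero => exact zero
  | add u v _ _ hu hv => exact add u v hu hv
  | smul c u _ hu => exact smul c u hu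

/-- The counit of the tensor algebra. -/
def tensCounit (k : Type*) [Field k] (n : ℕ) : Tens k n →ₐ[k] k :=
  FreeAlgebra.lift k fun _ => 0

@[simp] theorem tensCounit_ι (i : Fin n) : tensCounit k n (FreeAlgebra.ι k i) = 0 := by
  simp [tensCounit]

/-- The endomorphisms of `T ⊕ T` that define a linear map `δ` with `δ(1) = 0` and
`δ(E_j u) = s_j E_j δ(u) + e_j(u)`. -/
def recGen (s : Fin n → k) (e : Fin n → Module.End k (Tens k n)) (j : Fin n) :
    Module.End k (Tens k n × Tens k n) :=
  LinearMap.prod (LinearMap.mulLeft k (FreeAlgebra.ι k j) ∘ₗ LinearMap.fst k _ _)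
    (s j • LinearMap.mulLeft k (FreeAlgebra.ι k j) ∘ₗ LinearMap.snd k _ _ +
      e j ∘ₗ LinearMap.fst k _ _)

/-- The linear map `δ` of the tensor algebra with `δ(1) = 0` and
`δ(E_j u) = s_j E_j δ(u) + e_j(u)`. -/
def recMap (s : Fin n → k) (e : Fin n → Module.End k (Tens k n)) : Module.End k (Tens k n) :=
  LinearMap.snd k _ _ ∘ₗ LinearMap.applyₗ ((1, 0) : Tens k n × Tens k n) ∘ₗ
    (FreeAlgebra.lift k (recGen s e)).toLinearMap

/-- The first component merely records the product formed so far, so that the recursion for the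
second one has `u` at its disposal. -/
theorem recGen_fst (s : Fin n → k) (e : Fin n → Module.End k (Tens k n)) (p : Tens k n) (z) :
    (FreeAlgebra.lift k (recGen s e) p z).1 = p * z.1 := by
  induction p using tens_induction generalizing z with
  | zero => simp
  | one => simp
  | mul i u hu => simp [recGen, hu, mul_assoc]
  | add u v hu hv => simp [hu, hv, add_mul]
  | smul c u hu => simp [hu]

theorem recMap_one (s : Fin n → k) (e : Fin n → Module.End k (Tens k n)) : recMap s e 1 = 0 := by
  simp [recMap]

theorem recMap_mul (s : Fin n → k) (e : Fin n → Module.End k (Tens k n)) (j : Fin n)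
    (u : Tens k n) :
    recMap s e (FreeAlgebra.ι k j * u) = s j • (FreeAlgebra.ι k j * recMap s e u) + e j u := by
  have h := recGen_fst s e u (1, 0)
  simp only [recMap, LinearMap.comp_apply, LinearMap.applyₗ_apply_apply, AlgHom.toLinearMap_apply,
    map_mul, FreeAlgebra.lift_ι_apply, Module.End.mul_apply]
  simp [recGen, h]

variable (d : Datum k n)

@[simp] theorem braidAction_ι (i j : Fin n) :
    braidAction d i (FreeAlgebra.ι k j) = d.q i j • FreeAlgebra.ι k j := by
  simp [braidAction]

/-- The left skew derivation `δ(E_j u) = δ_{ij} u + q_{ij} E_j δ(u)`. -/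
def dL (i : Fin n) : Module.End k (Tens k n) :=
  recMap (d.q i) fun j => if i = j then 1 else 0

/-- The right skew derivation `δ(E_j u) = δ_{ij} K_i · u + E_j δ(u)`. -/
def dR (i : Fin n) : Module.End k (Tens k n) :=
  recMap (fun _ => 1) fun j => if i = j then (braidAction d i).toLinearMap else 0

@[simp] theorem dL_one (i : Fin n) : dL d i 1 = 0 := recMap_one _ _

@[simp] theorem dR_one (i : Fin n) : dR d i 1 = 0 := recMap_one _ _

theorem dL_ι_mul (i j : Fin n) (u : Tens k n) :
    dL d i (FreeAlgebra.ι k j * u) =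
      d.q i j • (FreeAlgebra.ι k j * dL d i u) + if i = j then u else 0 := by
  rw [dL, recMap_mul]
  split_ifs <;> rfl

theorem dR_ι_mul (i j : Fin n) (u : Tens k n) :
    dR d i (FreeAlgebra.ι k j * u) =
      FreeAlgebra.ι k j * dR d i u + if i = j then braidAction d i u else 0 := by
  rw [dR, recMap_mul, one_smul]
  split_ifs <;> rfl

/-- The defining recursion of `dR` removes letters from the left end and pays for the letters to the
right of the removed one. Read from the right end it is the mirror image of the recursion of `dL`.
-/
theorem dR_mul_ι (i j : Fin n) (u : Tens k n) :
    dR d i (u * FreeAlgebra.ι k j) =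
      d.q i j • (dR d i u * FreeAlgebra.ι k j) + if i = j then u else 0 := by
  induction u using tens_induction with
  | zero => simp
  | one =>
    have := dR_ι_mul d i j 1
    rw [mul_one] at this
    simp [this]
  | mul l u hu =>
    rw [mul_assoc, dR_ι_mul, dR_ι_mul, hu, map_mul, braidAction_ι]
    split_ifs <;> (simp [mul_add, add_mul, mul_assoc]; try abel)
  | add u v hu hv =>
    rw [add_mul, map_add, hu, hv, map_add, add_mul, smul_add]
    split_ifs <;> abel
  | smul c u hu =>
    rw [smul_mul_assoc, map_smul, hu, map_smul, smul_add, smul_mul_assoc, smul_comm]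
    split_ifs <;> simp

theorem dL_braidAction (i j : Fin n) (u : Tens k n) :
    dL d i (braidAction d j u) = d.q i j • braidAction d j (dL d i u) := by
  induction u using tens_induction with
  | zero => simp
  | one => simp
  | mul l u hu =>
    rw [map_mul, braidAction_ι, smul_mul_assoc, map_smul, dL_ι_mul, hu, dL_ι_mul, map_add, map_smul,
      map_mul, braidAction_ι]
    split_ifs with h
    · subst h
      simp only [smul_add, mul_smul_comm, smul_mul_assoc, smul_smul, d.q_symm i j]
    · simp only [smul_add, mul_smul_comm, smul_mul_assoc, smul_smul, smul_zero, map_zero]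
      congr 2; ring
  | add u v hu hv => simp only [map_add, hu, hv, smul_add]
  | smul c u hu => simp only [map_smul, hu, smul_comm c]

/-- The two derivations remove letters from opposite ends. In the inductive step they interact only
through the term `K_j · u`, past which `dL` moves with the same scalar as past the letter `E_j`. -/
theorem dL_dR (i j : Fin n) (u : Tens k n) : dL d i (dR d j u) = dR d j (dL d i u) := by
  induction u using tens_induction with
  | zero => simp
  | one => simp
  | mul l u hu =>
    rw [dR_ι_mul, dL_ι_mul, map_add, map_add, map_smul, dL_ι_mul, dR_ι_mul, hu]
    split_ifs with h h' <;> simp [dL_braidAction, *]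
    abel
  | add u v hu hv => simp only [map_add, hu, hv]
  | smul c u hu => simp only [map_smul, hu]

/-- After one derivation the counit sees only the component of `u` of degree one, where the two
derivations agree. -/
theorem tensCounit_dL_eq_dR (i : Fin n) (u : Tens k n) :
    tensCounit k n (dL d i u) = tensCounit k n (dR d i u) := by
  have hb : ∀ v, tensCounit k n (braidAction d i v) = tensCounit k n v := by
    intro v
    have : (tensCounit k n).comp (braidAction d i) = tensCounit k n := by ext l; simp
    exact congrArg (fun f => f v) this
  induction u using tens_induction with
  | zero => simp
  | one => simp
  | mul l u hu =>
    rw [dL_ι_mul, dR_ι_mul]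
    split_ifs <;> simp [hb]
  | add u v hu hv => simp only [map_add, hu, hv]
  | smul c u hu => simp only [map_smul, hu]

end Words

/-! ### Tensors annihilated by families of functionals -/

section LinearAlgebra

variable {k V W X Y : Type*} [Field k] [AddCommGroup V] [Module k V] [AddCommGroup W] [Module k W]

/-- Expand `z` along a basis of `W`: every coefficient in `V` is annihilated by all `β x`, hence
vanishes. -/
theorem tensor_eq_zero_of_forall (β : X → V →ₗ[k] k) (hβ : ∀ v, (∀ x, β x v = 0) → v = 0)
    {z : V ⊗[k] W} (hz : ∀ x, TensorProduct.map (β x) (LinearMap.id : W →ₗ[k] W) z = 0) :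
    z = 0 := by
  classical
  let c := Module.Basis.ofVectorSpace k W
  let e := TensorProduct.equivFinsuppOfBasisRight (M := V) c
  refine e.map_eq_zero_iff.mp (Finsupp.ext fun i => hβ _ fun x => ?_)
  have key : ∀ y : V ⊗[k] W, β x (e y i) =
      c.repr (TensorProduct.lid k W (TensorProduct.map (β x) LinearMap.id y)) i := by
    intro y
    induction y with
    | zero => simp
    | add a b ha hb => simp only [map_add, Finsupp.add_apply, ha, hb]
    | tmul v w => simp [e, mul_comm]
  rw [key, hz x]
  simp

/-- An element of a tensor product that is killed by all `β x ⊗ γ y` lies in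
`ker β ⊗ W + V ⊗ ker γ`. -/
theorem mem_sup_range_of_forall (β : X → V →ₗ[k] k) (γ : Y → W →ₗ[k] k) (R : Submodule k V)
    (R' : Submodule k W) (hR : ∀ v, v ∈ R ↔ ∀ x, β x v = 0) (hR' : ∀ w, w ∈ R' ↔ ∀ y, γ y w = 0)
    {z : V ⊗[k] W} (hz : ∀ x y, TensorProduct.map (β x) (γ y) z = 0) :
    z ∈ LinearMap.range (TensorProduct.map R.subtype (LinearMap.id : W →ₗ[k] W)) ⊔
      LinearMap.range (TensorProduct.map (LinearMap.id : V →ₗ[k] V) R'.subtype) := by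
  -- The functionals descend to the quotients by their common kernels and separate points there.
  -- Thus `z` vanishes in `V/R ⊗ W/R'`, and the claim is the description of the kernel of a tensor
  -- product of surjections.
  let β' : X → (V ⧸ R) →ₗ[k] k := fun x => R.liftQ (β x) fun v hv => (hR v).mp hv x
  let γ' : Y → (W ⧸ R') →ₗ[k] k := fun y => R'.liftQ (γ y) fun v hv => (hR' v).mp hv y
  have hβ' : ∀ v, (∀ x, β' x v = 0) → v = 0 := by
    intro v hv
    obtain ⟨v, rfl⟩ := R.mkQ_surjective v
    rw [Submodule.mkQ_apply, Submodule.Quotient.mk_eq_zero, hR]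
    exact hv
  have hγ' : ∀ v, (∀ y, γ' y v = 0) → v = 0 := by
    intro v hv
    obtain ⟨v, rfl⟩ := R'.mkQ_surjective v
    rw [Submodule.mkQ_apply, Submodule.Quotient.mk_eq_zero, hR']
    exact hv
  have h0 : TensorProduct.map R.mkQ R'.mkQ z = 0 := by
    refine tensor_eq_zero_of_forall β' hβ' fun x => ?_
    rw [← (TensorProduct.lid k _).map_eq_zero_iff]
    refine hγ' _ fun y => ?_
    have key : ∀ t : V ⊗[k] W, γ' y (TensorProduct.lid k _ (TensorProduct.map (β' x) LinearMap.id
        (TensorProduct.map R.mkQ R'.mkQ t))) =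
        TensorProduct.lid k k (TensorProduct.map (β x) (γ y) t) := by
      intro t
      induction t with
      | zero => simp
      | add a b ha hb => simp only [map_add, ha, hb]
      | tmul v w =>
      simp only [TensorProduct.map_tmul, TensorProduct.lid_tmul, LinearMap.id_apply, map_smul]
      rfl
    rw [key, hz, map_zero]
  have h1 : z ∈ LinearMap.ker (TensorProduct.map R.mkQ R'.mkQ) := h0
  rw [TensorProduct.map_ker (LinearMap.exact_subtype_mkQ R) R.mkQ_surjective (LinearMap.exact_subtype_mkQ R')
    R'.mkQ_surjective] at h1
  rwa [sup_comm] at h1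

end LinearAlgebra

/-! ### The bilinear form on the tensor algebra -/

section Form

variable {k : Type*} [Field k] {n : ℕ} (d : Datum k n)

/-- The reversal of words. -/
def rev (k : Type*) [Field k] (n : ℕ) : Tens k n →ₗ[k] Tens k n :=
  (MulOpposite.opLinearEquiv k).symm.toLinearMap ∘ₗ
    (FreeAlgebra.lift k fun i : Fin n => MulOpposite.op (FreeAlgebra.ι k i)).toLinearMap

@[simp] theorem rev_one : rev k n 1 = 1 := by simp [rev]

theorem rev_ι_mul (i : Fin n) (u : Tens k n) :
    rev k n (FreeAlgebra.ι k i * u) = rev k n u * FreeAlgebra.ι k i := by simp [rev]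

theorem rev_mul_ι (i : Fin n) (u : Tens k n) :
    rev k n (u * FreeAlgebra.ι k i) = FreeAlgebra.ι k i * rev k n u := by simp [rev]

theorem rev_rev (u : Tens k n) : rev k n (rev k n u) = u := by
  induction u using tens_induction with
  | zero => simp
  | one => simp
  | mul i u hu => rw [rev_ι_mul, rev_mul_ι, hu]
  | add u v hu hv => rw [map_add, map_add, hu, hv]
  | smul c u hu => rw [map_smul, map_smul, hu]

/-- Antihomomorphisms evaluate reversed words. The right action and the antipode are both
constructed as homomorphisms to an opposite algebra. -/
theorem lift_op {A : Type*} [Ring A] [Algebra k A] (x : Fin n → A) (p : Tens k n) :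
    FreeAlgebra.lift k (fun i => MulOpposite.op (x i)) p =
      MulOpposite.op (FreeAlgebra.lift k x (rev k n p)) := by
  induction p using tens_induction with
  | zero => simp
  | one => simp
  | mul i u hu =>
    rw [map_mul, hu, rev_ι_mul, map_mul, MulOpposite.op_mul]
    simp
  | add u v hu hv => rw [map_add, map_add, map_add, hu, hv, MulOpposite.op_add]
  | smul c u hu => rw [map_smul, map_smul, map_smul, hu, MulOpposite.op_smul]

/-- The bilinear form `(p, u) = ε(p(∂^R)(u))` on the tensor algebra. -/
def form : Tens k n →ₗ[k] Tens k n →ₗ[k] k :=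
  (FreeAlgebra.lift k (dR d)).toLinearMap.compr₂ (tensCounit k n).toLinearMap

theorem form_apply (p u : Tens k n) :
    form d p u = tensCounit k n (FreeAlgebra.lift k (dR d) p u) := rfl

theorem form_one_left (u : Tens k n) : form d 1 u = tensCounit k n u := by simp [form_apply]

theorem form_mul_ι_left (p u : Tens k n) (i : Fin n) :
    form d (p * FreeAlgebra.ι k i) u = form d p (dR d i u) := by simp [form_apply]

theorem lift_dR_dL (p u : Tens k n) (i : Fin n) :
    dL d i (FreeAlgebra.lift k (dR d) p u) = FreeAlgebra.lift k (dR d) p (dL d i u) := by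
  induction p using tens_induction with
  | zero => simp
  | one => simp
  | mul j p hp => simp only [map_mul, FreeAlgebra.lift_ι_apply, Module.End.mul_apply, dL_dR, hp]
  | add p q hp hq => simp only [map_add, LinearMap.add_apply, hp, hq]
  | smul c p hp => simp only [map_smul, LinearMap.smul_apply, hp]

/-- Here `∂_i^R` is the last operator applied before the counit, so it may be replaced by `∂_i^L`,
which commutes with `p(∂^R)`. -/
theorem form_ι_mul_left (p u : Tens k n) (i : Fin n) :
    form d (FreeAlgebra.ι k i * p) u = form d p (dL d i u) := by
  simp only [form_apply, map_mul, FreeAlgebra.lift_ι_apply, Module.End.mul_apply]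
  rw [← tensCounit_dL_eq_dR, lift_dR_dL]

/-- Both sides satisfy the same recursion in the first letter of `p`, because `q` is symmetric. With
`form_ι_mul_left` this makes multiplication by `E_i` and `∂_i^L` adjoint in either argument, whence
the symmetry of the form. -/
theorem form_ι_mul_right (p u : Tens k n) (i : Fin n) :
    form d p (FreeAlgebra.ι k i * u) = form d (dL d i p) u := by
  induction p using tens_induction generalizing u with
  | zero => simp
  | one => simp [form_one_left]
  | mul j p hp =>
    rw [form_ι_mul_left, dL_ι_mul, dL_ι_mul, map_add, map_smul, hp, map_add, map_smul,
      LinearMap.add_apply, LinearMap.smul_apply, form_ι_mul_left, d.q_symm j i]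
    by_cases h : i = j
    · subst h; simp
    · simp [h, Ne.symm h]
  | add p q hp hq => simp only [map_add, LinearMap.add_apply, hp, hq]
  | smul c p hp => simp only [map_smul, LinearMap.smul_apply, hp]

theorem form_symm (p u : Tens k n) : form d p u = form d u p := by
  induction u using tens_induction generalizing p with
  | zero => simp
  | one =>
    rw [form_one_left]
    induction p using tens_induction with
    | zero => simp
    | one => simp [form_one_left]
    | mul j p hp => simp [form_ι_mul_left]
    | add p q hp hq => simp only [map_add, LinearMap.add_apply, hp, hq]
    | smul c p hp => simp only [map_smul, LinearMap.smul_apply, hp]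
  | mul i u hu => rw [form_ι_mul_right, hu, form_ι_mul_left]
  | add u v hu hv => simp only [map_add, LinearMap.add_apply, hu, hv]
  | smul c u hu => simp only [map_smul, LinearMap.smul_apply, hu]

theorem dR_rev (i : Fin n) (u : Tens k n) : dR d i (rev k n u) = rev k n (dL d i u) := by
  induction u using tens_induction with
  | zero => simp
  | one => simp
  | mul j u hu =>
    rw [rev_ι_mul, dR_mul_ι, hu, dL_ι_mul, map_add, map_smul, rev_ι_mul]
    split_ifs <;> simp
  | add u v hu hv => simp only [map_add, hu, hv]
  | smul c u hu => simp only [map_smul, hu]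

/-- Reversal exchanges the adjoint pair of left multiplication and `∂^L` with that of right
multiplication and `∂^R`. -/
theorem form_rev (p u : Tens k n) : form d (rev k n p) (rev k n u) = form d p u := by
  induction p using tens_induction generalizing u with
  | zero => simp
  | one =>
    rw [rev_one, form_symm, form_symm d 1]
    induction u using tens_induction with
    | zero => simp
    | one => simp
    | mul j u hu => simp [rev_ι_mul, form_mul_ι_left, form_ι_mul_left]
    | add p q hp hq => simp only [map_add, LinearMap.add_apply, hp, hq]
    | smul c p hp => simp only [map_smul, LinearMap.smul_apply, hp]
  | mul i p hp => rw [rev_ι_mul, form_mul_ι_left, dR_rev, hp, form_ι_mul_left]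
  | add p q hp hq => simp only [map_add, LinearMap.add_apply, hp, hq]
  | smul c p hp => simp only [map_smul, LinearMap.smul_apply, hp]

/-- The value `ε(p(∂^L)(u))` is the form with the first argument reversed. -/
theorem tensCounit_lift_dL (p u : Tens k n) :
    tensCounit k n (FreeAlgebra.lift k (dL d) p u) = form d (rev k n p) u := by
  have hc : ∀ (p u : Tens k n) (i : Fin n),
      dR d i (FreeAlgebra.lift k (dL d) p u) = FreeAlgebra.lift k (dL d) p (dR d i u) := by
    intro p u i
    induction p using tens_induction with
    | zero => simp
    | one => simp
    | mul j p hp => simp only [map_mul, FreeAlgebra.lift_ι_apply, Module.End.mul_apply, ← dL_dR, hp]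
    | add p q hp hq => simp only [map_add, LinearMap.add_apply, hp, hq]
    | smul c p hp => simp only [map_smul, LinearMap.smul_apply, hp]
  induction p using tens_induction generalizing u with
  | zero => simp
  | one => simp [form_one_left]
  | mul i p hp =>
    rw [rev_ι_mul, form_mul_ι_left, map_mul, FreeAlgebra.lift_ι_apply, Module.End.mul_apply,
      tensCounit_dL_eq_dR, hc, hp]
  | add p q hp hq => simp only [map_add, LinearMap.add_apply, hp, hq]
  | smul c p hp => simp only [map_smul, LinearMap.smul_apply, hp]

/-- The radical of the form. -/
def radical : Submodule k (Tens k n) := LinearMap.ker (form d).flip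

theorem mem_radical {u : Tens k n} : u ∈ radical d ↔ ∀ p, form d p u = 0 := by
  rw [radical, LinearMap.mem_ker]
  exact ⟨fun h p => congrArg (fun f => f p) h, fun h => LinearMap.ext h⟩

theorem rev_mem_radical {u : Tens k n} (hu : u ∈ radical d) : rev k n u ∈ radical d := by
  rw [mem_radical] at hu ⊢
  intro p
  rw [← rev_rev p, form_rev, hu]

/-- By adjointness a factor in the second argument becomes a derivation of the first, against which
the element of the radical still pairs to zero. -/
theorem radical_mul_left (a : Tens k n) {p : Tens k n} (hp : p ∈ radical d) :
    a * p ∈ radical d := by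
  induction a using tens_induction with
  | zero => simp
  | one => simpa using hp
  | mul i a ha =>
    rw [mem_radical] at ha ⊢
    intro q
    rw [mul_assoc, form_ι_mul_right, ha]
  | add a b ha hb => rw [add_mul]; exact add_mem ha hb
  | smul c a ha => rw [smul_mul_assoc]; exact Submodule.smul_mem _ _ ha

theorem radical_mul_right (a : Tens k n) {p : Tens k n} (hp : p ∈ radical d) :
    p * a ∈ radical d := by
  induction a using tens_induction generalizing p with
  | zero => simp
  | one => simpa using hp
  | mul i a ha =>
    rw [← mul_assoc]
    refine ha ?_
    rw [mem_radical] at hp ⊢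
    intro q
    rw [form_symm, form_mul_ι_left, form_symm, hp]
  | add a b ha hb => rw [mul_add]; exact add_mem (ha hp) (hb hp)
  | smul c a ha => rw [mul_smul_comm]; exact Submodule.smul_mem _ _ (ha hp)

theorem lift_dR_mem_radical (a : Tens k n) {p : Tens k n} (hp : p ∈ radical d) :
    FreeAlgebra.lift k (dR d) a p ∈ radical d := by
  induction a using tens_induction with
  | zero => simp
  | one => simpa using hp
  | mul i a ha =>
    rw [mem_radical] at ha ⊢
    intro q
    rw [map_mul, FreeAlgebra.lift_ι_apply, Module.End.mul_apply, ← form_mul_ι_left, ha]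
  | add a b ha hb => rw [map_add, LinearMap.add_apply]; exact add_mem ha hb
  | smul c a ha => rw [map_smul, LinearMap.smul_apply]; exact Submodule.smul_mem _ _ ha

theorem braidedComul_one : braidedComul d 1 = 1 ⊗ₜ 1 := by simp [braidedComul]

theorem braidedComul_ι_mul (i : Fin n) (u : Tens k n) :
    braidedComul d (FreeAlgebra.ι k i * u) =
      TensorProduct.map (LinearMap.mulLeft k (FreeAlgebra.ι k i)) LinearMap.id (braidedComul d u) +
      TensorProduct.map (braidAction d i).toLinearMap (LinearMap.mulLeft k (FreeAlgebra.ι k i))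
        (braidedComul d u) := by
  simp [braidedComul, braidedComulGen]

/-- `∂^L` removes letters from the left and therefore touches only the left tensor factor of the
coproduct; correspondingly `∂^R` touches only the right one. -/
theorem braidedComul_dL (i : Fin n) (u : Tens k n) :
    TensorProduct.map (dL d i) LinearMap.id (braidedComul d u) = braidedComul d (dL d i u) := by
  induction u using tens_induction with
  | zero => simp
  | one => simp [braidedComul_one]
  | mul j u hu =>
    rw [dL_ι_mul, map_add, map_smul, braidedComul_ι_mul, braidedComul_ι_mul, ← hu, map_add]
    have h1 : ∀ z : Tens k n ⊗[k] Tens k n, TensorProduct.map (dL d i) LinearMap.id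
        (TensorProduct.map (LinearMap.mulLeft k (FreeAlgebra.ι k j)) LinearMap.id z) =
        d.q i j • TensorProduct.map (LinearMap.mulLeft k (FreeAlgebra.ι k j)) LinearMap.id
          (TensorProduct.map (dL d i) LinearMap.id z) + if i = j then z else 0 := by
      intro z
      induction z with
      | zero => simp
      | add a b ha hb =>
        simp only [map_add, ha, hb, smul_add]
        split_ifs <;> abel
      | tmul a b =>
        simp only [TensorProduct.map_tmul, LinearMap.mulLeft_apply, LinearMap.id_apply, dL_ι_mul]
        split_ifs <;> simp [TensorProduct.add_tmul, TensorProduct.smul_tmul']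
    have h2 : ∀ z : Tens k n ⊗[k] Tens k n, TensorProduct.map (dL d i) LinearMap.id
        (TensorProduct.map (braidAction d j).toLinearMap
          (LinearMap.mulLeft k (FreeAlgebra.ι k j)) z) =
        d.q i j • TensorProduct.map (braidAction d j).toLinearMap
          (LinearMap.mulLeft k (FreeAlgebra.ι k j))
          (TensorProduct.map (dL d i) LinearMap.id z) := by
      intro z
      induction z with
      | zero => simp
      | add a b ha hb => simp only [map_add, ha, hb, smul_add]
      | tmul a b =>
        simp only [TensorProduct.map_tmul, LinearMap.mulLeft_apply, LinearMap.id_apply,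
          AlgHom.toLinearMap_apply, dL_braidAction, TensorProduct.smul_tmul']
    rw [h1, h2, smul_add]
    split_ifs
    · abel
    · simp
  | add u v hu hv => simp only [map_add, hu, hv]
  | smul c u hu => simp only [map_smul, hu]

theorem braidedComul_braidAction (i : Fin n) (u : Tens k n) :
    braidedComul d (braidAction d i u) =
      TensorProduct.map (braidAction d i).toLinearMap (braidAction d i).toLinearMap
        (braidedComul d u) := by
  have hc : ∀ j v, braidAction d i (braidAction d j v) = braidAction d j (braidAction d i v) := by
    intro j v
    have : (braidAction d i).comp (braidAction d j) = (braidAction d j).comp (braidAction d i) := by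
      ext l
      simp [smul_smul, mul_comm]
    exact congrArg (fun f => f v) this
  induction u using tens_induction with
  | zero => simp
  | one => simp [braidedComul_one]
  | mul j u hu =>
    rw [map_mul, braidAction_ι, smul_mul_assoc, map_smul, braidedComul_ι_mul, hu,
      braidedComul_ι_mul]
    generalize braidedComul d u = z
    induction z with
    | zero => simp
    | add a b ha hb =>
      simp only [map_add, smul_add] at ha hb ⊢
      rw [add_add_add_comm, ha, hb]
      abel
    | tmul a b =>
      simp [TensorProduct.smul_tmul', hc, TensorProduct.tmul_smul, smul_add]
  | add u v hu hv => simp only [map_add, hu, hv]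
  | smul c u hu => simp only [map_smul, hu]

theorem braidedComul_dR (i : Fin n) (u : Tens k n) :
    TensorProduct.map LinearMap.id (dR d i) (braidedComul d u) = braidedComul d (dR d i u) := by
  induction u using tens_induction with
  | zero => simp
  | one => simp [braidedComul_one]
  | mul j u hu =>
    have hb : braidedComul d (if i = j then braidAction d i u else 0) = if i = j then
        TensorProduct.map (braidAction d i).toLinearMap (braidAction d i).toLinearMap
        (braidedComul d u) else 0 := by
      split_ifs
      · rw [braidedComul_braidAction]
      · simp
    rw [dR_ι_mul, map_add, braidedComul_ι_mul, braidedComul_ι_mul, ← hu, map_add, hb]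
    generalize braidedComul d u = z
    induction z with
    | zero => simp
    | add a b ha hb =>
      simp only [map_add] at ha hb ⊢
      rw [add_add_add_comm, ha, hb]
      split_ifs <;> abel
    | tmul a b =>
      simp only [TensorProduct.map_tmul, LinearMap.mulLeft_apply, LinearMap.id_apply,
          AlgHom.toLinearMap_apply, dR_ι_mul]
      split_ifs with h
      · subst h; simp [TensorProduct.tmul_add, add_assoc]
      · simp
  | add u v hu hv => simp only [map_add, hu, hv]
  | smul c u hu => simp only [map_smul, hu]

theorem tensCounit_braidedComul (u : Tens k n) :
    TensorProduct.lid k k (TensorProduct.map (tensCounit k n).toLinearMap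
      (tensCounit k n).toLinearMap (braidedComul d u)) = tensCounit k n u := by
  induction u using tens_induction with
  | zero => simp
  | one => simp [braidedComul_one]
  | mul j u hu =>
    rw [braidedComul_ι_mul]
    generalize braidedComul d u = z
    induction z with
    | zero => simp
    | add a b ha hb =>
      simp only [map_add, map_mul, tensCounit_ι, zero_mul] at ha hb ⊢
      rw [add_add_add_comm, ha, hb, add_zero]
    | tmul a b => simp
  | add u v hu hv => simp only [map_add, hu, hv]
  | smul c u hu => simp only [map_smul, hu]

theorem lift_dL_dR_comul (p q u : Tens k n) :
    TensorProduct.map (FreeAlgebra.lift k (dL d) p) (FreeAlgebra.lift k (dR d) q)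
      (braidedComul d u) =
    braidedComul d (FreeAlgebra.lift k (dL d) p (FreeAlgebra.lift k (dR d) q u)) := by
  have hR : ∀ q u, TensorProduct.map LinearMap.id (FreeAlgebra.lift k (dR d) q)
      (braidedComul d u) = braidedComul d (FreeAlgebra.lift k (dR d) q u) := by
    intro q u
    induction q using tens_induction with
    | zero => simp
    | one => simp [← Module.End.one_eq_id]
    | mul i q hq =>
      rw [map_mul, Module.End.mul_eq_comp, ← LinearMap.comp_id LinearMap.id, TensorProduct.map_comp,
        LinearMap.comp_apply, hq]
      simp [← braidedComul_dR]
    | add p q hp hq => simp only [map_add, LinearMap.add_apply, TensorProduct.map_add_right, hp, hq]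
    | smul c p hp => simp only [map_smul, LinearMap.smul_apply, TensorProduct.map_smul_right, hp]
  have hL : ∀ q u, TensorProduct.map (FreeAlgebra.lift k (dL d) q) LinearMap.id
      (braidedComul d u) = braidedComul d (FreeAlgebra.lift k (dL d) q u) := by
    intro q u
    induction q using tens_induction with
    | zero => simp
    | one => simp [← Module.End.one_eq_id]
    | mul i q hq =>
      rw [map_mul, Module.End.mul_eq_comp, ← LinearMap.comp_id LinearMap.id, TensorProduct.map_comp,
        LinearMap.comp_apply, hq]
      simp [← braidedComul_dL]
    | add p q hp hq => simp only [map_add, LinearMap.add_apply, TensorProduct.map_add_left, hp, hq]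
    | smul c p hp => simp only [map_smul, LinearMap.smul_apply, TensorProduct.map_smul_left, hp]
  rw [← hL, ← hR, ← LinearMap.comp_apply (TensorProduct.map _ _) (TensorProduct.map _ _),
    ← TensorProduct.map_comp, LinearMap.comp_id, LinearMap.id_comp]

/-- By `mem_sup_range_of_forall` it suffices to annihilate the coproduct with the functionals `ε ∘
p(∂^L)` and `ε ∘ q(∂^R)`. As the derivations act on one tensor factor each, the result is `ε(p(∂^L)
q(∂^R) u)`, a value of the form on the element `q(∂^R) u` of the radical. -/
theorem comul_radical {u : Tens k n} (hu : u ∈ radical d) : braidedComul d u ∈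
    LinearMap.range (TensorProduct.map (radical d).subtype
      (LinearMap.id : Tens k n →ₗ[k] Tens k n)) ⊔
    LinearMap.range (TensorProduct.map (LinearMap.id : Tens k n →ₗ[k] Tens k n)
      (radical d).subtype) := by
  refine mem_sup_range_of_forall
    (fun p => (tensCounit k n).toLinearMap ∘ₗ FreeAlgebra.lift k (dL d) p)
    (fun q => (tensCounit k n).toLinearMap ∘ₗ FreeAlgebra.lift k (dR d) q) _ _ ?_ ?_ ?_
  · intro v
    simp only [LinearMap.comp_apply, AlgHom.toLinearMap_apply, tensCounit_lift_dL, mem_radical]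
    exact ⟨fun h p => h _, fun h p => by simpa [rev_rev] using h (rev k n p)⟩
  · intro v
    exact mem_radical d
  · intro p q
    rw [TensorProduct.map_comp, LinearMap.comp_apply, lift_dL_dR_comul,
      ← (TensorProduct.lid k k).map_eq_zero_iff, tensCounit_braidedComul, tensCounit_lift_dL]
    exact (mem_radical d).mp (lift_dR_mem_radical d q hu) _

end Form

/-! ### The radical of the form is a graded biideal -/

section Radical

variable {k : Type*} [Field k] {n : ℕ} (d : Datum k n)

theorem wt_eq_iff {l l' : List (Fin n)} : wt l = wt l' ↔ l.Perm l' := by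
  rw [List.perm_iff_count]
  exact ⟨fun h i => congrFun h i, fun h => funext h⟩

theorem mem_span_words_mul {S S' : Set (List (Fin n))} (i : Fin n) {u : Tens k n}
    (h : ∀ l ∈ S, i :: l ∈ S') (hu : u ∈ Submodule.span k (word k '' S)) :
    FreeAlgebra.ι k i * u ∈ Submodule.span k (word k '' S') := by
  induction hu using Submodule.span_induction with
  | mem _ hx =>
    obtain ⟨l, hl, rfl⟩ := hx
    exact Submodule.subset_span ⟨i :: l, h l hl, word_cons i l⟩
  | zero => simp
  | add u v _ _ hu hv => rw [mul_add]; exact add_mem hu hv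
  | smul c u _ hu => rw [mul_smul_comm]; exact Submodule.smul_mem _ _ hu

theorem braidAction_word (i : Fin n) (l : List (Fin n)) :
    braidAction d i (word k l) = d.chi (simpleRoot i) (zwt l) • word k l := by
  induction l with
  | nil => simp [word_nil, zwt_nil, d.chi_zero_right]
  | cons j l ih =>
    rw [word_cons, map_mul, ih, braidAction_ι, zwt_cons, d.chi_add_right, d.chi_simple,
      smul_mul_assoc, mul_smul_comm, smul_smul]

theorem dL_word_mem (i : Fin n) (l : List (Fin n)) :
    dL d i (word k l) ∈ Submodule.span k (word k '' {l' | (i :: l').Perm l}) := by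
  induction l with
  | nil => simp [word_nil]
  | cons j l ih =>
    rw [word_cons, dL_ι_mul]
    refine add_mem (Submodule.smul_mem _ _ (mem_span_words_mul j ?_ ih)) ?_
    · intro l' hl'
      exact (List.Perm.swap j i l').trans (hl'.cons j)
    · split_ifs with h
      · subst h
        exact Submodule.subset_span ⟨l, List.Perm.refl _, rfl⟩
      · exact zero_mem _

theorem dR_word_mem (i : Fin n) (l : List (Fin n)) :
    dR d i (word k l) ∈ Submodule.span k (word k '' {l' | (i :: l').Perm l}) := by
  induction l with
  | nil => simp [word_nil]
  | cons j l ih =>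
    rw [word_cons, dR_ι_mul]
    refine add_mem (mem_span_words_mul j ?_ ih) ?_
    · intro l' hl'
      exact (List.Perm.swap j i l').trans (hl'.cons j)
    · split_ifs with h
      · subst h
        rw [braidAction_word]
        exact Submodule.smul_mem _ _ (Submodule.subset_span ⟨l, List.Perm.refl _, rfl⟩)
      · exact zero_mem _

/-- Each letter of `w` removes one equal letter from `l`, and nothing but the empty word survives
the counit. -/
theorem form_word_word {w l : List (Fin n)} (h : ¬ w.Perm l) :
    form d (word k w) (word k l) = 0 := by
  induction w generalizing l with
  | nil =>
    cases l with
    | nil => exact (h (List.Perm.refl _)).elim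
    | cons j l => simp [word_nil, word_cons, form_one_left]
  | cons i w ih =>
    rw [word_cons, form_ι_mul_left]
    have key : Submodule.span k (word k '' {l' | (i :: l').Perm l}) ≤
        LinearMap.ker (form d (word k w)) := by
      rw [Submodule.span_le]
      rintro _ ⟨l', hl', rfl⟩
      exact ih fun hw => h ((hw.cons i).trans hl')
    exact key (dL_word_mem d i l)

theorem form_word_homog {w : List (Fin n)} {μ : Fin n → ℕ} (h : wt w ≠ μ) {u : Tens k n}
    (hu : u ∈ homog k μ) : form d (word k w) u = 0 := by
  have key : homog k μ ≤ LinearMap.ker (form d (word k w)) := by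
    rw [homog, Submodule.span_le]
    rintro _ ⟨l, rfl, rfl⟩
    exact form_word_word d fun hw => h (wt_eq_iff.mpr hw)
  exact key hu

theorem iSup_homog : ⨆ μ, homog k (n := n) μ = ⊤ := by
  rw [eq_top_iff, ← span_words, Submodule.span_le]
  rintro _ ⟨l, rfl⟩
  exact Submodule.mem_iSup_of_mem (wt l) (Submodule.subset_span ⟨l, rfl, rfl⟩)

theorem mem_radical_of_words {u : Tens k n} (h : ∀ w, form d (word k w) u = 0) :
    u ∈ radical d := by
  rw [mem_radical]
  intro p
  have : (form d).flip u = 0 := tens_ext h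
  exact congrArg (fun f => f p) this

/-- The form vanishes on a homogeneous element if it pairs to zero with all elements of the same
weight. -/
theorem mem_radical_of_homog {μ : Fin n → ℕ} {u : Tens k n} (hu : u ∈ homog k μ)
    (h : ∀ p ∈ homog k μ, form d p u = 0) : u ∈ radical d := by
  refine mem_radical_of_words d fun w => ?_
  by_cases hw : wt w = μ
  · exact h _ (Submodule.subset_span ⟨w, hw, rfl⟩)
  · exact form_word_homog d hw hu

/-- A word of weight `μ` pairs only with the component of weight `μ`, so each component of an
element of the radical is again in the radical. -/
theorem radical_graded : radical d ≤ ⨆ μ, radical d ⊓ homog k μ := by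
  intro u hu
  have hu' : u ∈ ⨆ μ, homog k (n := n) μ := by rw [iSup_homog]; trivial
  obtain ⟨f, hf, rfl⟩ := (Submodule.mem_iSup_iff_exists_finsupp _ _).mp hu'
  refine Submodule.sum_mem _ fun μ hμ => Submodule.mem_iSup_of_mem μ ⟨?_, hf μ⟩
  refine mem_radical_of_words d fun w => ?_
  by_cases hw : wt w = μ
  · have h1 := (mem_radical d).mp hu (word k w)
    rw [Finsupp.sum, map_sum, Finset.sum_eq_single μ] at h1
    · exact h1
    · intro ν _ hν
      exact form_word_homog d (by rw [hw]; exact hν.symm) (hf ν)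
    · intro h
      exact (h hμ).elim
  · exact form_word_homog d hw (hf μ)

/-- The form reads off the components of degree zero and one, as `(1, u)` and the `(E_i, u)`. The
map `r` subtracts them: its image lies in degrees at least two, and it is the identity on the
radical. -/
theorem radical_two_le : radical d ≤ Submodule.span k (word k '' {l | 2 ≤ l.length}) := by
  let r : Tens k n →ₗ[k] Tens k n := LinearMap.id - (form d 1).smulRight 1 -
    ∑ i, (form d (FreeAlgebra.ι k i)).smulRight (FreeAlgebra.ι k i)
  have hι : ∀ i : Fin n, FreeAlgebra.ι k i = word k [i] := fun i => by simp [word]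
  have hr : ∀ u, r u ∈ Submodule.span k (word k '' {l | 2 ≤ l.length}) := by
    intro u
    have hu : u ∈ Submodule.span k (Set.range (word k (n := n))) := by rw [span_words]; trivial
    induction hu using Submodule.span_induction with
    | mem _ h =>
      obtain ⟨l, rfl⟩ := h
      match l with
      | [] =>
        have h0 : ∀ i, form d (FreeAlgebra.ι k i) (word k []) = 0 := fun i => by
          rw [hι, form_word_word]; simp
        simp [r, h0]
        simp [word_nil, form_one_left]
      | [j] =>
        have h1 : ∀ i, form d (FreeAlgebra.ι k i) (word k [j]) = if i = j then 1 else 0 :=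
          fun i => by
          have h2 := form_ι_mul_left d 1 (word k [j]) i
          rw [mul_one] at h2
          rw [h2, word_cons, dL_ι_mul]
          split_ifs <;> simp [word_nil, form_one_left]
        have h0 : form d 1 (word k [j]) = 0 := by simp [form_one_left, word_cons]
        simp [r, h1, h0]
        simp [word]
      | i :: j :: l =>
        have h1 : ∀ m, form d (FreeAlgebra.ι k m) (word k (i :: j :: l)) = 0 := fun m => by
          rw [hι, form_word_word]
          intro h
          simpa using h.length_eq
        have h0 : form d 1 (word k (i :: j :: l)) = 0 := by simp [form_one_left, word_cons]
        simp only [r, h1, h0, LinearMap.sub_apply, LinearMap.id_apply, LinearMap.smulRight_apply,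
          zero_smul, LinearMap.sum_apply, Finset.sum_const_zero, sub_zero]
        exact Submodule.subset_span ⟨_, by simp, rfl⟩
    | zero => simp
    | add u v _ _ hu hv => rw [map_add]; exact add_mem hu hv
    | smul c u _ hu => rw [map_smul]; exact Submodule.smul_mem _ _ hu
  intro u hu
  have h := hr u
  rw [mem_radical] at hu
  simpa [r, hu] using h

theorem isGradedBiideal_radical : IsGradedBiideal d (radical d) where
  mul_left a _ hp := radical_mul_left d a hp
  mul_right a _ hp := radical_mul_right d a hp
  comul _ hp := comul_radical d hp
  graded := radical_graded d
  two_le := radical_two_le d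

theorem radical_le_max : radical d ≤ (maxIdeal d).carrier := le_sSup (isGradedBiideal_radical d)

end Radical

/-! ### Generators and spanning sets of bosonizations -/

section Generators

variable {k : Type*} [Field k] {n : ℕ}

theorem Presented.mk_surjective {X : Type*} (r : FreeAlgebra k X → FreeAlgebra k X → Prop) :
    Function.Surjective (Presented.mk r) := RingQuot.mkAlgHom_surjective k r

/-- Left induction: an element of a presented algebra is a combination of products of generators. -/
theorem Presented.induction {X : Type*} {r : FreeAlgebra k X → FreeAlgebra k X → Prop}
    {p : Presented r → Prop} (zero : p 0) (one : p 1)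
    (mul : ∀ x u, p u → p (Presented.mk r (FreeAlgebra.ι k x) * u))
    (add : ∀ u v, p u → p v → p (u + v)) (smul : ∀ (c : k) u, p u → p (c • u))
    (u : Presented r) : p u := by
  obtain ⟨a, rfl⟩ := Presented.mk_surjective r u
  have h : ∀ v, p v → p (Presented.mk r a * v) := by
    induction a using FreeAlgebra.induction with
    | grade0 c =>
      intro v hv
      rw [AlgHom.commutes, ← Algebra.smul_def]
      exact smul c v hv
    | grade1 x => exact fun v hv => mul x v hv
    | mul a b ha hb =>
      intro v hv
      rw [map_mul, mul_assoc]
      exact ha _ (hb v hv)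
    | add a b ha hb =>
      intro v hv
      rw [map_add, add_mul]
      exact add _ _ (ha v hv) (hb v hv)
  simpa using h 1 one

namespace Borel

variable {d : Datum k n} {s : (Fin n → ℤ) → Fin n → k} {J : PreNicholsIdeal d}

theorem induction {p : Borel s J → Prop} (zero : p 0) (one : p 1)
    (X_mul : ∀ i u, p u → p (X s J i * u)) (K_mul : ∀ a u, p u → p (K s J a * u))
    (add : ∀ u v, p u → p v → p (u + v)) (smul : ∀ (c : k) u, p u → p (c • u))
    (u : Borel s J) : p u := by
  refine Presented.induction zero one ?_ add smul u
  rintro (i | a) u hu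
  · exact X_mul i u hu
  · exact K_mul a u hu

variable {A : Type*} [Ring A] [Algebra k A]

theorem hom_ext {f g : Borel s J →ₐ[k] A} (hX : ∀ i, f (X s J i) = g (X s J i))
    (hK : ∀ a, f (K s J a) = g (K s J a)) : f = g := by
  ext u
  induction u using Borel.induction with
  | zero => simp
  | one => simp
  | X_mul i u hu => rw [map_mul, map_mul, hu, hX]
  | K_mul a u hu => rw [map_mul, map_mul, hu, hK]
  | add u v hu hv => rw [map_add, map_add, hu, hv]
  | smul c u hu => rw [map_smul, map_smul, hu]

section Lift

variable {x : Fin n → A} {g : (Fin n → ℤ) → A} {h0 : g 0 = 1}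
  {hadd : ∀ a b, g (a + b) = g a * g b} {hx : ∀ a i, g a * x i = s a i • (x i * g a)}
  {hJ : ∀ p ∈ J.carrier, FreeAlgebra.lift k x p = 0}

@[simp] theorem lift_apply_X (i : Fin n) : lift s J x g h0 hadd hx hJ (X s J i) = x i := by
  simp [lift, X, Presented.lift_mk]

@[simp] theorem lift_apply_K (a : Fin n → ℤ) : lift s J x g h0 hadd hx hJ (K s J a) = g a := by
  simp [lift, K, Presented.lift_mk]

end Lift

variable (s J)

@[simp] theorem counit_X (i : Fin n) : counit s J (X s J i) = 0 := by simp [counit]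

@[simp] theorem counit_K (a : Fin n → ℤ) : counit s J (K s J a) = 1 := by simp [counit]

@[simp] theorem toMax_X (i : Fin n) : toMax s J (X s J i) = X s _ i := by simp [toMax]

@[simp] theorem toMax_K (a : Fin n → ℤ) : toMax s J (K s J a) = K s _ a := by simp [toMax]

theorem K_neg_mul_K (a : Fin n → ℤ) : K s J (-a) * K s J a = 1 := by
  rw [← K_add, neg_add_cancel, K_zero]

theorem K_mul_K_neg (a : Fin n → ℤ) : K s J a * K s J (-a) = 1 := by
  rw [← K_add, add_neg_cancel, K_zero]

/-- The homomorphism from the tensor algebra to a bosonization. -/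
def emb : Tens k n →ₐ[k] Borel s J := FreeAlgebra.lift k (X s J)

@[simp] theorem emb_ι (i : Fin n) : emb s J (FreeAlgebra.ι k i) = X s J i := by simp [emb]

theorem emb_of_mem {p : Tens k n} (hp : p ∈ J.carrier) : emb s J p = 0 := lift_X s J hp

theorem ofPre_mk (u : Tens k n) : ofPre s J (Pre.mk J u) = emb s J u := by
  rw [ofPre, Pre.lift, Pre.mk, Presented.lift_mk, emb]

theorem counit_emb (u : Tens k n) : counit s J (emb s J u) = tensCounit k n u := by
  have : (counit s J).comp (emb s J) = tensCounit k n := by ext i; simp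
  exact congrArg (fun f => f u) this

theorem K_mul_word (a : Fin n → ℤ) (l : List (Fin n)) :
    K s J a * emb s J (word k l) = (l.map (s a)).prod • (emb s J (word k l) * K s J a) := by
  induction l with
  | nil => simp [word_nil]
  | cons i l ih =>
    rw [word_cons, map_mul, emb_ι, ← mul_assoc, K_mul_X, smul_mul_assoc, mul_assoc, ih,
      mul_smul_comm, smul_smul, mul_assoc, List.map_cons, List.prod_cons]

/-- This is the spanning half of the decomposition of the bosonization into the products `u K_a`;
for H ⋉ U⁻ the independence is `coeff_emb_mul_K`. -/
theorem span_emb_K : Submodule.span k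
    (Set.range fun z : List (Fin n) × (Fin n → ℤ) => emb s J (word k z.1) * K s J z.2) = ⊤ := by
  rw [eq_top_iff]
  rintro u -
  induction u using Borel.induction with
  | zero => exact zero_mem _
  | one => exact Submodule.subset_span ⟨([], 0), by simp [word_nil, K_zero]⟩
  | X_mul i u hu =>
    induction hu using Submodule.span_induction with
    | mem _ h =>
      obtain ⟨⟨l, a⟩, rfl⟩ := h
      exact Submodule.subset_span ⟨(i :: l, a), by simp [word_cons, mul_assoc]⟩
    | zero => simp
    | add u v _ _ hu hv => rw [mul_add]; exact add_mem hu hv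
    | smul c u _ hu => rw [mul_smul_comm]; exact Submodule.smul_mem _ _ hu
  | K_mul b u hu =>
    induction hu using Submodule.span_induction with
    | mem _ h =>
      obtain ⟨⟨l, a⟩, rfl⟩ := h
      simp only
      rw [← mul_assoc, K_mul_word, smul_mul_assoc, mul_assoc, ← K_add]
      exact Submodule.smul_mem _ _ (Submodule.subset_span ⟨(l, b + a), rfl⟩)
    | zero => simp
    | add u v _ _ hu hv => rw [mul_add]; exact add_mem hu hv
    | smul c u _ hu => rw [mul_smul_comm]; exact Submodule.smul_mem _ _ hu
  | add u v hu hv => exact add_mem hu hv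
  | smul c u hu => exact Submodule.smul_mem _ _ hu

variable {s J}

theorem ext_emb_K {M : Type*} [AddCommMonoid M] [Module k M] {f g : Borel s J →ₗ[k] M}
    (h : ∀ l a, f (emb s J (word k l) * K s J a) = g (emb s J (word k l) * K s J a)) : f = g :=
  LinearMap.ext_on_range (span_emb_K s J) fun z => h z.1 z.2

theorem induction_emb_K {p : Borel s J → Prop} (zero : p 0)
    (gen : ∀ l a, p (emb s J (word k l) * K s J a))
    (add : ∀ u v, p u → p v → p (u + v)) (smul : ∀ (c : k) u, p u → p (c • u))
    (u : Borel s J) : p u := by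
  have hu : u ∈ Submodule.span k
    (Set.range fun z : List (Fin n) × (Fin n → ℤ) => emb s J (word k z.1) * K s J z.2) := by
    rw [span_emb_K]; trivial
  induction hu using Submodule.span_induction with
  | mem _ h => obtain ⟨z, rfl⟩ := h; exact gen z.1 z.2
  | zero => exact zero
  | add u v _ _ hu hv => exact add u v hu hv
  | smul c u _ hu => exact smul c u hu

end Borel

end Generators

/-! ### Skew derivations of H ⋉ U⁻ -/

section Minus

open Borel

variable {k : Type*} [Field k] {n : ℕ} {d : Datum k n} (J : PreNicholsIdeal d)

local notation "mX" => Borel.X (minusScalar d) J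
local notation "mK" => Borel.K (minusScalar d) J
local notation "mE" => Borel.emb (minusScalar d) J

theorem minus_K_mul_word (a : Fin n → ℤ) (l : List (Fin n)) :
    mK a * mE (word k l) = (d.chi a (zwt l))⁻¹ • (mE (word k l) * mK a) := by
  rw [K_mul_word]
  congr 1
  induction l with
  | nil => simp [zwt_nil, d.chi_zero_right]
  | cons i l ih =>
    rw [List.map_cons, List.prod_cons, ih, zwt_cons, d.chi_add_right, d.minusScalar_eq, mul_inv]

theorem minus_word_mul_K (a : Fin n → ℤ) (l : List (Fin n)) :
    mE (word k l) * mK a = d.chi a (zwt l) • (mK a * mE (word k l)) := by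
  rw [minus_K_mul_word, smul_smul, mul_inv_cancel₀ (d.chi_ne_zero _ _), one_smul]

theorem K_neg_mul_emb (i : Fin n) (u : Tens k n) :
    mK (-simpleRoot i) * mE u = mE (braidAction d i u) * mK (-simpleRoot i) := by
  induction u using tens_induction with
  | zero => simp
  | one => simp
  | mul j u hu =>
    simp only [map_mul, emb_ι, braidAction_ι, map_smul]
    rw [← mul_assoc, K_mul_X, smul_mul_assoc, mul_assoc, hu, minusScalar_neg, smul_mul_assoc,
      smul_mul_assoc, mul_assoc]
  | add u v hu hv => simp only [map_add, mul_add, add_mul, hu, hv]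
  | smul c u hu => simp only [map_smul, mul_smul_comm, smul_mul_assoc, hu]

/-- Left multiplication on both summands of `B ⊕ B`. -/
def diagMul (y : BMinus J) : Module.End k (BMinus J × BMinus J) :=
  LinearMap.prodMap (LinearMap.mulLeft k y) (LinearMap.mulLeft k y)

/-- The map `(y, w) ↦ (0, K_e y)`. -/
def cornerK (e : Fin n → ℤ) : Module.End k (BMinus J × BMinus J) :=
  LinearMap.prod 0 (LinearMap.mulLeft k (mK e) ∘ₗ LinearMap.fst k _ _)

theorem diagMul_apply (y : BMinus J) (z) : diagMul J y z = (y * z.1, y * z.2) := rfl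

theorem cornerK_apply (e : Fin n → ℤ) (z) : cornerK J e z = (0, mK e * z.1) := rfl

theorem lift_diagMul (p : Tens k n) (z) :
    FreeAlgebra.lift k (fun j => diagMul J (mX j)) p z = (mE p * z.1, mE p * z.2) := by
  induction p using tens_induction generalizing z with
  | zero => simp; rfl
  | one => simp
  | mul i u hu => simp [hu, diagMul_apply, mul_assoc]
  | add u v hu hv => simp [hu, hv, add_mul]
  | smul c u hu => simp [hu]

/-- Products of two corner maps vanish, and the elements of the ideal have degree at least two. -/
theorem lift_cornerK (i : Fin n) (e : Fin n → ℤ) {p : Tens k n} (hp : p ∈ J.carrier) :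
    FreeAlgebra.lift k (fun j => if i = j then cornerK J e else 0) p = 0 := by
  have h : J.carrier ≤ LinearMap.ker
      (FreeAlgebra.lift k (fun j => if i = j then cornerK J e else 0)).toLinearMap := by
    refine J.biideal.two_le.trans (Submodule.span_le.mpr ?_)
    rintro _ ⟨l, hl, rfl⟩
    match l, hl with
    | a :: b :: l, _ =>
      have h2 : (if i = a then cornerK J e else 0) * (if i = b then cornerK J e else 0) = 0 := by
        split_ifs
        · refine LinearMap.ext fun z => ?_
          simp [cornerK_apply]
        all_goals simp
      change FreeAlgebra.lift k _ _ = 0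
      rw [lift_word, List.map_cons, List.map_cons, List.prod_cons, List.prod_cons, ← mul_assoc, h2,
        zero_mul]
  exact h hp

/-- The homomorphism to the endomorphisms of `B ⊕ B` that encodes the skew derivation
`δ(F_j y) = F_j δ(y) + δ_{ij} K_e y`, for `e = ± α_i`. -/
def skewHom (i : Fin n) (e : Fin n → ℤ) (he : e = simpleRoot i ∨ e = -simpleRoot i) :
    BMinus J →ₐ[k] Module.End k (BMinus J × BMinus J) :=
  Borel.lift _ J (fun j => diagMul J (mX j) + if i = j then cornerK J e else 0)
    -- The scalar on the second summand makes the corner term compatible with the commutation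
    -- relation of `K_a` and `F_i`.
    (fun a => LinearMap.prodMap (LinearMap.mulLeft k (mK a))
      (minusScalar d a i • LinearMap.mulLeft k (mK a)))
    (by
      ext z <;> simp [K_zero, d.minusScalar_eq, d.chi_zero_left])
    (by
      intro a b
      refine LinearMap.ext fun z => Prod.ext ?_ ?_
      · simp [K_add]
      · simp [K_add, d.minusScalar_eq, d.chi_add_left, smul_smul])
    (by
      intro a j
      refine LinearMap.ext fun z => Prod.ext ?_ ?_
      · have h1 : mK a * (mX j * z.1) = minusScalar d a j • (mX j * (mK a * z.1)) := by
          rw [← mul_assoc, K_mul_X, smul_mul_assoc, mul_assoc]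
        split_ifs <;> simp [diagMul_apply, cornerK_apply, h1]
      · have h1 : mK a * (mX j * z.2) = minusScalar d a j • (mX j * (mK a * z.2)) := by
          rw [← mul_assoc, K_mul_X, smul_mul_assoc, mul_assoc]
        have h2 : mK a * (mK e * z.1) = mK e * (mK a * z.1) := by
          rw [← mul_assoc, K_comm, mul_assoc]
        split_ifs with h
        · subst h
          simp [diagMul_apply, cornerK_apply, mul_add, h1, h2]
        · simp [diagMul_apply, h1]
          rw [smul_comm])
    (by
      intro p hp
      have ha : ∀ p ∈ J.carrier, FreeAlgebra.lift k (fun j => diagMul J (mX j)) p = 0 := by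
        intro p hp
        refine LinearMap.ext fun z => ?_
        rw [lift_diagMul, emb_of_mem _ _ hp]
        simp
      -- The diagonal and the corner maps q-commute for both signs of `e`, but in opposite order, so
      -- they exchange roles in `lift_add_eq_zero`.
      rcases he with he | he
      · have := lift_add_eq_zero J.biideal (fun j => if i = j then cornerK J e else 0)
          (fun j => diagMul J (mX j)) ?_ (fun p hp => lift_cornerK J i e hp) ha hp
        · simpa only [add_comm] using this
        · intro l j
          split_ifs with h
          · subst h
            refine LinearMap.ext fun z => Prod.ext ?_ ?_
            · simp [diagMul_apply, cornerK_apply]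
            · have hq := d.q_ne_zero l i
              simp [diagMul_apply, cornerK_apply, he]
              rw [← mul_assoc, ← mul_assoc, K_mul_X, smul_mul_assoc, smul_smul, d.minusScalar_eq,
                d.chi_simple, d.q_symm i l, mul_inv_cancel₀ hq, one_smul]
          · simp
      · refine lift_add_eq_zero J.biideal _ _ ?_ ha (fun p hp => lift_cornerK J i e hp) hp
        intro l j
        split_ifs with h
        · subst h
          refine LinearMap.ext fun z => Prod.ext ?_ ?_
          · simp [diagMul_apply, cornerK_apply]
          · simp [diagMul_apply, cornerK_apply, he]
            rw [← mul_assoc, K_mul_X, smul_mul_assoc, minusScalar_neg, mul_assoc]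
        · simp)

/-- The skew derivation of `H ⋉ U⁻` with `δ(F_j y) = F_j δ(y) + δ_{ij} K_e y`, for `e = ± α_i`. -/
def skewDer (i : Fin n) (e : Fin n → ℤ) (he : e = simpleRoot i ∨ e = -simpleRoot i) :
    Module.End k (BMinus J) :=
  LinearMap.snd k _ _ ∘ₗ LinearMap.applyₗ ((1, 0) : BMinus J × BMinus J) ∘ₗ
    (skewHom J i e he).toLinearMap

section

variable (i : Fin n) (e : Fin n → ℤ) (he : e = simpleRoot i ∨ e = -simpleRoot i)

theorem skewHom_X (j : Fin n) : skewHom J i e he (mX j) =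
    diagMul J (mX j) + if i = j then cornerK J e else 0 := by
  simp [skewHom]

theorem skewHom_K (a : Fin n → ℤ) : skewHom J i e he (mK a) =
    LinearMap.prodMap (LinearMap.mulLeft k (mK a))
      (minusScalar d a i • LinearMap.mulLeft k (mK a)) := by
  simp [skewHom]

theorem skewHom_fst (y : BMinus J) (z) : (skewHom J i e he y z).1 = y * z.1 := by
  induction y using Borel.induction generalizing z with
  | zero => simp
  | one => simp
  | X_mul j u hu =>
    rw [map_mul, Module.End.mul_apply, skewHom_X]
    split_ifs <;> simp [diagMul_apply, cornerK_apply, hu, mul_assoc]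
  | K_mul a u hu => simp [skewHom_K, hu, mul_assoc]
  | add u v hu hv => simp [hu, hv, add_mul]
  | smul c u hu => simp [hu]

theorem skewDer_one : skewDer J i e he 1 = 0 := by simp [skewDer]

theorem skewDer_X_mul (j : Fin n) (y : BMinus J) :
    skewDer J i e he (mX j * y) = mX j * skewDer J i e he y + if i = j then mK e * y else 0 := by
  have h := skewHom_fst J i e he y (1, 0)
  simp only [skewDer, LinearMap.comp_apply, LinearMap.applyₗ_apply_apply,
    AlgHom.toLinearMap_apply, map_mul, Module.End.mul_apply, skewHom_X]
  split_ifs <;> simp [diagMul_apply, cornerK_apply, h]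

theorem skewDer_K_mul (a : Fin n → ℤ) (y : BMinus J) :
    skewDer J i e he (mK a * y) = minusScalar d a i • (mK a * skewDer J i e he y) := by
  simp only [skewDer, LinearMap.comp_apply, LinearMap.applyₗ_apply_apply,
    AlgHom.toLinearMap_apply, map_mul, Module.End.mul_apply, skewHom_K]
  simp

end

/-- The action of `K_a` on `H ⋉ U⁻` from the left. -/
def eta (a : Fin n → ℤ) : BMinus J →ₐ[k] BMinus J :=
  Borel.lift _ J mX (fun b => (d.chi a b)⁻¹ • mK b)
    (by rw [K_zero, d.chi_zero_right, inv_one, one_smul])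
    (by intro b c; simp [K_add, d.chi_add_right, smul_smul])
    (by intro b i; simp [K_mul_X, smul_smul, mul_comm])
    (fun p hp => lift_X _ _ hp)

/-- The action of `K_a` on `H ⋉ U⁻` from the right. -/
def kap (a : Fin n → ℤ) : BMinus J →ₐ[k] BMinus J :=
  Borel.lift _ J (fun i => d.chi a (simpleRoot i) • mX i) (fun b => (d.chi a b)⁻¹ • mK b)
    (by rw [K_zero, d.chi_zero_right, inv_one, one_smul])
    (by intro b c; simp [K_add, d.chi_add_right, smul_smul])
    (by intro b i; simp [K_mul_X, smul_smul]; congr 1; ring)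
    (by
      intro p hp
      have := lift_mul_eq_zero J.biideal
        (fun i => algebraMap k (BMinus J) (d.chi a (simpleRoot i))) mX (fun _ _ => 1)
        (fun _ _ => rfl) (fun i j => by rw [one_smul, Algebra.commutes])
        (fun i j => by rw [Algebra.commutes]) (fun p hp => lift_X _ _ hp) hp
      simpa [← Algebra.smul_def] using this)

@[simp] theorem eta_X (a : Fin n → ℤ) (i : Fin n) : eta J a (mX i) = mX i := by simp [eta]

@[simp] theorem eta_K (a b : Fin n → ℤ) : eta J a (mK b) = (d.chi a b)⁻¹ • mK b := by simp [eta]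

@[simp] theorem kap_X (a : Fin n → ℤ) (i : Fin n) :
    kap J a (mX i) = d.chi a (simpleRoot i) • mX i := by simp [kap]

@[simp] theorem kap_K (a b : Fin n → ℤ) : kap J a (mK b) = (d.chi a b)⁻¹ • mK b := by simp [kap]

/-- The derivation passes `F_j` without a scalar and `K_a` with the scalar of `eta`, for either sign
of `e`. -/
theorem skewDer_mul (i : Fin n) (e : Fin n → ℤ) (he : e = simpleRoot i ∨ e = -simpleRoot i)
    (y z : BMinus J) : skewDer J i e he (y * z) =
      skewDer J i e he y * z + eta J (simpleRoot i) y * skewDer J i e he z := by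
  induction y using Borel.induction with
  | zero => simp
  | one => simp [skewDer_one]
  | X_mul j u hu =>
    rw [mul_assoc, skewDer_X_mul, hu, skewDer_X_mul, map_mul, eta_X]
    split_ifs <;> (simp [mul_add, add_mul, mul_assoc]; try abel)
  | K_mul a u hu =>
    rw [mul_assoc, skewDer_K_mul, hu, skewDer_K_mul, map_mul, eta_K, d.minusScalar_eq, d.chi_comm]
    simp only [mul_add, smul_add, smul_mul_assoc, mul_assoc]
  | add u v hu hv => simp only [add_mul, map_add, hu, hv]; abel
  | smul c u hu => simp only [smul_mul_assoc, map_smul, hu, smul_add]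

/-- The action of `E_i` on `H ⋉ U⁻` from the left. -/
def RR (i : Fin n) : Module.End k (BMinus J) := skewDer J i (-simpleRoot i) (Or.inr rfl)

/-- The skew derivation `y ↦ K_i (y ◁ E_i)`. -/
def LL (i : Fin n) : Module.End k (BMinus J) := skewDer J i (simpleRoot i) (Or.inl rfl)

/-- The action of `E_i` on `H ⋉ U⁻` from the right. -/
def CC (i : Fin n) : Module.End k (BMinus J) := LinearMap.mulLeft k (mK (-simpleRoot i)) ∘ₗ LL J i

theorem RR_one (i : Fin n) : RR J i 1 = 0 := skewDer_one _ _ _ _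

theorem RR_X_mul (i j : Fin n) (y : BMinus J) : RR J i (mX j * y) =
    mX j * RR J i y + if i = j then mK (-simpleRoot i) * y else 0 := skewDer_X_mul _ _ _ _ _ _

theorem RR_K_mul (i : Fin n) (a : Fin n → ℤ) (y : BMinus J) :
    RR J i (mK a * y) = (d.chi a (simpleRoot i))⁻¹ • (mK a * RR J i y) := by
  rw [RR, skewDer_K_mul, d.minusScalar_eq]

theorem RR_mul (i : Fin n) (y z : BMinus J) :
    RR J i (y * z) = RR J i y * z + eta J (simpleRoot i) y * RR J i z := skewDer_mul _ _ _ _ _ _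

theorem RR_K (i : Fin n) (a : Fin n → ℤ) : RR J i (mK a) = 0 := by
  have := RR_K_mul J i a 1
  rwa [mul_one, RR_one, mul_zero, smul_zero] at this

theorem RR_mul_K (i : Fin n) (a : Fin n → ℤ) (y : BMinus J) :
    RR J i (y * mK a) = RR J i y * mK a := by
  rw [RR_mul, RR_K, mul_zero, add_zero]

theorem LL_one (i : Fin n) : LL J i 1 = 0 := skewDer_one _ _ _ _

theorem LL_X_mul (i j : Fin n) (y : BMinus J) : LL J i (mX j * y) =
    mX j * LL J i y + if i = j then mK (simpleRoot i) * y else 0 := skewDer_X_mul _ _ _ _ _ _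

theorem LL_K_mul (i : Fin n) (a : Fin n → ℤ) (y : BMinus J) :
    LL J i (mK a * y) = (d.chi a (simpleRoot i))⁻¹ • (mK a * LL J i y) := by
  rw [LL, skewDer_K_mul, d.minusScalar_eq]

theorem CC_apply (i : Fin n) (y : BMinus J) : CC J i y = mK (-simpleRoot i) * LL J i y := rfl

theorem LL_eq (i : Fin n) (y : BMinus J) : LL J i y = mK (simpleRoot i) * CC J i y := by
  rw [CC_apply, ← mul_assoc, K_mul_K_neg, one_mul]

theorem CC_one (i : Fin n) : CC J i 1 = 0 := by rw [CC_apply, LL_one, mul_zero]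

theorem CC_X_mul (i j : Fin n) (y : BMinus J) : CC J i (mX j * y) =
    d.q i j • (mX j * CC J i y) + if i = j then y else 0 := by
  rw [CC_apply, LL_X_mul, mul_add, ← mul_assoc, K_mul_X, minusScalar_neg, smul_mul_assoc,
    mul_assoc, CC_apply]
  split_ifs
  · rw [← mul_assoc (mK (-simpleRoot i)) (mK (simpleRoot i)), K_neg_mul_K, one_mul]
  · simp

theorem CC_K_mul (i : Fin n) (a : Fin n → ℤ) (y : BMinus J) :
    CC J i (mK a * y) = (d.chi a (simpleRoot i))⁻¹ • (mK a * CC J i y) := by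
  rw [CC_apply, LL_K_mul, mul_smul_comm, ← mul_assoc, K_comm, mul_assoc, CC_apply]

theorem CC_mul (i : Fin n) (y z : BMinus J) :
    CC J i (y * z) = CC J i y * z + kap J (simpleRoot i) y * CC J i z := by
  induction y using Borel.induction with
  | zero => simp
  | one => simp [CC_one]
  | X_mul j u hu =>
    rw [mul_assoc, CC_X_mul, hu, CC_X_mul, map_mul, kap_X, d.chi_simple]
    split_ifs <;> (simp [mul_add, add_mul, mul_assoc]; try abel)
  | K_mul a u hu =>
    rw [mul_assoc, CC_K_mul, hu, CC_K_mul, map_mul, kap_K, d.chi_comm]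
    simp only [mul_add, smul_add, smul_mul_assoc, mul_assoc]
  | add u v hu hv => simp only [add_mul, map_add, hu, hv]; abel
  | smul c u hu => simp only [smul_mul_assoc, map_smul, hu, smul_add]

theorem CC_K (i : Fin n) (a : Fin n → ℤ) : CC J i (mK a) = 0 := by
  have := CC_K_mul J i a 1
  rwa [mul_one, CC_one, mul_zero, smul_zero] at this

theorem CC_mul_K (i : Fin n) (a : Fin n → ℤ) (y : BMinus J) :
    CC J i (y * mK a) = CC J i y * mK a := by
  rw [CC_mul, CC_K, mul_zero, add_zero]

/-- A left and a right action derived from the coproduct must commute. On generators the only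
interaction is `K_i⁻¹ u`, and there the scalars match by the symmetry of `q`. -/
theorem RR_CC (i j : Fin n) (y : BMinus J) : RR J i (CC J j y) = CC J j (RR J i y) := by
  induction y using Borel.induction with
  | zero => simp
  | one => simp [CC_one, RR_one]
  | X_mul l u hu =>
    rw [CC_X_mul, map_add, map_smul, RR_X_mul, hu, RR_X_mul, map_add, CC_X_mul]
    have h1 : CC J j (if i = l then mK (-simpleRoot i) * u else 0) =
        if i = l then d.q i j • (mK (-simpleRoot i) * CC J j u) else 0 := by
      split_ifs
      · rw [CC_K_mul, d.chi_neg_left, inv_inv, d.chi_simple]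
      · simp
    rw [h1, apply_ite (RR J i), map_zero, smul_add, smul_ite, smul_zero]
    have h2 : (if i = l then d.q j l • (mK (-simpleRoot i) * CC J j u) else 0) =
        if i = l then d.q i j • (mK (-simpleRoot i) * CC J j u) else 0 := by
      split_ifs with h
      · rw [h, d.q_symm j l]
      · rfl
    rw [h2]
    abel
  | K_mul a u hu =>
    rw [CC_K_mul, map_smul, RR_K_mul, hu, RR_K_mul, map_smul, CC_K_mul, smul_comm]
  | add u v hu hv => simp only [map_add, hu, hv]
  | smul c u hu => simp only [map_smul, hu]

/-- `LL` is `CC` followed by multiplication with `K_i`, and `RR` moves past `K_i` at the cost of a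
scalar. This q-commutation is what makes `LL - RR` respect the relations of U⁺. -/
theorem LL_RR (i j : Fin n) (y : BMinus J) :
    LL J i (RR J j y) = d.q i j • RR J j (LL J i y) := by
  rw [LL_eq, LL_eq, RR_K_mul, RR_CC, smul_smul, d.chi_simple, mul_inv_cancel₀ (d.q_ne_zero _ _),
    one_smul]

/-- On U⁻ the operators `RR` and `CC` reduce to the derivations of the tensor algebra, which ties
them to the form. -/
theorem RR_emb (i : Fin n) (u : Tens k n) :
    RR J i (mE u) = mE (dR d i u) * mK (-simpleRoot i) := by
  induction u using tens_induction with
  | zero => simp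
  | one => simp [RR_one]
  | mul j u hu =>
    rw [map_mul, emb_ι, RR_X_mul, hu, dR_ι_mul, map_add, map_mul, emb_ι, add_mul, mul_assoc]
    split_ifs
    · rw [K_neg_mul_emb]
    · simp
  | add u v hu hv => simp only [map_add, hu, hv, add_mul]
  | smul c u hu => simp only [map_smul, hu, smul_mul_assoc]

theorem CC_emb (i : Fin n) (u : Tens k n) : CC J i (mE u) = mE (dL d i u) := by
  induction u using tens_induction with
  | zero => simp
  | one => simp [CC_one]
  | mul j u hu =>
    rw [map_mul, emb_ι, CC_X_mul, hu, dL_ι_mul, map_add, map_smul, map_mul, emb_ι]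
    split_ifs <;> simp
  | add u v hu hv => simp only [map_add, hu, hv]
  | smul c u hu => simp only [map_smul, hu]

theorem lift_RR_word (w : List (Fin n)) (u : Tens k n) (a : Fin n → ℤ) :
    FreeAlgebra.lift k (RR J) (word k w) (mE u * mK a) =
      mE (FreeAlgebra.lift k (dR d) (word k w) u) * mK (a - zwt w) := by
  induction w with
  | nil => simp [word_nil, zwt_nil]
  | cons i w ih =>
    rw [word_cons, map_mul (FreeAlgebra.lift k (RR J)), map_mul (FreeAlgebra.lift k (dR d)),
      Module.End.mul_apply, ih, FreeAlgebra.lift_ι_apply, RR_mul_K,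
      RR_emb, mul_assoc, ← K_add, FreeAlgebra.lift_ι_apply, Module.End.mul_apply, zwt_cons]
    congr 2
    abel

/-- The right side depends neither on `J` nor on `a`. It follows that the form vanishes on every
such `J`, and that counits of operators `p(RR)` can be computed in the tensor algebra. -/
theorem counit_lift_RR (p u : Tens k n) (a : Fin n → ℤ) :
    Borel.counit _ J (FreeAlgebra.lift k (RR J) p (mE u * mK a)) = form d p u := by
  have h : (Borel.counit (minusScalar d) J).toLinearMap ∘ₗ
      LinearMap.applyₗ (mE u * mK a) ∘ₗ (FreeAlgebra.lift k (RR J)).toLinearMap =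
      (form d).flip u := by
    refine tens_ext fun w => ?_
    simp only [LinearMap.comp_apply, AlgHom.toLinearMap_apply, LinearMap.applyₗ_apply_apply,
      lift_RR_word, map_mul, counit_emb, counit_K, mul_one]
    rfl
  exact congrArg (fun f => f p) h

theorem lift_CC_emb (p u : Tens k n) (a : Fin n → ℤ) :
    FreeAlgebra.lift k (CC J) p (mE u * mK a) = mE (FreeAlgebra.lift k (dL d) p u) * mK a := by
  induction p using tens_induction with
  | zero => simp
  | one => simp
  | mul i p hp =>
    rw [map_mul (FreeAlgebra.lift k (CC J)), Module.End.mul_apply, hp,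
      FreeAlgebra.lift_ι_apply, CC_mul_K, CC_emb]
    simp
  | add p q hp hq => simp only [map_add, LinearMap.add_apply, add_mul, hp, hq]
  | smul c p hp => simp only [map_smul, LinearMap.smul_apply, smul_mul_assoc, hp]

end Minus

/-! ### The maximal biideal is the radical -/

section Max

open Borel

variable {k : Type*} [Field k] {n : ℕ} (d : Datum k n)

/-- The maximal graded biideal is the radical of the form. -/
theorem maxIdeal_carrier_eq : (maxIdeal d).carrier = radical d := by
  refine le_antisymm (fun p hp => ?_) (radical_le_max d)
  rw [mem_radical]
  intro q
  -- The form can be evaluated in H ⋉ U⁻_max, where `p` is zero.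
  rw [← counit_lift_RR (maxIdeal d) q p 0, emb_of_mem _ _ hp]
  simp

/-- Reversal preserves the form and hence its radical. This is what allows antihomomorphisms out of
U⁺_max. -/
theorem rev_mem_max {p : Tens k n} (hp : p ∈ (maxIdeal d).carrier) :
    rev k n p ∈ (maxIdeal d).carrier := by
  rw [maxIdeal_carrier_eq] at hp ⊢
  exact rev_mem_radical d hp

end Max

/-! ### The two actions of U⁺_max ⋊ H on H ⋉ U⁻ -/

section Actions

open Borel

variable {k : Type*} [Field k] {n : ℕ} {d : Datum k n} (J : PreNicholsIdeal d)

local notation "mX" => Borel.X (minusScalar d) J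
local notation "mK" => Borel.K (minusScalar d) J
local notation "mE" => Borel.emb (minusScalar d) J

@[simp] theorem comulMinus_X (i : Fin n) :
    comulMinus J (mX i) = 1 ⊗ₜ mX i + mX i ⊗ₜ mK (-simpleRoot i) := by simp [comulMinus]

@[simp] theorem comulMinus_K (a : Fin n → ℤ) : comulMinus J (mK a) = mK a ⊗ₜ mK a := by
  simp [comulMinus]

@[simp] theorem comulPlus_X (i : Fin n) : comulPlus J (Borel.X _ J i) =
    Borel.X _ J i ⊗ₜ 1 + Borel.K _ J (simpleRoot i) ⊗ₜ Borel.X _ J i := by simp [comulPlus]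

@[simp] theorem comulPlus_K (a : Fin n → ℤ) :
    comulPlus J (Borel.K _ J a) = Borel.K _ J a ⊗ₜ Borel.K _ J a := by
  simp [comulPlus]

theorem counit_comulMinus_left (y : BMinus J) : TensorProduct.lid k _ (TensorProduct.map
    (Borel.counit (minusScalar d) J).toLinearMap LinearMap.id (comulMinus J y)) = y := by
  have : ((Algebra.TensorProduct.lid k (BMinus J)).toAlgHom.comp (Algebra.TensorProduct.map
      (Borel.counit (minusScalar d) J) (AlgHom.id k _))).comp (comulMinus J) = AlgHom.id k _ :=
    hom_ext (by simp) (by simp)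
  exact congrArg (fun f => f y) this

theorem counit_comulMinus_right (y : BMinus J) : TensorProduct.rid k _ (TensorProduct.map
    LinearMap.id (Borel.counit (minusScalar d) J).toLinearMap (comulMinus J y)) = y := by
  have : ((Algebra.TensorProduct.rid k k (BMinus J)).toAlgHom.comp (Algebra.TensorProduct.map
      (AlgHom.id k _) (Borel.counit (minusScalar d) J))).comp (comulMinus J) = AlgHom.id k _ :=
    hom_ext (by simp) (by simp)
  exact congrArg (fun f => f y) this

theorem comulMinus_eta (a : Fin n → ℤ) (y : BMinus J) : comulMinus J (eta J a y) =
    TensorProduct.map (eta J a).toLinearMap LinearMap.id (comulMinus J y) := by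
  have : (comulMinus J).comp (eta J a) = (Algebra.TensorProduct.map
      (eta J a) (AlgHom.id k _)).comp (comulMinus J) :=
    hom_ext (by simp) (by simp [TensorProduct.smul_tmul'])
  exact congrArg (fun f => f y) this

theorem comulMinus_kap (a : Fin n → ℤ) (y : BMinus J) : comulMinus J (kap J a y) =
    TensorProduct.map LinearMap.id (kap J a).toLinearMap (comulMinus J y) := by
  have : (comulMinus J).comp (kap J a) = (Algebra.TensorProduct.map
      (AlgHom.id k _) (kap J a)).comp (comulMinus J) :=
    hom_ext (by simp [d.chi_neg_right]) (by simp)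
  exact congrArg (fun f => f y) this

/-- An operator that passes to one tensor factor of the coproduct is determined by its composition
with the counit. This holds for `RR` on the left factor and for `CC` on the right one, as expected
of `⟨y₍₁₎, E_i⟩ y₍₂₎` and `y₍₁₎ ⟨y₍₂₎, E_i⟩`. -/
theorem comulMinus_RR (i : Fin n) (y : BMinus J) : comulMinus J (RR J i y) =
    TensorProduct.map (RR J i) LinearMap.id (comulMinus J y) := by
  induction y using Borel.induction with
  | zero => simp
  | one => simp [RR_one, Algebra.TensorProduct.one_def]
  | X_mul j u hu =>
    rw [RR_X_mul, map_add, map_mul, hu, map_mul, comulMinus_X]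
    have h0 : comulMinus J (if i = j then mK (-simpleRoot i) * u else 0) =
        if i = j then (mK (-simpleRoot i) ⊗ₜ mK (-simpleRoot i)) * comulMinus J u else 0 := by
      split_ifs <;> simp
    rw [h0]
    generalize comulMinus J u = z
    induction z with
    | zero => simp
    | add a b ha hb =>
      simp only [map_add, mul_add] at ha hb ⊢
      rw [← ha, ← hb]
      split_ifs <;> abel
    | tmul a b =>
      simp only [add_mul, Algebra.TensorProduct.tmul_mul_tmul, TensorProduct.map_tmul,
        LinearMap.id_apply, map_add, RR_X_mul, one_mul]
      split_ifs with h
      · subst h; simp [TensorProduct.add_tmul, add_assoc]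
      · simp
  | K_mul a u hu =>
    rw [RR_K_mul, map_smul, map_mul, hu, map_mul, comulMinus_K]
    generalize comulMinus J u = z
    induction z with
    | zero => simp
    | add a b ha hb =>
      simp only [map_add, mul_add, smul_add] at ha hb ⊢
      rw [← ha, ← hb]
    | tmul b c => simp [RR_K_mul, TensorProduct.smul_tmul']
  | add u v hu hv => simp only [map_add, hu, hv]
  | smul c u hu => simp only [map_smul, hu]

theorem comulMinus_CC (i : Fin n) (y : BMinus J) : comulMinus J (CC J i y) =
    TensorProduct.map LinearMap.id (CC J i) (comulMinus J y) := by
  induction y using Borel.induction with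
  | zero => simp
  | one => simp [CC_one, Algebra.TensorProduct.one_def]
  | X_mul j u hu =>
    rw [CC_X_mul, map_add, map_smul, map_mul, hu, map_mul, comulMinus_X]
    have h0 : comulMinus J (if i = j then u else 0) =
        if i = j then comulMinus J u else 0 := by
      split_ifs <;> simp
    rw [h0]
    generalize comulMinus J u = z
    induction z with
    | zero => simp
    | add a b ha hb =>
      simp only [map_add, mul_add, smul_add] at ha hb ⊢
      rw [← ha, ← hb]
      split_ifs <;> abel
    | tmul a b =>
      simp only [add_mul, Algebra.TensorProduct.tmul_mul_tmul, TensorProduct.map_tmul,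
        LinearMap.id_apply, map_add, CC_X_mul, one_mul, CC_K_mul, d.chi_neg_left, inv_inv,
        TensorProduct.tmul_add, TensorProduct.tmul_smul, smul_add, d.chi_simple, d.q_symm j i]
      split_ifs with h
      · abel
      · simp
  | K_mul a u hu =>
    rw [CC_K_mul, map_smul, map_mul, hu, map_mul, comulMinus_K]
    generalize comulMinus J u = z
    induction z with
    | zero => simp
    | add a b ha hb =>
      simp only [map_add, mul_add, smul_add] at ha hb ⊢
      rw [← ha, ← hb]
    | tmul b c => simp [CC_K_mul]
  | add u v hu hv => simp only [map_add, hu, hv]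
  | smul c u hu => simp only [map_smul, hu]

theorem eta_RR (a : Fin n → ℤ) (i : Fin n) (y : BMinus J) :
    eta J a (RR J i y) = d.chi a (simpleRoot i) • RR J i (eta J a y) := by
  induction y using Borel.induction with
  | zero => simp
  | one => simp [RR_one]
  | X_mul j u hu =>
    rw [RR_X_mul, map_add, map_mul, hu, map_mul, eta_X, RR_X_mul]
    split_ifs <;> simp [d.chi_neg_right, smul_add]
  | K_mul b u hu =>
    rw [RR_K_mul, map_smul, map_mul, hu, map_mul, eta_K, smul_mul_assoc, smul_mul_assoc,
      map_smul (RR J i), RR_K_mul]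
    simp only [mul_smul_comm, smul_smul]
    congr 1; ring
  | add u v hu hv => simp only [map_add, hu, hv, smul_add]
  | smul c u hu => simp only [map_smul, hu, smul_comm c]

theorem CC_kap (a : Fin n → ℤ) (i : Fin n) (y : BMinus J) :
    CC J i (kap J a y) = d.chi a (simpleRoot i) • kap J a (CC J i y) := by
  induction y using Borel.induction with
  | zero => simp
  | one => simp [CC_one]
  | X_mul j u hu =>
    rw [map_mul, kap_X, smul_mul_assoc, map_smul, CC_X_mul, hu, CC_X_mul, map_add, map_smul,
      map_mul, kap_X]
    simp only [smul_mul_assoc, mul_smul_comm, smul_smul, smul_add]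
    split_ifs with h
    · subst h
      congr 2
    · simp only [smul_zero, map_zero]
      congr 2
      ring
  | K_mul b u hu =>
    rw [CC_K_mul, map_smul, map_mul (kap J a), map_mul (kap J a), kap_K, smul_mul_assoc, map_smul,
      CC_K_mul, hu]
    simp only [smul_mul_assoc, mul_smul_comm, smul_smul]
    congr 1; ring
  | add u v hu hv => simp only [map_add, hu, hv, smul_add]
  | smul c u hu => simp only [map_smul, hu, smul_comm c]

theorem RR_kap (a : Fin n → ℤ) (i : Fin n) (y : BMinus J) :
    RR J i (kap J a y) = kap J a (RR J i y) := by
  induction y using Borel.induction with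
  | zero => simp
  | one => simp [RR_one]
  | X_mul j u hu =>
    rw [map_mul, kap_X, smul_mul_assoc, map_smul, RR_X_mul, hu, RR_X_mul, map_add, map_mul, kap_X]
    split_ifs with h
    · subst h; simp [d.chi_neg_right, smul_add]
    · simp
  | K_mul b u hu =>
    rw [map_mul, kap_K, smul_mul_assoc, map_smul, RR_K_mul, hu, RR_K_mul, map_smul, map_mul, kap_K]
    simp only [smul_mul_assoc, smul_smul]
    congr 1; ring
  | add u v hu hv => simp only [map_add, hu, hv]
  | smul c u hu => simp only [map_smul, hu]

theorem eta_CC (a : Fin n → ℤ) (i : Fin n) (y : BMinus J) :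
    eta J a (CC J i y) = CC J i (eta J a y) := by
  induction y using Borel.induction with
  | zero => simp
  | one => simp [CC_one]
  | X_mul j u hu =>
    rw [map_mul (eta J a), eta_X, CC_X_mul, CC_X_mul, map_add, map_smul, map_mul, eta_X, hu]
    split_ifs <;> simp
  | K_mul b u hu =>
    rw [map_mul (eta J a), eta_K, smul_mul_assoc, map_smul, CC_K_mul, CC_K_mul, map_smul, map_mul,
      eta_K, hu]
    simp only [smul_mul_assoc, smul_smul]
    congr 1; ring
  | add u v hu hv => simp only [map_add, hu, hv]
  | smul c u hu => simp only [map_smul, hu]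

theorem eta_kap (a b : Fin n → ℤ) (y : BMinus J) :
    eta J a (kap J b y) = kap J b (eta J a y) := by
  have : (eta J a).comp (kap J b) = (kap J b).comp (eta J a) :=
    hom_ext (by simp) (by simp [smul_smul, mul_comm])
  exact congrArg (fun f => f y) this

/-- The counit of `p(RR)` is a value of the form at an element of the radical, hence zero. Since
`p(RR)` acts on the left factor of the coproduct, the counit axiom then makes the operator itself
zero. The relations of the Nichols algebra thus hold on H ⋉ U⁻ for every pre-Nichols algebra U⁻. -/
theorem lift_RR_of_mem_max {p : Tens k n} (hp : p ∈ (maxIdeal d).carrier) :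
    FreeAlgebra.lift k (RR J) p = 0 := by
  have h0 : (Borel.counit (minusScalar d) J).toLinearMap ∘ₗ FreeAlgebra.lift k (RR J) p = 0 := by
    refine ext_emb_K fun l a => ?_
    rw [maxIdeal_carrier_eq, mem_radical] at hp
    simp only [LinearMap.comp_apply, AlgHom.toLinearMap_apply, counit_lift_RR]
    rw [form_symm, hp]
    rfl
  have h1 : ∀ (p : Tens k n) (y : BMinus J), comulMinus J (FreeAlgebra.lift k (RR J) p y) =
      TensorProduct.map (FreeAlgebra.lift k (RR J) p) LinearMap.id (comulMinus J y) := by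
    intro p y
    induction p using tens_induction with
    | zero => simp
    | one => simp [← Module.End.one_eq_id]
    | mul i q hq =>
      rw [map_mul, Module.End.mul_eq_comp, ← LinearMap.comp_id LinearMap.id, TensorProduct.map_comp,
        LinearMap.comp_apply, LinearMap.comp_apply, ← hq, FreeAlgebra.lift_ι_apply, comulMinus_RR]
    | add p q hp hq => simp only [map_add, LinearMap.add_apply, TensorProduct.map_add_left, hp, hq]
    | smul c p hp => simp only [map_smul, LinearMap.smul_apply, TensorProduct.map_smul_left, hp]
  refine LinearMap.ext fun y => ?_
  rw [← counit_comulMinus_left J (FreeAlgebra.lift k (RR J) p y), h1,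
    ← LinearMap.comp_apply (TensorProduct.map _ _) (TensorProduct.map _ _),
    ← TensorProduct.map_comp, h0]
  simp

/-- The argument is that of `lift_RR_of_mem_max` on the right tensor factor. Here `ε ∘ p(∂^L)` gives
the form with `p` reversed, so stability of the radical under reversal enters. -/
theorem lift_CC_of_mem_max {p : Tens k n} (hp : p ∈ (maxIdeal d).carrier) :
    FreeAlgebra.lift k (CC J) p = 0 := by
  have h0 : (Borel.counit (minusScalar d) J).toLinearMap ∘ₗ FreeAlgebra.lift k (CC J) p = 0 := by
    refine ext_emb_K fun l a => ?_
    have hp' := rev_mem_max d hp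
    rw [maxIdeal_carrier_eq, mem_radical] at hp'
    simp only [LinearMap.comp_apply, AlgHom.toLinearMap_apply, lift_CC_emb, map_mul, counit_emb,
      counit_K, mul_one, tensCounit_lift_dL]
    rw [form_symm, hp']
    rfl
  have h1 : ∀ (p : Tens k n) (y : BMinus J), comulMinus J (FreeAlgebra.lift k (CC J) p y) =
      TensorProduct.map LinearMap.id (FreeAlgebra.lift k (CC J) p) (comulMinus J y) := by
    intro p y
    induction p using tens_induction with
    | zero => simp
    | one => simp [← Module.End.one_eq_id]
    | mul i q hq =>
      rw [map_mul, Module.End.mul_eq_comp, ← LinearMap.comp_id LinearMap.id, TensorProduct.map_comp,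
        LinearMap.comp_apply, LinearMap.comp_apply, ← hq, FreeAlgebra.lift_ι_apply, comulMinus_CC]
    | add p q hp hq => simp only [map_add, LinearMap.add_apply, TensorProduct.map_add_right, hp, hq]
    | smul c p hp => simp only [map_smul, LinearMap.smul_apply, TensorProduct.map_smul_right, hp]
  refine LinearMap.ext fun y => ?_
  rw [← counit_comulMinus_right J (FreeAlgebra.lift k (CC J) p y), h1,
    ← LinearMap.comp_apply (TensorProduct.map _ _) (TensorProduct.map _ _),
    ← TensorProduct.map_comp, h0]
  simp

/-- The left action of `U⁺_max ⋊ H` on `H ⋉ U⁻`. -/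
def lact : BPlus (maxIdeal d) →ₐ[k] Module.End k (BMinus J) :=
  Borel.lift _ _ (RR J) (fun a => (eta J a).toLinearMap)
    (by
      have : eta J 0 = AlgHom.id k _ :=
        hom_ext (by simp) (by simp [d.chi_zero_left])
      rw [this]; rfl)
    (by
      intro a b
      have : eta J (a + b) = (eta J a).comp (eta J b) :=
        hom_ext (by simp) (by intro c; simp [d.chi_add_left, smul_smul, mul_comm])
      rw [this]; rfl)
    (by
      intro a i
      refine LinearMap.ext fun y => ?_
      exact eta_RR J a i y)
    (fun _ hp => lift_RR_of_mem_max J hp)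

/-- The right action of `U⁺_max ⋊ H` on `H ⋉ U⁻`. -/
def ractHom : BPlus (maxIdeal d) →ₐ[k] (Module.End k (BMinus J))ᵐᵒᵖ :=
  Borel.lift _ _ (fun i => MulOpposite.op (CC J i)) (fun a => MulOpposite.op (kap J a).toLinearMap)
    (by
      have : kap J 0 = AlgHom.id k _ :=
        hom_ext (by simp [d.chi_zero_left]) (by simp [d.chi_zero_left])
      rw [this]; rfl)
    (by
      intro a b
      have : kap J (a + b) = (kap J b).comp (kap J a) :=
        hom_ext (by intro c; simp [d.chi_add_left, smul_smul])
          (by intro c; simp [d.chi_add_left, smul_smul, mul_comm])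
      rw [this]; rfl)
    (by
      intro a i
      rw [← MulOpposite.op_mul, ← MulOpposite.op_mul, ← MulOpposite.op_smul]
      congr 1
      refine LinearMap.ext fun y => ?_
      exact CC_kap J a i y)
    (fun p hp => by rw [lift_op, lift_CC_of_mem_max J (rev_mem_max d hp), MulOpposite.op_zero])

/-- The right action of an element of `U⁺_max ⋊ H` on `H ⋉ U⁻`. -/
def ract : BPlus (maxIdeal d) →ₗ[k] Module.End k (BMinus J) :=
  (MulOpposite.opLinearEquiv k).symm.toLinearMap ∘ₗ (ractHom J).toLinearMap

@[simp] theorem lact_X (i : Fin n) : lact J (Borel.X _ _ i) = RR J i := by simp [lact]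

@[simp] theorem lact_K (a : Fin n → ℤ) : lact J (Borel.K _ _ a) = (eta J a).toLinearMap := by
  simp [lact]

@[simp] theorem ract_X (i : Fin n) : ract J (Borel.X _ _ i) = CC J i := by simp [ract, ractHom]

@[simp] theorem ract_K (a : Fin n → ℤ) : ract J (Borel.K _ _ a) = (kap J a).toLinearMap := by
  simp [ract, ractHom]

@[simp] theorem ract_one : ract J 1 = 1 := by simp [ract]

theorem ract_mul (x y : BPlus (maxIdeal d)) : ract J (x * y) = ract J y * ract J x := by
  simp [ract]

theorem comulMinus_lact (x : BPlus (maxIdeal d)) (y : BMinus J) : comulMinus J (lact J x y) =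
    TensorProduct.map (lact J x) LinearMap.id (comulMinus J y) := by
  induction x using Borel.induction with
  | zero => simp
  | one => simp [← Module.End.one_eq_id]
  | X_mul i u hu =>
    rw [map_mul, Module.End.mul_eq_comp, ← LinearMap.comp_id LinearMap.id, TensorProduct.map_comp,
      LinearMap.comp_apply, LinearMap.comp_apply, ← hu, lact_X, comulMinus_RR]
  | K_mul i u hu =>
    rw [map_mul, Module.End.mul_eq_comp, ← LinearMap.comp_id LinearMap.id, TensorProduct.map_comp,
      LinearMap.comp_apply, LinearMap.comp_apply, ← hu, lact_K, AlgHom.toLinearMap_apply,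
      comulMinus_eta]
  | add p q hp hq => simp only [map_add, LinearMap.add_apply, TensorProduct.map_add_left, hp, hq]
  | smul c p hp => simp only [map_smul, LinearMap.smul_apply, TensorProduct.map_smul_left, hp]

theorem comulMinus_ract (x : BPlus (maxIdeal d)) (y : BMinus J) : comulMinus J (ract J x y) =
    TensorProduct.map LinearMap.id (ract J x) (comulMinus J y) := by
  induction x using Borel.induction generalizing y with
  | zero => simp
  | one => simp [← Module.End.one_eq_id]
  | X_mul i u hu =>
    rw [ract_mul, Module.End.mul_eq_comp, ← LinearMap.comp_id LinearMap.id, TensorProduct.map_comp,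
      LinearMap.comp_apply, LinearMap.comp_apply, hu, ract_X, comulMinus_CC]
  | K_mul i u hu =>
    rw [ract_mul, Module.End.mul_eq_comp, ← LinearMap.comp_id LinearMap.id, TensorProduct.map_comp,
      LinearMap.comp_apply, LinearMap.comp_apply, hu, ract_K, AlgHom.toLinearMap_apply,
      comulMinus_kap]
  | add p q hp hq => simp only [map_add, LinearMap.add_apply, TensorProduct.map_add_right, hp, hq]
  | smul c p hp => simp only [map_smul, LinearMap.smul_apply, TensorProduct.map_smul_right, hp]

theorem lact_CC (x : BPlus (maxIdeal d)) (i : Fin n) (y : BMinus J) :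
    lact J x (CC J i y) = CC J i (lact J x y) := by
  induction x using Borel.induction generalizing y with
  | zero => simp
  | one => simp
  | X_mul j u hu => simp [hu, RR_CC]
  | K_mul a u hu => simp [hu, eta_CC]
  | add u v hu hv => simp [hu, hv]
  | smul c u hu => simp [hu]

theorem lact_kap (x : BPlus (maxIdeal d)) (a : Fin n → ℤ) (y : BMinus J) :
    lact J x (kap J a y) = kap J a (lact J x y) := by
  induction x using Borel.induction generalizing y with
  | zero => simp
  | one => simp
  | X_mul j u hu => simp [hu, RR_kap]
  | K_mul a u hu => simp [hu, eta_kap]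
  | add u v hu hv => simp [hu, hv]
  | smul c u hu => simp [hu]

theorem counit_RR (i : Fin n) (y : BMinus J) :
    Borel.counit _ J (RR J i y) = Borel.counit _ J (CC J i y) := by
  induction y using Borel.induction with
  | zero => simp
  | one => simp [CC_one, RR_one]
  | X_mul j u hu =>
    rw [RR_X_mul, CC_X_mul]
    split_ifs <;> simp
  | K_mul a u hu => simp [RR_K_mul, CC_K_mul, hu]
  | add u v hu hv => simp only [map_add, hu, hv]
  | smul c u hu => simp only [map_smul, hu]

theorem counit_eta (a : Fin n → ℤ) (y : BMinus J) :
    Borel.counit _ J (eta J a y) = Borel.counit _ J (kap J a y) := by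
  have : (Borel.counit _ J).comp (eta J a) = (Borel.counit _ J).comp (kap J a) :=
    hom_ext (by simp) (by simp)
  exact congrArg (fun f => f y) this

/-- Both sides equal `⟨π_max(y), x⟩`. They agree for generators, and the inductive step exchanges
the two commuting actions. -/
theorem counit_lact (x : BPlus (maxIdeal d)) (y : BMinus J) :
    Borel.counit _ J (lact J x y) = Borel.counit _ J (ract J x y) := by
  induction x using Borel.induction generalizing y with
  | zero => simp
  | one => simp
  | X_mul j u hu =>
    rw [map_mul, ract_mul, Module.End.mul_apply, Module.End.mul_apply, lact_X, ract_X, counit_RR,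
      ← lact_CC, hu]
  | K_mul a u hu =>
    rw [map_mul, ract_mul, Module.End.mul_apply, Module.End.mul_apply, lact_K, ract_K,
      AlgHom.toLinearMap_apply, AlgHom.toLinearMap_apply, counit_eta, ← lact_kap, hu]
  | add u v hu hv => simp [hu, hv]
  | smul c u hu => simp [hu]

theorem toMax_RR (i : Fin n) (y : BMinus J) :
    Borel.toMax _ J (RR J i y) = RR (maxIdeal d) i (Borel.toMax _ J y) := by
  induction y using Borel.induction with
  | zero => simp
  | one => simp [RR_one]
  | X_mul j u hu =>
    rw [RR_X_mul, map_mul, toMax_X, RR_X_mul, map_add, map_mul, toMax_X, hu]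
    split_ifs <;> simp
  | K_mul a u hu => simp [RR_K_mul, hu]
  | add u v hu hv => simp only [map_add, hu, hv]
  | smul c u hu => simp only [map_smul, hu]

theorem toMax_lact (x : BPlus (maxIdeal d)) (y : BMinus J) :
    Borel.toMax _ J (lact J x y) = lact (maxIdeal d) x (Borel.toMax _ J y) := by
  have he : ∀ a y, Borel.toMax _ J (eta J a y) = eta (maxIdeal d) a (Borel.toMax _ J y) := by
    intro a y
    have : (Borel.toMax _ J).comp (eta J a) = (eta (maxIdeal d) a).comp (Borel.toMax _ J) :=
      hom_ext (by simp) (by simp)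
    exact congrArg (fun f => f y) this
  induction x using Borel.induction generalizing y with
  | zero => simp
  | one => simp
  | X_mul j u hu => simp [hu, toMax_RR]
  | K_mul a u hu => simp [hu, he]
  | add u v hu hv => simp [hu, hv]
  | smul c u hu => simp [hu]

theorem counit_toMax (y : BMinus J) :
    Borel.counit _ (maxIdeal d) (Borel.toMax _ J y) = Borel.counit _ J y := by
  have : (Borel.counit _ (maxIdeal d)).comp (Borel.toMax (minusScalar d) J) = Borel.counit _ J :=
    hom_ext (by simp) (by simp)
  exact congrArg (fun f => f y) this

end Actions

/-! ### The skew Hopf pairing -/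

section Pairing

open Borel

variable {k : Type*} [Field k] {n : ℕ} (d : Datum k n)

/-- The pairing `⟨y, x⟩ = ε(x ▷ y)`. -/
def actPairing : BMinus (maxIdeal d) →ₗ[k] BPlus (maxIdeal d) →ₗ[k] k :=
  ((lact (maxIdeal d)).toLinearMap.compr₂ (Borel.counit _ (maxIdeal d)).toLinearMap).flip

theorem actPairing_apply (y : BMinus (maxIdeal d)) (x : BPlus (maxIdeal d)) :
    actPairing d y x = Borel.counit _ _ (lact (maxIdeal d) x y) := rfl

variable {d}

theorem actPairing_toMax (J : PreNicholsIdeal d) (x : BPlus (maxIdeal d)) (y : BMinus J) :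
    actPairing d (Borel.toMax _ J y) x = Borel.counit _ J (lact J x y) := by
  rw [actPairing_apply, ← toMax_lact, counit_toMax]

/-- The functional `⟨π_max(·), x⟩` is `ε ∘ (x ▷)`, and `x ▷` passes to the left factor of the
coproduct, so the counit axiom leaves `x ▷ y`. -/
theorem lact_eq_actPairing (J : PreNicholsIdeal d) (x : BPlus (maxIdeal d)) (y : BMinus J) :
    TensorProduct.lid k (BMinus J) (TensorProduct.map
      ((actPairing d).flip x ∘ₗ (Borel.toMax (minusScalar d) J).toLinearMap) LinearMap.id
      (comulMinus J y)) = lact J x y := by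
  have h : (actPairing d).flip x ∘ₗ (Borel.toMax (minusScalar d) J).toLinearMap =
      (Borel.counit (minusScalar d) J).toLinearMap ∘ₗ lact J x :=
    LinearMap.ext fun y => actPairing_toMax J x y
  rw [h, ← LinearMap.comp_id LinearMap.id, TensorProduct.map_comp, LinearMap.comp_apply,
    ← comulMinus_lact, counit_comulMinus_left]

theorem ract_eq_actPairing (J : PreNicholsIdeal d) (x : BPlus (maxIdeal d)) (y : BMinus J) :
    TensorProduct.rid k (BMinus J) (TensorProduct.map LinearMap.id
      ((actPairing d).flip x ∘ₗ (Borel.toMax (minusScalar d) J).toLinearMap)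
      (comulMinus J y)) = ract J x y := by
  have h : (actPairing d).flip x ∘ₗ (Borel.toMax (minusScalar d) J).toLinearMap =
      (Borel.counit (minusScalar d) J).toLinearMap ∘ₗ ract J x :=
    LinearMap.ext fun y => (actPairing_toMax J x y).trans (counit_lact J x y)
  rw [h, ← LinearMap.comp_id LinearMap.id, TensorProduct.map_comp, LinearMap.comp_apply,
    ← comulMinus_ract, counit_comulMinus_right]

theorem endTensorEnd_tmul {V : Type*} [AddCommGroup V] [Module k V] (f g : Module.End k V)
    (a b : V) : Module.endTensorEndAlgHom (R := k) (S := k) (A := k) (f ⊗ₜ[k] g) (a ⊗ₜ[k] b) =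
      f a ⊗ₜ g b := rfl

/-- The left action on products. -/
theorem lact_mul' (J : PreNicholsIdeal d) (x : BPlus (maxIdeal d)) (z : BMinus J ⊗[k] BMinus J) :
    lact J x (LinearMap.mul' k _ z) = LinearMap.mul' k _
      (Module.endTensorEndAlgHom (R := k) (S := k) (A := k) (M := BMinus J) (N := BMinus J) (Algebra.TensorProduct.map (lact J) (lact J)
        (comulPlus _ x)) z) := by
  induction x using Borel.induction generalizing z with
  | zero => simp
  | one => simp
  | X_mul i u hu =>
    rw [map_mul, map_mul, map_mul, map_mul, Module.End.mul_apply, Module.End.mul_apply, hu]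
    generalize Module.endTensorEndAlgHom (R := k) (S := k) (A := k) (M := BMinus J) (N := BMinus J) (Algebra.TensorProduct.map (lact J) (lact J)
        (comulPlus _ u)) z = w
    induction w with
    | zero => simp
    | add a b ha hb => simp only [map_add] at ha hb ⊢; rw [ha, hb]
    | tmul a b => simp [RR_mul, endTensorEnd_tmul]
  | K_mul a u hu =>
    rw [map_mul, map_mul, map_mul, map_mul, Module.End.mul_apply, Module.End.mul_apply, hu]
    generalize Module.endTensorEndAlgHom (R := k) (S := k) (A := k) (M := BMinus J) (N := BMinus J) (Algebra.TensorProduct.map (lact J) (lact J)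
        (comulPlus _ u)) z = w
    induction w with
    | zero => simp
    | add a b ha hb => simp only [map_add] at ha hb ⊢; rw [ha, hb]
    | tmul a b => simp [endTensorEnd_tmul]
  | add u v hu hv => simp [hu, hv]
  | smul c u hu => simp [hu]

theorem lact_one (J : PreNicholsIdeal d) (x : BPlus (maxIdeal d)) :
    lact J x 1 = algebraMap k _ (Borel.counit _ _ x) := by
  induction x using Borel.induction with
  | zero => simp
  | one => simp
  | X_mul i u hu => simp [hu, Algebra.algebraMap_eq_smul_one, RR_one]
  | K_mul a u hu => simp [hu, Algebra.algebraMap_eq_smul_one]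
  | add u v hu hv => simp [hu, hv]
  | smul c u hu => simp [hu, Algebra.algebraMap_eq_smul_one, mul_smul]

/-- The product rule in `x` holds because `▷` is an action; the product rule in `y` holds because
`▷` satisfies a Leibniz rule along the coproduct of `x`. -/
theorem isSkewHopfPairing_actPairing : IsSkewHopfPairing d (actPairing d) where
  apply_mul y x x' := by
    have h : (actPairing d).flip x' ∘ₗ (Borel.toMax (minusScalar d) (maxIdeal d)).toLinearMap =
        (actPairing d).flip x' := by
      refine LinearMap.ext fun y => ?_
      exact actPairing_toMax (maxIdeal d) x' y
    rw [actPairing_apply, map_mul, Module.End.mul_apply, ← lact_eq_actPairing _ x', h]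
    generalize comulMinus _ y = z
    induction z with
    | zero => simp
    | add a b ha hb => simp only [map_add, ha, hb]
    | tmul a b => simp [actPairing_apply]
  mul_apply y y' x := by
    have := lact_mul' (maxIdeal d) x (y ⊗ₜ y')
    rw [LinearMap.mul'_apply] at this
    rw [actPairing_apply, this]
    generalize comulPlus _ x = z
    induction z with
    | zero => simp
    | add a b ha hb => simp only [map_add, LinearMap.add_apply, ha, hb]
    | tmul a b => simp [actPairing_apply, endTensorEnd_tmul]
  apply_one y := by simp [actPairing_apply]
  one_apply x := by rw [actPairing_apply, lact_one]; simp
  F_E i j := by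
    have := RR_X_mul (maxIdeal d) j i 1
    rw [mul_one] at this
    rw [actPairing_apply, lact_X, this]
    by_cases h : i = j
    · subst h; simp [RR_one]
    · simp [RR_one, h, Ne.symm h]
  K_K i j := by simp [actPairing_apply, d.chi_simple, d.q_symm i j]
  F_K i j := by simp [actPairing_apply]
  K_E i j := by simp [actPairing_apply, RR_K]

namespace IsSkewHopfPairing

variable {P : BMinus (maxIdeal d) →ₗ[k] BPlus (maxIdeal d) →ₗ[k] k} (hP : IsSkewHopfPairing d P)

include hP

theorem apply_K_mul (a : Fin n → ℤ) (x x') :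
    P (Borel.K _ _ a) (x * x') = P (Borel.K _ _ a) x' * P (Borel.K _ _ a) x := by
  rw [hP.apply_mul]; simp

theorem mul_apply_K (y y') (a : Fin n → ℤ) :
    P (y * y') (Borel.K _ _ a) = P y (Borel.K _ _ a) * P y' (Borel.K _ _ a) := by
  rw [hP.mul_apply]; simp

theorem apply_X_mul (i : Fin n) (x x') : P (Borel.X _ _ i) (x * x') =
    Borel.counit _ _ x' * P (Borel.X _ _ i) x +
      P (Borel.X _ _ i) x' * P (Borel.K _ _ (-simpleRoot i)) x := by
  rw [hP.apply_mul]; simp [hP.one_apply]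

theorem mul_apply_X (y y') (i : Fin n) : P (y * y') (Borel.X _ _ i) =
    P y (Borel.X _ _ i) * Borel.counit _ _ y' +
      P y (Borel.K _ _ (simpleRoot i)) * P y' (Borel.X _ _ i) := by
  rw [hP.mul_apply]; simp [hP.apply_one]

/-- Group-like elements pair bimultiplicatively, and values at negatives are forced by `⟨1, x⟩ =
ε(x)` and `⟨y, 1⟩ = ε(y)`. -/
theorem apply_K_K (a b : Fin n → ℤ) : P (Borel.K _ _ a) (Borel.K _ _ b) = (d.chi a b)⁻¹ := by
  have hl : ∀ b, (∀ i, P (Borel.K _ _ (simpleRoot i)) (Borel.K _ _ b) =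
      (d.chi (simpleRoot i) b)⁻¹) → ∀ a, P (Borel.K _ _ a) (Borel.K _ _ b) = (d.chi a b)⁻¹ := by
    intro b hb a
    induction a using lattice_induction with
    | zero => rw [K_zero, hP.one_apply, d.chi_zero_left]; simp
    | simple i => exact hb i
    | add a a' ha ha' => rw [K_add, hP.mul_apply_K, ha, ha', d.chi_add_left, mul_inv]
    | neg a ha =>
      have := hP.mul_apply_K (Borel.K _ _ (-a)) (Borel.K _ _ a) b
      rw [← K_add, neg_add_cancel, K_zero, hP.one_apply, counit_K, ha] at this
      rw [d.chi_neg_left]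
      exact eq_inv_of_mul_eq_one_left this.symm
  refine hl b (fun i => ?_) a
  induction b using lattice_induction with
  | zero => rw [K_zero, hP.apply_one, d.chi_zero_right]; simp
  | simple j => rw [hP.K_K]; rfl
  | add a a' ha ha' => rw [K_add, hP.apply_K_mul, ha, ha', d.chi_add_right, mul_inv, mul_comm]
  | neg a ha =>
    have := hP.apply_K_mul (simpleRoot i) (Borel.K _ _ a) (Borel.K _ _ (-a))
    rw [← K_add, add_neg_cancel, K_zero, hP.apply_one, counit_K, ha] at this
    rw [d.chi_neg_right]
    exact eq_inv_of_mul_eq_one_left this.symm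

theorem apply_X_K (i : Fin n) (b : Fin n → ℤ) : P (Borel.X _ _ i) (Borel.K _ _ b) = 0 := by
  induction b using lattice_induction with
  | zero => rw [K_zero, hP.apply_one, counit_X]
  | simple j => exact hP.F_K i j
  | add a a' ha ha' => rw [K_add, hP.apply_X_mul, ha, ha', zero_mul, mul_zero, add_zero]
  | neg a ha =>
    have := hP.apply_X_mul i (Borel.K _ _ a) (Borel.K _ _ (-a))
    rw [← K_add, add_neg_cancel, K_zero, hP.apply_one, counit_X, ha, mul_zero, zero_add,
      hP.apply_K_K] at this
    exact (mul_eq_zero.mp this.symm).resolve_right (inv_ne_zero (d.chi_ne_zero _ _))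

theorem apply_K_X (a : Fin n → ℤ) (j : Fin n) : P (Borel.K _ _ a) (Borel.X _ _ j) = 0 := by
  induction a using lattice_induction with
  | zero => rw [K_zero, hP.one_apply, counit_X]
  | simple i => exact hP.K_E i j
  | add a a' ha ha' => rw [K_add, hP.mul_apply_X, ha, ha', zero_mul, mul_zero, add_zero]
  | neg a ha =>
    have := hP.mul_apply_X (Borel.K _ _ a) (Borel.K _ _ (-a)) j
    rw [← K_add, add_neg_cancel, K_zero, hP.one_apply, counit_X, ha, zero_mul, zero_add,
      hP.apply_K_K] at this
    exact (mul_eq_zero.mp this.symm).resolve_left (inv_ne_zero (d.chi_ne_zero _ _))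

/-- One product rule reduces `y` to a generator, the other one then reduces `x` to a generator. -/
theorem eq {P'} (hP' : IsSkewHopfPairing d P') : P = P' := by
  have hK : ∀ a, P (Borel.K _ _ a) = P' (Borel.K _ _ a) := by
    intro a
    refine LinearMap.ext fun x => ?_
    induction x using Borel.induction with
    | zero => simp
    | one => rw [hP.apply_one, hP'.apply_one]
    | X_mul i u hu =>
      rw [hP.apply_K_mul, hP'.apply_K_mul, hP.apply_K_X, hP'.apply_K_X, mul_zero, mul_zero]
    | K_mul b u hu => rw [hP.apply_K_mul, hP'.apply_K_mul, hu, hP.apply_K_K, hP'.apply_K_K]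
    | add u v hu hv => simp only [map_add, hu, hv]
    | smul c u hu => simp only [map_smul, hu]
  have hX : ∀ i, P (Borel.X _ _ i) = P' (Borel.X _ _ i) := by
    intro i
    refine LinearMap.ext fun x => ?_
    induction x using Borel.induction with
    | zero => simp
    | one => rw [hP.apply_one, hP'.apply_one]
    | X_mul j u hu => rw [hP.apply_X_mul, hP'.apply_X_mul, hu, hP.F_E, hP'.F_E, hK]
    | K_mul b u hu =>
      rw [hP.apply_X_mul, hP'.apply_X_mul, hu, hP.apply_X_K, hP'.apply_X_K, hK]
    | add u v hu hv => simp only [map_add, hu, hv]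
    | smul c u hu => simp only [map_smul, hu]
  refine LinearMap.ext fun y => ?_
  induction y using Borel.induction with
  | zero => simp
  | one => ext x; rw [hP.one_apply, hP'.one_apply]
  | X_mul i u hu => ext x; rw [hP.mul_apply, hP'.mul_apply, hu, hX]
  | K_mul b u hu => ext x; rw [hP.mul_apply, hP'.mul_apply, hu, hK]
  | add u v hu hv => simp only [map_add, hu, hv]
  | smul c u hu => simp only [map_smul, hu]

end IsSkewHopfPairing

variable (d)

theorem isSkewHopfPairing_pairing : IsSkewHopfPairing d (pairing d) :=
  Classical.epsilon_spec (p := IsSkewHopfPairing d) ⟨_, isSkewHopfPairing_actPairing⟩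

theorem pairing_eq : pairing d = actPairing d :=
  (isSkewHopfPairing_pairing d).eq isSkewHopfPairing_actPairing

variable {d}

theorem actL_eq (J : PreNicholsIdeal d) (e : BPlus (maxIdeal d)) (f : BMinus J) :
    actL J e f = lact J e f := by
  rw [actL, pairing_eq, lact_eq_actPairing]

theorem actR_eq (J : PreNicholsIdeal d) (e : BPlus (maxIdeal d)) (f : BMinus J) :
    actR J f e = ract J e f := by
  rw [actR, pairing_eq, ract_eq_actPairing]

end Pairing

/-! ### The antipode of U⁺_max ⋊ H and its inverse -/

section Antipode

open Borel

variable {k : Type*} [Field k] {n : ℕ} (d : Datum k n)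

local notation "pX" => Borel.X (plusScalar d) (maxIdeal d)
local notation "pK" => Borel.K (plusScalar d) (maxIdeal d)

theorem plus_X_mul_K_neg (a : Fin n → ℤ) (i : Fin n) :
    pX i * pK (-a) = d.chi a (simpleRoot i) • (pK (-a) * pX i) := by
  rw [K_mul_X, d.plusScalar_eq, d.chi_neg_left, smul_smul, mul_inv_cancel₀ (d.chi_ne_zero _ _),
    one_smul]

theorem lift_smul_K_mul_X {p : Tens k n} (hp : p ∈ (maxIdeal d).carrier) (r : Fin n → k) :
    FreeAlgebra.lift k (fun i => r i • (pK (-simpleRoot i) * pX i)) p = 0 := by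
  have := lift_mul_eq_zero (maxIdeal d).biideal (fun i => r i • pK (-simpleRoot i)) pX
    (fun i j => d.q i j) d.q_symm
    (by
      intro i j
      rw [mul_smul_comm, plus_X_mul_K_neg, smul_mul_assoc, smul_comm, d.chi_comm, d.chi_simple])
    (by intro i j; rw [smul_mul_smul_comm, K_comm, smul_mul_smul_comm, mul_comm])
    (fun p hp => lift_X _ _ hp) hp
  simpa using this

/-- The antihomomorphism of `U⁺_max ⋊ H` with `K_a ↦ K_{-a}` and `E_i ↦ r_i K_i⁻¹ E_i`. -/
def antiHom (r : Fin n → k) : BPlus (maxIdeal d) →ₐ[k] (BPlus (maxIdeal d))ᵐᵒᵖ :=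
  Borel.lift _ _ (fun i => MulOpposite.op (r i • (pK (-simpleRoot i) * pX i)))
    (fun a => MulOpposite.op (pK (-a)))
    (by rw [neg_zero, K_zero, MulOpposite.op_one])
    (by intro a b; rw [← MulOpposite.op_mul, ← K_add]; congr 2; abel)
    (by
      intro a i
      rw [← MulOpposite.op_mul, ← MulOpposite.op_mul, ← MulOpposite.op_smul]
      congr 1
      rw [smul_mul_assoc, mul_assoc, plus_X_mul_K_neg, mul_smul_comm, mul_smul_comm, smul_comm,
        ← mul_assoc, ← mul_assoc, K_comm, d.plusScalar_eq])
    (fun p hp => by rw [lift_op, lift_smul_K_mul_X d (rev_mem_max d hp), MulOpposite.op_zero])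

/-- `antiHom` as a linear map. -/
def antiMap (r : Fin n → k) : BPlus (maxIdeal d) →ₗ[k] BPlus (maxIdeal d) :=
  (MulOpposite.opLinearEquiv k).symm.toLinearMap ∘ₗ (antiHom d r).toLinearMap

@[simp] theorem antiMap_one (r : Fin n → k) : antiMap d r 1 = 1 := by simp [antiMap]

theorem antiMap_mul (r : Fin n → k) (x y) :
    antiMap d r (x * y) = antiMap d r y * antiMap d r x := by simp [antiMap]

@[simp] theorem antiMap_K (r : Fin n → k) (a : Fin n → ℤ) : antiMap d r (pK a) = pK (-a) := by
  simp [antiMap, antiHom]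

@[simp] theorem antiMap_X (r : Fin n → k) (i : Fin n) :
    antiMap d r (pX i) = r i • (pK (-simpleRoot i) * pX i) := by
  simp [antiMap, antiHom]

/-- Applying two such maps multiplies `E_i` by `r_i r'_i q_{ii}⁻¹`. The antipode has `r_i = -1`, so
its inverse has `r_i = -q_{ii}`. -/
theorem antiMap_antiMap (r r' : Fin n → k) (h : ∀ i, r i * r' i = d.q i i) (x) :
    antiMap d r (antiMap d r' x) = x := by
  induction x using Borel.induction with
  | zero => simp
  | one => simp
  | X_mul i u hu =>
    have h1 : antiMap d r (antiMap d r' (pX i)) = pX i := by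
      have h2 := plus_X_mul_K_neg d (-simpleRoot i) i
      rw [neg_neg, d.chi_neg_left, d.chi_simple] at h2
      rw [antiMap_X, map_smul, antiMap_mul, antiMap_K, neg_neg, antiMap_X, smul_mul_assoc,
        smul_smul, mul_assoc, h2, mul_smul_comm, ← mul_assoc, K_neg_mul_K, one_mul, smul_smul,
        mul_comm (r' i), h, mul_inv_cancel₀ (d.q_ne_zero _ _), one_smul]
    rw [antiMap_mul, antiMap_mul, hu, h1]
  | K_mul a u hu => rw [antiMap_mul, antiMap_mul, hu, antiMap_K, antiMap_K, neg_neg]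
  | add u v hu hv => simp only [map_add, hu, hv]
  | smul c u hu => simp only [map_smul, hu]

theorem isAntipode_antiMap : IsAntipode (maxIdeal d) (antiMap d fun _ => -1) := by
  intro x
  constructor
  · induction x using Borel.induction with
    | zero => simp
    | one => simp [Algebra.TensorProduct.one_def]
    | X_mul i u hu =>
      -- The two terms of the coproduct of `E_i` cancel inside the product, whatever `u`
      -- contributes.
      clear hu
      rw [map_mul (comulPlus _), map_mul (Borel.counit _ _), counit_X, zero_mul, map_zero,
        comulPlus_X]
      generalize comulPlus _ u = z
      induction z with
      | zero => simp
      | add a b ha hb => rw [mul_add, map_add, map_add, ha, hb, add_zero]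
      | tmul a b =>
        simp only [add_mul, Algebra.TensorProduct.tmul_mul_tmul, map_add, TensorProduct.map_tmul,
          LinearMap.mul'_apply, LinearMap.id_apply, antiMap_mul, antiMap_X, antiMap_K, one_mul]
        simp [mul_assoc]
    | K_mul a u hu =>
      rw [map_mul (comulPlus _), map_mul (Borel.counit _ _), counit_K, one_mul, ← hu, comulPlus_K]
      generalize comulPlus _ u = z
      induction z with
      | zero => simp
      | add a b ha hb => rw [mul_add, map_add, map_add, ha, hb, map_add, map_add]
      | tmul b c =>
        simp only [Algebra.TensorProduct.tmul_mul_tmul, TensorProduct.map_tmul,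
          LinearMap.mul'_apply, LinearMap.id_apply, antiMap_mul, antiMap_K]
        rw [mul_assoc, ← mul_assoc (pK (-a)), K_neg_mul_K, one_mul]
    | add u v hu hv => simp only [map_add, hu, hv]
    | smul c u hu => simp only [map_smul, hu, Algebra.algebraMap_eq_smul_one, smul_assoc]
  · induction x using Borel.induction with
    | zero => simp
    | one => simp [Algebra.TensorProduct.one_def]
    | X_mul i u hu =>
      -- Here the terms from `E_i` surround the convolution for `u`; it is a scalar by the induction
      -- hypothesis, so they cancel again.
      have h1 : ∀ z, LinearMap.mul' k _ (TensorProduct.map LinearMap.id (antiMap d fun _ => -1)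
          ((pX i ⊗ₜ 1 + pK (simpleRoot i) ⊗ₜ pX i) * z)) =
          pX i * LinearMap.mul' k _ (TensorProduct.map LinearMap.id (antiMap d fun _ => -1) z) +
          pK (simpleRoot i) * LinearMap.mul' k _
            (TensorProduct.map LinearMap.id (antiMap d fun _ => -1) z) *
            antiMap d (fun _ => -1) (pX i) := by
        intro z
        induction z with
        | zero => simp
        | add a b ha hb =>
          rw [mul_add, map_add, map_add, ha, hb, map_add, map_add]
          simp only [mul_add, add_mul]
          abel
        | tmul a b =>
          simp only [add_mul, Algebra.TensorProduct.tmul_mul_tmul, map_add, TensorProduct.map_tmul,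
            LinearMap.mul'_apply, LinearMap.id_apply, antiMap_mul, one_mul, mul_assoc]
      rw [map_mul (comulPlus _), map_mul (Borel.counit _ _), counit_X, zero_mul, map_zero,
        comulPlus_X, h1, hu, antiMap_X,
        ← Algebra.commutes, ← Algebra.commutes, mul_assoc, mul_smul_comm, ← mul_assoc (pK _) (pK _),
        K_mul_K_neg]
      simp
    | K_mul a u hu =>
      have h1 : ∀ z, LinearMap.mul' k _ (TensorProduct.map LinearMap.id (antiMap d fun _ => -1)
          ((pK a ⊗ₜ pK a) * z)) =
          pK a * LinearMap.mul' k _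
            (TensorProduct.map LinearMap.id (antiMap d fun _ => -1) z) * pK (-a) := by
        intro z
        induction z with
        | zero => simp
        | add a b ha hb => simp only [mul_add, map_add, ha, hb, add_mul]
        | tmul a b =>
          simp only [Algebra.TensorProduct.tmul_mul_tmul, TensorProduct.map_tmul,
            LinearMap.mul'_apply, LinearMap.id_apply, antiMap_mul, antiMap_K, mul_assoc]
      rw [map_mul (comulPlus _), map_mul (Borel.counit _ _), counit_K, one_mul, comulPlus_K, h1, hu, ← Algebra.commutes, mul_assoc,
        K_mul_K_neg, mul_one]
    | add u v hu hv => simp only [map_add, hu, hv]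
    | smul c u hu => simp only [map_smul, hu, Algebra.algebraMap_eq_smul_one, smul_assoc]

variable {d}

theorem counit_comulPlus_left (J : PreNicholsIdeal d) (y : BPlus J) :
    TensorProduct.lid k _ (TensorProduct.map
      (Borel.counit (plusScalar d) J).toLinearMap LinearMap.id (comulPlus J y)) = y := by
  have : ((Algebra.TensorProduct.lid k (BPlus J)).toAlgHom.comp (Algebra.TensorProduct.map
      (Borel.counit (plusScalar d) J) (AlgHom.id k _))).comp (comulPlus J) = AlgHom.id k _ :=
    hom_ext (by simp) (by simp)
  exact congrArg (fun f => f y) this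

theorem counit_comulPlus_right (J : PreNicholsIdeal d) (y : BPlus J) :
    TensorProduct.rid k _ (TensorProduct.map
      LinearMap.id (Borel.counit (plusScalar d) J).toLinearMap (comulPlus J y)) = y := by
  have : ((Algebra.TensorProduct.rid k k (BPlus J)).toAlgHom.comp (Algebra.TensorProduct.map
      (AlgHom.id k _) (Borel.counit (plusScalar d) J))).comp (comulPlus J) = AlgHom.id k _ :=
    hom_ext (by simp) (by simp)
  exact congrArg (fun f => f y) this

theorem comulPlus_coassoc (J : PreNicholsIdeal d) (y : BPlus J) :
    TensorProduct.assoc k _ _ _ (TensorProduct.map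
      (comulPlus J).toLinearMap LinearMap.id (comulPlus J y)) =
    TensorProduct.map LinearMap.id (comulPlus J).toLinearMap (comulPlus J y) := by
  have : ((Algebra.TensorProduct.assoc k k k (BPlus J) (BPlus J) (BPlus J)).toAlgHom.comp
      (Algebra.TensorProduct.map (comulPlus J) (AlgHom.id k _))).comp (comulPlus J) =
      (Algebra.TensorProduct.map (AlgHom.id k _) (comulPlus J)).comp (comulPlus J) :=
    hom_ext (by simp [TensorProduct.add_tmul, TensorProduct.tmul_add, add_assoc,
      Algebra.TensorProduct.one_def]) (by simp)
  exact congrArg (fun f => f y) this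

/-- Inverses in the convolution algebra are unique: bracket `S * id * S'` in two ways. -/
theorem IsAntipode.eq {J : PreNicholsIdeal d} {S S' : BPlus J →ₗ[k] BPlus J} (hS : IsAntipode J S)
    (hS' : IsAntipode J S') : S = S' := by
  refine LinearMap.ext fun x => ?_
  let μ := LinearMap.mul' k (BPlus J)
  have h1 : ∀ z : (BPlus J ⊗[k] BPlus J) ⊗[k] BPlus J,
      μ (TensorProduct.map (μ ∘ₗ TensorProduct.map S LinearMap.id) S' z) =
      μ (TensorProduct.map S (μ ∘ₗ TensorProduct.map LinearMap.id S')
        (TensorProduct.assoc k _ _ _ z)) := by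
    intro z
    induction z with
    | zero => simp
    | add a b ha hb => simp only [map_add, ha, hb]
    | tmul a b =>
      induction a with
      | zero => simp
      | add a a' ha hb => simp only [TensorProduct.add_tmul, map_add, ha, hb]
      | tmul a a' => simp [μ, mul_assoc]
  have h2 := h1 (TensorProduct.map (comulPlus J).toLinearMap LinearMap.id (comulPlus J x))
  rw [comulPlus_coassoc, ← LinearMap.comp_apply (TensorProduct.map _ _) (TensorProduct.map _ _),
    ← LinearMap.comp_apply (TensorProduct.map _ _) (TensorProduct.map _ _),
    ← TensorProduct.map_comp, ← TensorProduct.map_comp] at h2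
  have e1 : (μ ∘ₗ TensorProduct.map S LinearMap.id) ∘ₗ (comulPlus J).toLinearMap =
      Algebra.linearMap k _ ∘ₗ (Borel.counit (plusScalar d) J).toLinearMap :=
    LinearMap.ext fun x => (hS x).1
  have e2 : (μ ∘ₗ TensorProduct.map LinearMap.id S') ∘ₗ (comulPlus J).toLinearMap =
      Algebra.linearMap k _ ∘ₗ (Borel.counit (plusScalar d) J).toLinearMap :=
    LinearMap.ext fun x => (hS' x).2
  rw [e1, e2, LinearMap.comp_id, LinearMap.comp_id] at h2
  have h3 : ∀ z : BPlus J ⊗[k] BPlus J, μ (TensorProduct.map (Algebra.linearMap k _ ∘ₗ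
      (Borel.counit (plusScalar d) J).toLinearMap) S' z) = S' (TensorProduct.lid k _
      (TensorProduct.map (Borel.counit (plusScalar d) J).toLinearMap LinearMap.id z)) := by
    intro z
    induction z with
    | zero => simp
    | add a b ha hb => simp only [map_add, ha, hb]
    | tmul a b => simp [μ, Algebra.algebraMap_eq_smul_one]
  have h4 : ∀ z : BPlus J ⊗[k] BPlus J, μ (TensorProduct.map S (Algebra.linearMap k _ ∘ₗ
      (Borel.counit (plusScalar d) J).toLinearMap) z) = S (TensorProduct.rid k _
      (TensorProduct.map LinearMap.id (Borel.counit (plusScalar d) J).toLinearMap z)) := by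
    intro z
    induction z with
    | zero => simp
    | add a b ha hb => simp only [map_add, ha, hb]
    | tmul a b => simp [μ, Algebra.algebraMap_eq_smul_one]
  rw [h3, h4, counit_comulPlus_left, counit_comulPlus_right] at h2
  exact h2.symm

variable (d)

theorem isAntipodeInv_antiMap : IsAntipodeInv d (antiMap d fun i => -d.q i i) :=
  ⟨_, isAntipode_antiMap d,
    LinearMap.ext fun x => antiMap_antiMap d _ _ (fun i => by ring) x,
    LinearMap.ext fun x => antiMap_antiMap d _ _ (fun i => by ring) x⟩

variable {d}

theorem IsAntipodeInv.eq {T T'} (hT : IsAntipodeInv d T) (hT' : IsAntipodeInv d T') : T = T' := by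
  obtain ⟨S, hS, h1, h2⟩ := hT
  obtain ⟨S', hS', h1', h2'⟩ := hT'
  rw [hS'.eq hS] at h2'
  rw [← LinearMap.id_comp T, ← h2', LinearMap.comp_assoc, h1, LinearMap.comp_id]

variable (d)

theorem isAntipodeInv_antipodeInv : IsAntipodeInv d (antipodeInv d) :=
  Classical.epsilon_spec (p := IsAntipodeInv d) ⟨_, isAntipodeInv_antiMap d⟩

theorem antipodeInv_eq : antipodeInv d = antiMap d fun i => -d.q i i :=
  (isAntipodeInv_antipodeInv d).eq (isAntipodeInv_antiMap d)

end Antipode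

/-! ### Coefficients of the group-like elements -/

section Coefficients

open Borel

variable {k : Type*} [Field k] {n : ℕ} {d : Datum k n} (J : PreNicholsIdeal d)

local notation "mX" => Borel.X (minusScalar d) J
local notation "mK" => Borel.K (minusScalar d) J
local notation "mE" => Borel.emb (minusScalar d) J
local notation "mP" => Borel.ofPre (minusScalar d) J

theorem Pre.mk_surjective : Function.Surjective (Pre.mk J) := Presented.mk_surjective _

theorem Pre.mk_of_mem {p : Tens k n} (hp : p ∈ J.carrier) : Pre.mk J p = 0 := by
  rw [Pre.mk, Presented.mk_rel (PreRel.of p hp), map_zero]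

@[simp] theorem Pre.mk_ι (i : Fin n) : Pre.mk J (FreeAlgebra.ι k i) = Pre.x J i := rfl

theorem Pre.lift_x (p : Tens k n) : FreeAlgebra.lift k (Pre.x J) p = Pre.mk J p := by
  have : FreeAlgebra.lift k (Pre.x J) = Pre.mk J := by ext i; simp
  rw [this]

@[simp] theorem Pre.lift_apply_x {A : Type*} [Ring A] [Algebra k A] (x : Fin n → A)
    (h : ∀ p ∈ J.carrier, FreeAlgebra.lift k x p = 0) (i : Fin n) :
    Pre.lift J x h (Pre.x J i) = x i := by
  simp [Pre.lift, Pre.x, Pre.mk, Presented.lift_mk]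

theorem Pre.induction {p : Pre J → Prop} (zero : p 0) (one : p 1)
    (x_mul : ∀ i u, p u → p (Pre.x J i * u))
    (add : ∀ u v, p u → p v → p (u + v)) (smul : ∀ (c : k) u, p u → p (c • u))
    (u : Pre J) : p u :=
  Presented.induction zero one x_mul add smul u

/-- The automorphism of `U⁻` by which `K_a` acts. -/
def preTheta (a : Fin n → ℤ) : Pre J →ₐ[k] Pre J :=
  Pre.lift J (fun i => minusScalar d a i • Pre.x J i) (by
    intro p hp
    have := lift_mul_eq_zero J.biideal
      (fun i => algebraMap k (Pre J) (minusScalar d a i)) (Pre.x J) (fun _ _ => 1)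
      (fun _ _ => rfl) (fun i j => by rw [one_smul, Algebra.commutes])
      (fun i j => by rw [Algebra.commutes])
      (fun p hp => by rw [Pre.lift_x, Pre.mk_of_mem J hp]) hp
    simpa [← Algebra.smul_def] using this)

@[simp] theorem preTheta_x (a : Fin n → ℤ) (i : Fin n) :
    preTheta J a (Pre.x J i) = minusScalar d a i • Pre.x J i := by simp [preTheta]

theorem preTheta_zero (f : Pre J) : preTheta J 0 f = f := by
  induction f using Pre.induction with
  | zero => simp
  | one => simp
  | x_mul i u hu => simp [hu, d.minusScalar_eq, d.chi_zero_left]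
  | add u v hu hv => simp [hu, hv]
  | smul c u hu => simp [hu]

theorem preTheta_add (a b : Fin n → ℤ) (f : Pre J) :
    preTheta J (a + b) f = preTheta J a (preTheta J b f) := by
  induction f using Pre.induction with
  | zero => simp
  | one => simp
  | x_mul i u hu => simp [hu, d.minusScalar_eq, d.chi_add_left, smul_smul]
  | add u v hu hv => simp [hu, hv]
  | smul c u hu => simp [hu]

/-- The representation of `H ⋉ U⁻` on functions `ℤⁿ → U⁻`. -/
def coeffRep : BMinus J →ₐ[k] Module.End k ((Fin n → ℤ) → Pre J) :=
  Borel.lift _ J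
    (fun i => LinearMap.pi fun a => LinearMap.mulLeft k (Pre.x J i) ∘ₗ LinearMap.proj a)
    -- A function `f` stands for the formal sum of the `f_a K_a`; moving `K_b` to the right twists
    -- `f_a` and shifts the index.
    (fun b => LinearMap.pi fun a => (preTheta J b).toLinearMap ∘ₗ LinearMap.proj (a - b))
    (by
      refine LinearMap.ext fun f => funext fun a => ?_
      simp [preTheta_zero])
    (by
      intro b c
      refine LinearMap.ext fun f => funext fun a => ?_
      simp [preTheta_add, sub_sub])
    (by
      intro b i
      refine LinearMap.ext fun f => funext fun a => ?_
      simp)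
    (by
      intro p hp
      have h : ∀ (p : Tens k n) (f : (Fin n → ℤ) → Pre J) (a : Fin n → ℤ),
          FreeAlgebra.lift k (fun i => (LinearMap.pi fun a => LinearMap.mulLeft k (Pre.x J i) ∘ₗ
            LinearMap.proj a : Module.End k ((Fin n → ℤ) → Pre J))) p f a = Pre.mk J p * f a := by
        intro p
        induction p using tens_induction with
        | zero => simp
        | one => simp
        | mul i u hu => simp [hu, mul_assoc]
        | add u v hu hv => simp [hu, hv, add_mul]
        | smul c u hu => simp [hu]
      refine LinearMap.ext fun f => funext fun a => ?_
      rw [h, Pre.mk_of_mem J hp, zero_mul]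
      rfl)

/-- The coefficient of `K_a` of an element `∑ f_a K_a` of `H ⋉ U⁻`. -/
def coeff (a : Fin n → ℤ) : BMinus J →ₗ[k] Pre J :=
  LinearMap.proj a ∘ₗ LinearMap.applyₗ (Pi.single 0 1 : (Fin n → ℤ) → Pre J) ∘ₗ
    (coeffRep J).toLinearMap

theorem coeffRep_X (i : Fin n) (f : (Fin n → ℤ) → Pre J) (a : Fin n → ℤ) :
    coeffRep J (mX i) f a = Pre.x J i * f a := by
  simp [coeffRep]

/-- This shows that H ⋉ U⁻ is the direct sum of the subspaces `U⁻ K_a`, and in particular that U⁻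
embeds into it. -/
theorem coeff_emb_mul_K (a b : Fin n → ℤ) (u : Tens k n) :
    coeff J a (mE u * mK b) = if a = b then Pre.mk J u else 0 := by
  have h : ∀ (u : Tens k n) (f : (Fin n → ℤ) → Pre J),
      coeffRep J (mE u) f a = Pre.mk J u * f a := by
    intro u
    induction u using tens_induction with
    | zero => simp
    | one => simp
    | mul i u hu =>
      intro f
      rw [map_mul, map_mul, emb_ι, Module.End.mul_apply, coeffRep_X, hu, map_mul, Pre.mk_ι,
        mul_assoc]
    | add u v hu hv => simp [hu, hv, add_mul]
    | smul c u hu => simp [hu]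
  simp only [coeff, LinearMap.comp_apply, AlgHom.toLinearMap_apply, LinearMap.applyₗ_apply_apply,
    LinearMap.proj_apply, map_mul, Module.End.mul_apply, h]
  simp only [coeffRep, lift_apply_K, LinearMap.pi_apply, LinearMap.comp_apply,
    LinearMap.proj_apply, AlgHom.toLinearMap_apply]
  by_cases hab : a = b
  · subst hab; simp
  · have : a - b ≠ 0 := sub_ne_zero.mpr hab
    simp [hab, this]

theorem coeff_ofPre_mul_K (a b : Fin n → ℤ) (f : Pre J) :
    coeff J a (mP f * mK b) = if a = b then f else 0 := by
  obtain ⟨u, rfl⟩ := Pre.mk_surjective J f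
  rw [ofPre_mk, coeff_emb_mul_K]

theorem coeff_ofPre (f : Pre J) : coeff J 0 (mP f) = f := by
  have := coeff_ofPre_mul_K J 0 0 f
  rwa [K_zero, mul_one, if_pos rfl] at this

theorem exists_finsupp (y : BMinus J) :
    ∃ f : (Fin n → ℤ) →₀ Pre J, y = f.sum fun a u => mP u * mK a := by
  induction y using Borel.induction_emb_K with
  | zero => exact ⟨0, by simp⟩
  | gen l a => exact ⟨Finsupp.single a (Pre.mk J (word k l)), by simp [ofPre_mk]⟩
  | add u v hu hv =>
    obtain ⟨f, rfl⟩ := hu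
    obtain ⟨g, rfl⟩ := hv
    refine ⟨f + g, ?_⟩
    rw [Finsupp.sum_add_index' (by simp) (by simp [add_mul])]
  | smul c u hu =>
    obtain ⟨f, rfl⟩ := hu
    refine ⟨c • f, ?_⟩
    rw [Finsupp.sum_smul_index' (by simp), Finsupp.smul_sum]
    simp

theorem eq_zero_of_coeff {y : BMinus J} (h : ∀ a, coeff J a y = 0) : y = 0 := by
  obtain ⟨f, rfl⟩ := exists_finsupp J y
  refine Finset.sum_eq_zero fun a ha => ?_
  have h1 := h a
  rw [Finsupp.sum, map_sum, Finset.sum_eq_single a, coeff_ofPre_mul_K, if_pos rfl] at h1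
  · simp [h1]
  · intro b _ hb
    rw [coeff_ofPre_mul_K, if_neg hb.symm]
  · intro h2
    exact (h2 ha).elim

/-- The skew derivation `∂_i^L` of `U⁻`. -/
def preDL (i : Fin n) : Pre J →ₗ[k] Pre J := coeff J 0 ∘ₗ CC J i ∘ₗ (mP).toLinearMap

/-- The skew derivation `∂_i^R` of `U⁻`. -/
def preDR (i : Fin n) : Pre J →ₗ[k] Pre J :=
  coeff J (-simpleRoot i) ∘ₗ RR J i ∘ₗ (mP).toLinearMap

theorem preDL_mk (i : Fin n) (u : Tens k n) : preDL J i (Pre.mk J u) = Pre.mk J (dL d i u) := by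
  simp only [preDL, LinearMap.comp_apply, AlgHom.toLinearMap_apply, ofPre_mk, CC_emb]
  rw [← ofPre_mk, coeff_ofPre]

theorem preDR_mk (i : Fin n) (u : Tens k n) : preDR J i (Pre.mk J u) = Pre.mk J (dR d i u) := by
  simp only [preDR, LinearMap.comp_apply, AlgHom.toLinearMap_apply, ofPre_mk, RR_emb]
  rw [coeff_emb_mul_K, if_pos rfl]

theorem CC_ofPre (i : Fin n) (f : Pre J) : CC J i (mP f) = mP (preDL J i f) := by
  obtain ⟨u, rfl⟩ := Pre.mk_surjective J f
  rw [ofPre_mk, CC_emb, preDL_mk, ofPre_mk]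

theorem RR_ofPre (i : Fin n) (f : Pre J) :
    RR J i (mP f) = mP (preDR J i f) * mK (-simpleRoot i) := by
  obtain ⟨u, rfl⟩ := Pre.mk_surjective J f
  rw [ofPre_mk, RR_emb, preDR_mk, ofPre_mk]

theorem preDL_one (i : Fin n) : preDL J i 1 = 0 := by
  have := preDL_mk J i 1
  rwa [map_one, dL_one, map_zero] at this

theorem preDL_x_mul (i j : Fin n) (f : Pre J) : preDL J i (Pre.x J j * f) =
    d.q i j • (Pre.x J j * preDL J i f) + if i = j then f else 0 := by
  obtain ⟨u, rfl⟩ := Pre.mk_surjective J f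
  rw [← Pre.mk_ι, ← map_mul, preDL_mk, dL_ι_mul, preDL_mk]
  split_ifs <;> simp

theorem preDL_mem_deg {i : Fin n} {l : List (Fin n)} {f : Pre J}
    (hf : f ∈ Pre.deg J (wt (i :: l))) : preDL J i f ∈ Pre.deg J (wt l) := by
  obtain ⟨u, hu, rfl⟩ := hf
  have key : homog k (wt (i :: l)) ≤ (homog k (wt l)).comap (dL d i) := by
    rw [homog, Submodule.span_le]
    rintro _ ⟨l', hl', rfl⟩
    refine Submodule.span_mono ?_ (dL_word_mem d i l')
    rintro _ ⟨l'', hl'', rfl⟩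
    refine ⟨l'', ?_, rfl⟩
    exact wt_eq_iff.mpr ((hl''.trans (wt_eq_iff.mp hl')).cons_inv)
  exact ⟨_, key hu, (preDL_mk J i u).symm⟩

theorem preDL_eq_zero {i : Fin n} {μ : Fin n → ℕ} (hμ : μ i = 0) {f : Pre J}
    (hf : f ∈ Pre.deg J μ) : preDL J i f = 0 := by
  obtain ⟨u, hu, rfl⟩ := hf
  have key : homog k μ ≤ LinearMap.ker (dL d i) := by
    rw [homog, Submodule.span_le]
    rintro _ ⟨l, hl, rfl⟩
    have h : {l' : List (Fin n) | (i :: l').Perm l} = ∅ := by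
      ext l'
      simp only [Set.mem_ofPred_eq, Set.mem_empty_iff_false, iff_false]
      intro h
      have h1 : wt l i = wt (i :: l') i := congrFun (wt_eq_iff.mpr h.symm) i
      rw [show wt l = μ from hl, hμ] at h1
      simp [wt] at h1
    have h2 := dL_word_mem d i l
    rw [h] at h2
    simpa using h2
  change preDL J i (Pre.mk J u) = 0
  rw [preDL_mk, show dL d i u = 0 from key hu, map_zero]

theorem x_mul_mem_deg {i : Fin n} {l : List (Fin n)} {f : Pre J}
    (hf : f ∈ Pre.deg J (wt l)) : Pre.x J i * f ∈ Pre.deg J (wt (i :: l)) := by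
  obtain ⟨u, hu, rfl⟩ := hf
  refine ⟨FreeAlgebra.ι k i * u, mem_span_words_mul i ?_ hu, by simp⟩
  intro l' hl'
  exact wt_eq_iff.mpr ((wt_eq_iff.mp hl').cons i)

theorem exists_word_wt (μ : Fin n → ℕ) : ∃ l : List (Fin n), wt l = μ := by
  refine ⟨(Finset.univ.toList.map fun i => List.replicate (μ i) i).flatten, ?_⟩
  funext i
  simp [wt, List.count_flatten, Function.comp_def, List.count_replicate]

theorem mem_deg_word (l : List (Fin n)) : Pre.mk J (word k l) ∈ Pre.deg J (wt l) :=
  ⟨_, Submodule.subset_span ⟨l, rfl, rfl⟩, rfl⟩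

/-- All words of a given weight are permutations of one of them. -/
instance (μ : Fin n → ℕ) : FiniteDimensional k (Pre.deg J μ) := by
  obtain ⟨l, rfl⟩ := exists_word_wt μ
  have hfin : ({l' : List (Fin n) | wt l' = wt l}).Finite := by
    refine (List.finite_toSet l.permutations).subset fun l' hl' => ?_
    exact List.mem_permutations.mpr (wt_eq_iff.mp hl')
  have : FiniteDimensional k (homog k (wt l)) := FiniteDimensional.span_of_finite k (hfin.image _)
  exact inferInstanceAs (FiniteDimensional k ((homog k (wt l)).map (Pre.mk J).toLinearMap))

theorem deg_induction {μ : Fin n → ℕ} {p : Pre J → Prop} (zero : p 0)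
    (word : ∀ l, wt l = μ → p (Pre.mk J (word k l)))
    (add : ∀ u v, p u → p v → p (u + v)) (smul : ∀ (c : k) u, p u → p (c • u))
    {f : Pre J} (hf : f ∈ Pre.deg J μ) : p f := by
  obtain ⟨u, hu, rfl⟩ := hf
  change p (Pre.mk J u)
  induction hu using Submodule.span_induction with
  | mem _ h => obtain ⟨l, hl, rfl⟩ := h; exact word l hl
  | zero => rwa [map_zero]
  | add u v _ _ hu hv => rw [map_add]; exact add _ _ hu hv
  | smul c u _ hu => rw [map_smul]; exact smul _ _ hu

end Coefficients

/-! ### Dual bases and the canonical element -/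

section DualBases

open Borel

variable {k : Type*} [Field k] {n : ℕ} (d : Datum k n)

theorem lact_emb (J : PreNicholsIdeal d) (u : Tens k n) :
    lact J (Borel.emb (plusScalar d) _ u) = FreeAlgebra.lift k (RR J) u := by
  have : (lact J).comp (Borel.emb (plusScalar d) _) = FreeAlgebra.lift k (RR J) := by
    ext i
    simp
  exact congrArg (fun f => f u) this

/-- The pairing restricted to `U⁻_max` and `U⁺_max`. -/
noncomputable def prePairing : Pre (maxIdeal d) →ₗ[k] Pre (maxIdeal d) →ₗ[k] k :=
  (pairing d).compl₁₂ (Borel.ofPre _ _).toLinearMap (Borel.ofPre _ _).toLinearMap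

theorem prePairing_apply (f e : Pre (maxIdeal d)) :
    prePairing d f e = pairing d (Borel.ofPre _ _ f) (Borel.ofPre _ _ e) := rfl

theorem prePairing_mk (u v : Tens k n) :
    prePairing d (Pre.mk _ u) (Pre.mk _ v) = form d v u := by
  rw [prePairing_apply, ofPre_mk, ofPre_mk, pairing_eq, actPairing_apply, lact_emb,
    ← counit_lift_RR (maxIdeal d) v u 0, K_zero, mul_one]

/-- The adjointness of `∂_i^L` and left multiplication by `E_i` is what moves derivations across the
canonical element. -/
theorem prePairing_x_mul (f e : Pre (maxIdeal d)) (i : Fin n) :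
    prePairing d f (Pre.x _ i * e) = prePairing d (preDL _ i f) e := by
  obtain ⟨u, rfl⟩ := Pre.mk_surjective _ f
  obtain ⟨v, rfl⟩ := Pre.mk_surjective _ e
  rw [← Pre.mk_ι, ← map_mul, prePairing_mk, preDL_mk, prePairing_mk, form_ι_mul_left]

theorem prePairing_symm (f e : Pre (maxIdeal d)) : prePairing d f e = prePairing d e f := by
  obtain ⟨u, rfl⟩ := Pre.mk_surjective _ f
  obtain ⟨v, rfl⟩ := Pre.mk_surjective _ e
  rw [prePairing_mk, prePairing_mk, form_symm]

/-- The kernel of the pairing is the radical modulo the maximal biideal, and the two coincide. -/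
theorem prePairing_nondegenerate {μ : Fin n → ℕ} {f : Pre (maxIdeal d)}
    (hf : f ∈ Pre.deg (maxIdeal d) μ) (h : ∀ e ∈ Pre.deg (maxIdeal d) μ, prePairing d f e = 0) :
    f = 0 := by
  obtain ⟨u, hu, rfl⟩ := hf
  refine Pre.mk_of_mem _ ?_
  rw [maxIdeal_carrier_eq]
  refine mem_radical_of_homog d hu fun p hp => ?_
  rw [← prePairing_mk]
  exact h _ ⟨p, hp, rfl⟩

theorem nonempty_dualBases : Nonempty (DualBases d) := by
  let B : ∀ μ, LinearMap.BilinForm k (Pre.deg (maxIdeal d) μ) := fun μ =>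
    (prePairing d).compl₁₂ (Submodule.subtype _) (Submodule.subtype _)
  have hB : ∀ μ, (B μ).Nondegenerate := fun μ =>
    ⟨fun f hf => Subtype.ext (prePairing_nondegenerate d f.2 fun e he => hf ⟨e, he⟩),
     fun f hf => Subtype.ext (prePairing_nondegenerate d f.2 fun e he => by
      rw [prePairing_symm]; exact hf ⟨e, he⟩)⟩
  refine ⟨⟨fun μ => Module.finrank k (Pre.deg (maxIdeal d) μ),
    fun μ => (B μ).dualBasis (hB μ) (Module.finBasis k _), fun μ => Module.finBasis k _, ?_⟩⟩
  intro μ i j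
  have := LinearMap.BilinForm.apply_dualBasis_left (hB μ) (Module.finBasis k _) i j
  simp only [eq_comm (a := j)] at this
  exact this

variable {d}

namespace DualBases

variable (D : DualBases d)

theorem pairing_F_E (μ : Fin n → ℕ) (i j) :
    prePairing d (D.F μ i) (D.E μ j) = if i = j then 1 else 0 := D.dual μ i j

theorem sum_pairing_smul_F {μ : Fin n → ℕ} {f : Pre (maxIdeal d)}
    (hf : f ∈ Pre.deg (maxIdeal d) μ) :
    ∑ j, prePairing d f (D.E μ j) • (D.F μ j : Pre (maxIdeal d)) = f := by
  have h := congrArg Subtype.val ((D.F μ).sum_repr ⟨f, hf⟩)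
  rw [AddSubmonoidClass.coe_finsetSum] at h
  simp only [SetLike.val_smul] at h
  have hr : ∀ j, prePairing d f (D.E μ j) = (D.F μ).repr ⟨f, hf⟩ j := by
    intro j
    conv_lhs => rw [← h]
    simp [map_sum, LinearMap.sum_apply, pairing_F_E]
  simp only [hr]
  exact h

theorem sum_pairing_smul_E {μ : Fin n → ℕ} {e : Pre (maxIdeal d)}
    (he : e ∈ Pre.deg (maxIdeal d) μ) :
    ∑ j, prePairing d (D.F μ j) e • (D.E μ j : Pre (maxIdeal d)) = e := by
  have h := congrArg Subtype.val ((D.E μ).sum_repr ⟨e, he⟩)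
  rw [AddSubmonoidClass.coe_finsetSum] at h
  simp only [SetLike.val_smul] at h
  have hr : ∀ j, prePairing d (D.F μ j) e = (D.E μ).repr ⟨e, he⟩ j := by
    intro j
    conv_lhs => rw [← h]
    simp [map_sum, pairing_F_E]
  simp only [hr]
  exact h

/-- The canonical element intertwines `∂_i^L` with left multiplication by `E_i`. -/
theorem sum_preDL {M : Type*} [AddCommGroup M] [Module k M] (i : Fin n) (l : List (Fin n))
    (β : Pre (maxIdeal d) →ₗ[k] Pre (maxIdeal d) →ₗ[k] M) :
    ∑ j, β (preDL _ i (D.F (wt (i :: l)) j)) (D.E (wt (i :: l)) j) =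
      ∑ j, β (D.F (wt l) j) (Pre.x (maxIdeal d) i * (D.E (wt l) j : Pre (maxIdeal d))) := by
  have h1 : ∀ j, preDL _ i (D.F (wt (i :: l)) j : Pre (maxIdeal d)) =
      ∑ m, prePairing d (D.F (wt (i :: l)) j) (Pre.x (maxIdeal d) i * (D.E (wt l) m : Pre (maxIdeal d))) •
        (D.F (wt l) m : Pre (maxIdeal d)) := by
    intro j
    simp only [prePairing_x_mul]
    exact (D.sum_pairing_smul_F (preDL_mem_deg _ (D.F _ j).2)).symm
  have h2 : ∀ m, Pre.x _ i * (D.E (wt l) m : Pre (maxIdeal d)) =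
      ∑ j, prePairing d (D.F (wt (i :: l)) j) (Pre.x (maxIdeal d) i * (D.E (wt l) m : Pre (maxIdeal d))) •
        (D.E (wt (i :: l)) j : Pre (maxIdeal d)) :=
    fun m => (D.sum_pairing_smul_E (x_mul_mem_deg _ (D.E _ m).2)).symm
  -- Both sides expand to the same double sum, with the matrix of `∂_i^L` on the one side and its
  -- transpose, the matrix of multiplication by `E_i`, on the other.
  calc _ = ∑ j, ∑ m, prePairing d (D.F (wt (i :: l)) j) (Pre.x (maxIdeal d) i * (D.E (wt l) m : Pre (maxIdeal d))) •
        β (D.F (wt l) m) (D.E (wt (i :: l)) j) := by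
        refine Finset.sum_congr rfl fun j _ => ?_
        conv_lhs => rw [h1]
        simp [map_sum, LinearMap.sum_apply]
    _ = _ := by
        rw [Finset.sum_comm]
        refine Finset.sum_congr rfl fun m _ => ?_
        conv_rhs => rw [h2]
        simp [map_sum]

/-- In degree zero the canonical element is `1 ⊗ 1`. -/
theorem sum_zero {M : Type*} [AddCommGroup M] [Module k M]
    (β : Pre (maxIdeal d) →ₗ[k] Pre (maxIdeal d) →ₗ[k] M) :
    ∑ j, β (D.F 0 j) (D.E 0 j) = β 1 1 := by
  have h0 : (0 : Fin n → ℕ) = wt [] := rfl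
  have hone : (1 : Pre (maxIdeal d)) ∈ Pre.deg (maxIdeal d) 0 := by
    rw [h0, ← map_one (Pre.mk (maxIdeal d)), ← word_nil]
    exact mem_deg_word _ []
  have hs : ∀ f ∈ Pre.deg (maxIdeal d) 0, f = prePairing d f 1 • (1 : Pre (maxIdeal d)) := by
    intro f hf
    refine deg_induction (maxIdeal d) (p := fun f => f = prePairing d f 1 • 1) ?_ ?_ ?_ ?_ hf
    · simp
    · intro l hl
      rw [h0, wt_eq_iff, List.perm_nil] at hl
      subst hl
      have : prePairing d 1 1 = 1 := by
        have := prePairing_mk d 1 1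
        rwa [map_one (Pre.mk (maxIdeal d)), form_one_left, map_one (tensCounit k n)] at this
      rw [word_nil, map_one, this, one_smul]
    · intro u v hu hv
      rw [map_add, LinearMap.add_apply, add_smul, ← hu, ← hv]
    · intro c u hu
      rw [map_smul, LinearMap.smul_apply, smul_assoc, ← hu]
  calc _ = ∑ j, β 1 (prePairing d (D.F 0 j) 1 • (D.E 0 j : Pre (maxIdeal d))) := by
        refine Finset.sum_congr rfl fun j _ => ?_
        conv_lhs => rw [hs _ (D.F 0 j).2]
        simp
    _ = _ := by rw [← map_sum, D.sum_pairing_smul_E hone]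

end DualBases

end DualBases

/-! ### The filtration of H ⋉ U⁻ by word length -/

section Length

open Borel

variable {k : Type*} [Field k] {n : ℕ} {d : Datum k n} (J : PreNicholsIdeal d)

local notation "mX" => Borel.X (minusScalar d) J
local notation "mK" => Borel.K (minusScalar d) J
local notation "mE" => Borel.emb (minusScalar d) J
local notation "mP" => Borel.ofPre (minusScalar d) J

/-- The span of the elements `F_l K_a` with `a ∈ S` and `l` of length less than `N`. -/
def lenLT (S : Set (Fin n → ℤ)) (N : ℕ) : Submodule k (BMinus J) :=
  Submodule.span k {y | ∃ l : List (Fin n), ∃ a ∈ S, l.length < N ∧ y = mE (word k l) * mK a}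

variable {J} {S : Set (Fin n → ℤ)}

theorem word_mul_K_mem_lenLT {l : List (Fin n)} {a : Fin n → ℤ} {N : ℕ} (ha : a ∈ S)
    (hl : l.length < N) : mE (word k l) * mK a ∈ lenLT J S N :=
  Submodule.subset_span ⟨l, a, ha, hl, rfl⟩

theorem lenLT_le {N : ℕ} {M : Submodule k (BMinus J)}
    (h : ∀ l : List (Fin n), ∀ a ∈ S, l.length < N → mE (word k l) * mK a ∈ M) :
    lenLT J S N ≤ M := by
  refine Submodule.span_le.mpr ?_
  rintro _ ⟨l, a, ha, hl, rfl⟩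
  exact h l a ha hl

theorem lenLT_mono {N N' : ℕ} (h : N ≤ N') : lenLT J S N ≤ lenLT J S N' :=
  lenLT_le fun _ _ ha hl => word_mul_K_mem_lenLT ha (hl.trans_le h)

theorem lenLT_zero : lenLT J S 0 = ⊥ :=
  eq_bot_iff.mpr (lenLT_le fun _ _ _ hl => absurd hl (Nat.not_lt_zero _))

theorem emb_mul_K_mem_lenLT {T : Set (List (Fin n))} {N : ℕ} (hT : ∀ l ∈ T, l.length < N)
    {u : Tens k n} (hu : u ∈ Submodule.span k (word k '' T)) {a : Fin n → ℤ} (ha : a ∈ S) :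
    mE u * mK a ∈ lenLT J S N := by
  induction hu using Submodule.span_induction with
  | mem _ h => obtain ⟨l, hl, rfl⟩ := h; exact word_mul_K_mem_lenLT ha (hT l hl)
  | zero => simp
  | add u v _ _ hu hv => rw [map_add, add_mul]; exact add_mem hu hv
  | smul c u _ hu => rw [map_smul, smul_mul_assoc]; exact Submodule.smul_mem _ _ hu

theorem CC_mem_lenLT {i : Fin n} {N : ℕ} {y : BMinus J} (hy : y ∈ lenLT J S (N + 1)) :
    CC J i y ∈ lenLT J S N := by
  suffices h : lenLT J S (N + 1) ≤ (lenLT J S N).comap (CC J i) from h hy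
  refine lenLT_le fun l a ha hl => ?_
  change CC J i _ ∈ lenLT J S N
  rw [CC_mul_K, CC_emb]
  refine emb_mul_K_mem_lenLT (fun l' hl' => ?_) (dL_word_mem d i l) ha
  have := hl'.length_eq
  rw [List.length_cons] at this
  omega

/-- In contrast to `CC`, this operator multiplies by `K_i⁻¹`, so the group-like factors are not
confined to a given set. -/
theorem RR_mem_lenLT {i : Fin n} {N : ℕ} {y : BMinus J} (hy : y ∈ lenLT J Set.univ (N + 1)) :
    RR J i y ∈ lenLT J Set.univ N := by
  suffices h : lenLT J Set.univ (N + 1) ≤ (lenLT J Set.univ N).comap (RR J i) from h hy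
  refine lenLT_le fun l a ha hl => ?_
  change RR J i _ ∈ lenLT J Set.univ N
  rw [RR_mul_K, RR_emb, mul_assoc, ← K_add]
  refine emb_mul_K_mem_lenLT (fun l' hl' => ?_) (dR_word_mem d i l) trivial
  have := hl'.length_eq
  rw [List.length_cons] at this
  omega

theorem X_mul_mem_lenLT {i : Fin n} {N : ℕ} {y : BMinus J} (hy : y ∈ lenLT J S N) :
    mX i * y ∈ lenLT J S (N + 1) := by
  suffices h : lenLT J S N ≤ (lenLT J S (N + 1)).comap (LinearMap.mulLeft k (mX i)) from h hy
  refine lenLT_le fun l a ha hl => ?_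
  change mX i * _ ∈ lenLT J S (N + 1)
  rw [← mul_assoc, ← emb_ι, ← map_mul, ← word_cons]
  exact word_mul_K_mem_lenLT ha (by simpa using hl)

theorem K_mul_mem_lenLT {b : Fin n → ℤ} (hb : ∀ a ∈ S, b + a ∈ S) {N : ℕ} {y : BMinus J}
    (hy : y ∈ lenLT J S N) : mK b * y ∈ lenLT J S N := by
  suffices h : lenLT J S N ≤ (lenLT J S N).comap (LinearMap.mulLeft k (mK b)) from h hy
  refine lenLT_le fun l a ha hl => ?_
  change mK b * _ ∈ lenLT J S N
  rw [← mul_assoc, minus_K_mul_word, smul_mul_assoc, mul_assoc, ← K_add]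
  exact Submodule.smul_mem _ _ (word_mul_K_mem_lenLT (hb a ha) hl)

theorem eta_mem_lenLT {b : Fin n → ℤ} {N : ℕ} {y : BMinus J} (hy : y ∈ lenLT J S N) :
    eta J b y ∈ lenLT J S N := by
  suffices h : lenLT J S N ≤ (lenLT J S N).comap (eta J b).toLinearMap from h hy
  refine lenLT_le fun l a ha hl => ?_
  change eta J b _ ∈ lenLT J S N
  have h : ∀ l : List (Fin n), eta J b (mE (word k l)) = mE (word k l) := by
    intro l
    induction l with
    | nil => simp [word_nil]
    | cons i l ih => simp [word_cons, ih]
  rw [map_mul, h, eta_K, mul_smul_comm]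
  exact Submodule.smul_mem _ _ (word_mul_K_mem_lenLT ha hl)

theorem exists_mem_lenLT (y : BMinus J) : ∃ N, y ∈ lenLT J Set.univ N := by
  induction y using Borel.induction_emb_K with
  | zero => exact ⟨0, zero_mem _⟩
  | gen l a => exact ⟨l.length + 1, word_mul_K_mem_lenLT trivial (Nat.lt_succ_self _)⟩
  | add u v hu hv =>
    obtain ⟨M, hM⟩ := hu
    obtain ⟨N, hN⟩ := hv
    exact ⟨max M N, add_mem (lenLT_mono (le_max_left _ _) hM) (lenLT_mono (le_max_right _ _) hN)⟩
  | smul c u hu =>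
    obtain ⟨M, hM⟩ := hu
    exact ⟨M, Submodule.smul_mem _ _ hM⟩

theorem one_mem_lenLT (h : (0 : Fin n → ℤ) ∈ S) : (1 : BMinus J) ∈ lenLT J S 1 := by
  have := word_mul_K_mem_lenLT (J := J) (l := []) h Nat.zero_lt_one
  rwa [word_nil, map_one, K_zero, mul_one] at this

end Length

/-! ### The operators by which the canonical element acts -/

section TwistMaps

open Borel

variable {k : Type*} [Field k] {n : ℕ} {d : Datum k n} (J : PreNicholsIdeal d) (c : Fin n → k)

local notation "mX" => Borel.X (minusScalar d) J
local notation "mK" => Borel.K (minusScalar d) J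
local notation "mE" => Borel.emb (minusScalar d) J
local notation "mP" => Borel.ofPre (minusScalar d) J
local notation "Pm" => Pre (maxIdeal d)

theorem eta_comm (a b : Fin n → ℤ) (y : BMinus J) :
    eta J a (eta J b y) = eta J b (eta J a y) := by
  have : (eta J a).comp (eta J b) = (eta J b).comp (eta J a) :=
    hom_ext (by simp) (by simp [smul_smul, mul_comm])
  exact congrArg (fun f => f y) this

/-- The Leibniz rule of `CC` involves `kap`, while σ̄ produces `eta`; this identity reconciles them
in `canonicalSum_shift`. -/
theorem kap_eq (a : Fin n → ℤ) (y : BMinus J) : kap J a y = mK (-a) * eta J a y * mK a := by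
  induction y using Borel.induction with
  | zero => simp
  | one => simp [K_neg_mul_K]
  | X_mul j u hu =>
    rw [map_mul, map_mul, hu, kap_X, eta_X, ← mul_assoc (mK (-a)), K_mul_X, d.minusScalar_eq,
      d.chi_neg_left, inv_inv]
    simp only [smul_mul_assoc, mul_assoc]
  | K_mul b u hu =>
    rw [map_mul, map_mul, hu, kap_K, eta_K]
    simp only [smul_mul_assoc, mul_smul_comm, ← mul_assoc]
    rw [K_comm _ _ b]
  | add u v hu hv => simp only [map_add, hu, hv, mul_add, add_mul]
  | smul c u hu => simp only [map_smul, hu, mul_smul_comm, smul_mul_assoc]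

/-- The left action of `σ̄(x)` for `x ∈ U⁻_max`. -/
def twistL : Pm →ₐ[k] Module.End k (BMinus J) := (lact J).comp (sigmaBar d c)

/-- The right action of `S⁻¹(e) K_a` for `e ∈ U⁺_max`. -/
noncomputable def twistR (a : Fin n → ℤ) : Pm →ₗ[k] Module.End k (BMinus J) :=
  ract J ∘ₗ LinearMap.mulRight k (Borel.K _ _ a) ∘ₗ antipodeInv d ∘ₗ
    (Borel.ofPre (plusScalar d) (maxIdeal d)).toLinearMap

theorem twistR_apply (a : Fin n → ℤ) (e : Pm) :
    twistR J a e = ract J (antipodeInv d (Borel.ofPre _ _ e) * Borel.K _ _ a) := rfl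

theorem twistL_x_mul (j : Fin n) (x : Pm) (y : BMinus J) :
    twistL J c (Pre.x _ j * x) y =
      c (d.τ j) • eta J (simpleRoot j) (RR J (d.τ j) (twistL J c x y)) := by
  rw [map_mul, Module.End.mul_apply]
  simp [twistL, sigmaBar]

theorem twistL_one (y : BMinus J) : twistL J c 1 y = y := by rw [map_one]; rfl

theorem twistL_mk_word_cons (j : Fin n) (l : List (Fin n)) (y : BMinus J) :
    twistL J c (Pre.mk _ (word k (j :: l))) y =
      c (d.τ j) • eta J (simpleRoot j) (RR J (d.τ j) (twistL J c (Pre.mk _ (word k l)) y)) := by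
  rw [word_cons, map_mul, Pre.mk_ι, twistL_x_mul]

theorem twistL_mem_lenLT (l : List (Fin n)) {N : ℕ} {y : BMinus J} (hy : y ∈ lenLT J Set.univ N) :
    twistL J c (Pre.mk _ (word k l)) y ∈ lenLT J Set.univ (N - l.length) := by
  induction l with
  | nil => simpa [word_nil] using hy
  | cons j l ih =>
    rw [twistL_mk_word_cons]
    refine Submodule.smul_mem _ _ (eta_mem_lenLT ?_)
    rw [List.length_cons, ← Nat.sub_sub]
    -- When the truncated difference is already zero, the shorter word acts as zero and there is
    -- nothing left to lower.
    rcases hN : N - l.length with _ | M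
    · rw [hN, lenLT_zero, Submodule.mem_bot] at ih
      rw [ih, map_zero]
      exact zero_mem _
    · rw [hN] at ih
      exact RR_mem_lenLT ih

theorem length_eq_sum_wt (l : List (Fin n)) : l.length = ∑ i, wt l i := by
  induction l with
  | nil => simp [wt]
  | cons i l ih =>
    have : ∀ j, wt (i :: l) j = wt l j + if i = j then 1 else 0 := by
      intro j; simp [wt, List.count_cons]
    simp [this, Finset.sum_add_distrib, ih]

/-- Every letter under σ̄ lowers the length by one; this is the source of the finiteness of the
twist product. -/
theorem twistL_eq_zero {N : ℕ} {y : BMinus J} (hy : y ∈ lenLT J Set.univ N) {ρ : Fin n → ℕ}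
    (hρ : N ≤ ∑ i, ρ i) {f : Pm} (hf : f ∈ Pre.deg (maxIdeal d) ρ) : twistL J c f y = 0 := by
  refine deg_induction (maxIdeal d) (p := fun f => twistL J c f y = 0) ?_ ?_ ?_ ?_ hf
  · simp
  · rintro l rfl
    have := twistL_mem_lenLT J c l hy
    rwa [length_eq_sum_wt, Nat.sub_eq_zero_of_le hρ, lenLT_zero, Submodule.mem_bot] at this
  · intro u v hu hv; rw [map_add, LinearMap.add_apply, hu, hv, add_zero]
  · intro r u hu; rw [map_smul, LinearMap.smul_apply, hu, smul_zero]

/-- Moving `σ̄(F_j)` past `K_b` costs the scalar `χ(α_j + τ(α_j), b)⁻¹`, which is 1 for such `b`. -/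
theorem twistL_K_mul {b : Fin n → ℤ} (hb : d.tau b = -b) (x : Pm) (y : BMinus J) :
    twistL J c x (mK b * y) = mK b * twistL J c x y := by
  induction x using Pre.induction with
  | zero => simp
  | one => simp
  | x_mul j u hu =>
    rw [twistL_x_mul, twistL_x_mul, hu, RR_K_mul, map_smul, map_mul, eta_K, ← d.tau_simple,
      d.chi_comm b, d.chi_θ hb, inv_inv, smul_mul_assoc,
      smul_smul, smul_smul, mul_assoc, mul_inv_cancel₀ (d.chi_ne_zero _ _), mul_one, mul_smul_comm]
  | add u v hu hv => rw [map_add, LinearMap.add_apply, hu, hv, LinearMap.add_apply, mul_add]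
  | smul r u hu => rw [map_smul, LinearMap.smul_apply, hu, LinearMap.smul_apply, mul_smul_comm]

theorem twistL_mul_K (l : List (Fin n)) (b : Fin n → ℤ) (y : BMinus J) :
    twistL J c (Pre.mk _ (word k l)) (y * mK b) =
      (d.chi (zwt l) b)⁻¹ • (twistL J c (Pre.mk _ (word k l)) y * mK b) := by
  induction l with
  | nil => simp [word_nil, zwt_nil, d.chi_zero_left]
  | cons j l ih =>
    rw [twistL_mk_word_cons, twistL_mk_word_cons, ih, map_smul, RR_mul_K, map_smul, map_mul, eta_K,
      zwt_cons, d.chi_add_left, mul_inv]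
    simp only [mul_smul_comm, smul_mul_assoc, smul_smul]
    congr 1; ring

theorem twistL_CC (x : Pm) (i : Fin n) (y : BMinus J) :
    twistL J c x (CC J i y) = CC J i (twistL J c x y) := lact_CC J _ i y

/-- The letter `F_j` of `x` acts through `E_{τ(j)}` and hits the leading `F_i` exactly when `j =
τ(i)`. Collecting these contributions over all letters of `x` amounts to applying `∂^L_{τ(i)}` to
`x`. -/
theorem twistL_X_mul (i : Fin n) (x : Pm) (y : BMinus J) : twistL J c x (mX i * y) =
    mX i * twistL J c x y + (c i * d.q i (d.τ i)) • (mK (-simpleRoot i) *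
      eta J (simpleRoot (d.τ i)) (twistL J c (preDL _ (d.τ i) x) y)) := by
  induction x using Pre.induction with
  | zero => simp
  | one => simp [preDL_one]
  | x_mul j u hu =>
    have hs : d.q i (d.τ j) = d.q (d.τ i) j := by
      rw [← d.q_τ, d.τ_involutive]
    have h1 : RR J (d.τ j) (eta J (simpleRoot (d.τ i)) (twistL J c (preDL _ (d.τ i) u) y)) =
        (d.q i j)⁻¹ • eta J (simpleRoot (d.τ i))
          (RR J (d.τ j) (twistL J c (preDL _ (d.τ i) u) y)) := by
      rw [eta_RR, d.chi_simple, d.q_τ, smul_smul, inv_mul_cancel₀ (d.q_ne_zero _ _), one_smul]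
    rw [twistL_x_mul, hu, map_add, RR_X_mul, map_smul, RR_K_mul, h1, map_add, map_add, map_smul,
      map_smul, map_mul, mul_smul_comm, map_smul, map_mul, eta_X, eta_K, preDL_x_mul, twistL_x_mul,
      map_add, LinearMap.add_apply, map_smul, LinearMap.smul_apply, twistL_x_mul,
      eta_comm J (simpleRoot j), d.chi_neg_left, d.chi_neg_right, inv_inv, inv_inv, d.chi_simple,
      d.chi_simple, map_add, map_smul, map_smul, mul_add]
    by_cases h : d.τ j = i
    · have h' : d.τ i = j := by rw [← h, d.τ_involutive]
      rw [if_pos h, if_pos h', h', map_mul, eta_K, d.chi_neg_right, inv_inv, d.chi_simple, h]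
      simp only [mul_smul_comm, smul_mul_assoc, smul_smul, smul_add]
      rw [add_assoc, add_comm (_ • (mK (-simpleRoot i) * eta J (simpleRoot j) (twistL J c u y)))]
      congr 2
      · congr 1
        rw [d.q_symm j i]
        have h2 : d.q i i = d.q j j := by rw [← d.q_τ, h']
        field_simp [d.q_ne_zero i j]
        rw [h2]
      · congr 1
        rw [d.q_symm j i]
    · have h' : d.τ i ≠ j := fun h' => h (by rw [← h', d.τ_involutive])
      rw [if_neg h, if_neg h', map_zero, map_zero, LinearMap.zero_apply, map_zero, add_zero, mul_zero,
        add_zero]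
      simp only [mul_smul_comm, smul_mul_assoc, smul_smul, smul_add]
      congr 2
      rw [d.q_symm j i, ← hs]
      field_simp [d.q_ne_zero i j]
  | add u v hu hv =>
    simp only [map_add, LinearMap.add_apply, hu, hv, mul_add, smul_add]
    abel
  | smul r u hu =>
    simp only [map_smul, LinearMap.smul_apply, hu, mul_smul_comm, smul_add, smul_comm r]

theorem twistR_zero_one : twistR J 0 1 = 1 := by
  rw [twistR_apply, map_one, antipodeInv_eq, antiMap_one, one_mul, K_zero, ract_one]

/-- `S⁻¹(E_i) = -q_{ii} K_i⁻¹ E_i` stands to the right of `S⁻¹(e)`, and the additional `K_i` in the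
factor `K_{α_i + a}` compensates its `K_i⁻¹`. What remains is the right action of `E_i` up to a
scalar and a sign. -/
theorem twistR_x_mul (i : Fin n) (a : Fin n → ℤ) (e : Pm) (y : BMinus J) :
    twistR J (simpleRoot i + a) (Pre.x _ i * e) y =
      -(d.chi (simpleRoot i) a)⁻¹ • CC J i (twistR J a e y) := by
  have h1 : Borel.ofPre (plusScalar d) (maxIdeal d) (Pre.x _ i) = Borel.X _ _ i := by
    rw [← Pre.mk_ι, ofPre_mk, emb_ι]
  have hk : ∀ y, kap J (simpleRoot i + a) (kap J (-simpleRoot i) y) = kap J a y := by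
    intro y
    have := congrArg (fun f => f y)
      (ract_mul J (Borel.K _ _ (-simpleRoot i)) (Borel.K _ _ (simpleRoot i + a)))
    simp only [← K_add, neg_add_cancel_left, ract_K] at this
    exact this.symm
  have hc : ∀ b y, kap J b (CC J i y) = (d.chi b (simpleRoot i))⁻¹ • CC J i (kap J b y) := by
    intro b y
    rw [CC_kap, smul_smul, inv_mul_cancel₀ (d.chi_ne_zero _ _), one_smul]
  rw [twistR_apply, twistR_apply, map_mul (Borel.ofPre _ _), h1, antipodeInv_eq, antiMap_mul,
    antiMap_X, ract_mul, ract_mul, ract_mul, map_smul, ract_mul, ract_X, ract_K, ract_K, ract_K]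
  simp only [Module.End.mul_apply, LinearMap.smul_apply, AlgHom.toLinearMap_apply, map_smul]
  rw [hc, hk, d.chi_add_left, d.chi_comm a, d.chi_simple, smul_smul]
  congr 1
  field_simp [d.q_ne_zero i i]

theorem twistR_word_cons (i : Fin n) (l : List (Fin n)) (y : BMinus J) :
    twistR J (zwt (i :: l)) (Pre.mk _ (word k (i :: l))) y =
      -(d.chi (simpleRoot i) (zwt l))⁻¹ • CC J i (twistR J (zwt l) (Pre.mk _ (word k l)) y) := by
  rw [zwt_cons, word_cons, map_mul, Pre.mk_ι, twistR_x_mul]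

theorem twistR_word_K_mul (l : List (Fin n)) (b : Fin n → ℤ) (y : BMinus J) :
    twistR J (zwt l) (Pre.mk _ (word k l)) (mK b * y) =
      (d.chi (zwt l) b)⁻¹ • (mK b * twistR J (zwt l) (Pre.mk _ (word k l)) y) := by
  induction l with
  | nil => simp [word_nil, zwt_nil, d.chi_zero_left, twistR_zero_one]
  | cons j l ih =>
    rw [twistR_word_cons, twistR_word_cons, ih, map_smul, CC_K_mul, zwt_cons, d.chi_add_left,
      mul_inv, d.chi_comm b]
    simp only [mul_smul_comm, smul_smul]
    congr 1; ring

theorem twistR_word_one {l : List (Fin n)} (hl : l ≠ []) :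
    twistR J (zwt l) (Pre.mk _ (word k l)) 1 = 0 := by
  cases l with
  | nil => exact (hl rfl).elim
  | cons i l =>
    rw [twistR_word_cons]
    by_cases h : l = []
    · subst h
      rw [word_nil, map_one (Pre.mk _), zwt_nil, twistR_zero_one, Module.End.one_apply, CC_one, smul_zero]
    · rw [twistR_word_one h, map_zero, smul_zero]

end TwistMaps

/-! ### The twist product on H ⋉ U⁻ and its left multiplications -/

section TwistProduct

open Borel

variable {k : Type*} [Field k] {n : ℕ} {d : Datum k n} (J : PreNicholsIdeal d) (c : Fin n → k)

local notation "mX" => Borel.X (minusScalar d) J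
local notation "mK" => Borel.K (minusScalar d) J
local notation "mE" => Borel.emb (minusScalar d) J
local notation "mP" => Borel.ofPre (minusScalar d) J
local notation "Pm" => Pre (maxIdeal d)

theorem finsum_eq_finsum_of_injective {ι κ M : Type*} [AddCommMonoid M] {g : ι → κ}
    (hg : Function.Injective g) {f : κ → M} {f' : ι → M} (h : ∀ i, f (g i) = f' i)
    (h0 : ∀ x, x ∉ Set.range g → f x = 0) : ∑ᶠ x, f x = ∑ᶠ i, f' i := by
  rw [← funext h, ← finsum_mem_range hg]
  refine finsum_congr fun x => ?_
  by_cases hx : x ∈ Set.range g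
  · simp [hx]
  · simp [hx, h0 x hx]

/-- The sum `∑_j u(F_{ρ,j}) K_ρ v(E_{ρ,j})` for linear maps `u` and `v`, up to the sign. -/
noncomputable def canonicalSum (D : DualBases d) (ρ : Fin n → ℕ) (u v : Pm →ₗ[k] BMinus J) :
    BMinus J :=
  (-1 : k) ^ (∑ i, ρ i) • ∑ j, u (D.F ρ j) * mK (natWeight ρ) * v (D.E ρ j)

variable (D : DualBases d)

theorem canonicalSum_add_left (ρ : Fin n → ℕ) (u u' v : Pm →ₗ[k] BMinus J) :
    canonicalSum J D ρ (u + u') v = canonicalSum J D ρ u v + canonicalSum J D ρ u' v := by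
  simp [canonicalSum, add_mul, Finset.sum_add_distrib]

theorem canonicalSum_smul_left (ρ : Fin n → ℕ) (r : k) (u v : Pm →ₗ[k] BMinus J) :
    canonicalSum J D ρ (r • u) v = r • canonicalSum J D ρ u v := by
  simp [canonicalSum, Finset.smul_sum, smul_comm r]

theorem canonicalSum_add_right (ρ : Fin n → ℕ) (u v v' : Pm →ₗ[k] BMinus J) :
    canonicalSum J D ρ u (v + v') = canonicalSum J D ρ u v + canonicalSum J D ρ u v' := by
  simp [canonicalSum, mul_add, Finset.sum_add_distrib]

theorem canonicalSum_smul_right (ρ : Fin n → ℕ) (r : k) (u v : Pm →ₗ[k] BMinus J) :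
    canonicalSum J D ρ u (r • v) = r • canonicalSum J D ρ u v := by
  simp [canonicalSum, Finset.smul_sum, smul_comm r]

theorem canonicalSum_eq_zero_left {ρ : Fin n → ℕ} {u v : Pm →ₗ[k] BMinus J}
    (h : ∀ f ∈ Pre.deg (maxIdeal d) ρ, u f = 0) : canonicalSum J D ρ u v = 0 := by
  have h0 : ∑ j, u (D.F ρ j) * mK (natWeight ρ) * v (D.E ρ j) = 0 :=
    Finset.sum_eq_zero fun j _ => by rw [h _ (D.F ρ j).2, zero_mul, zero_mul]
  rw [canonicalSum, h0, smul_zero]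

theorem canonicalSum_eq_zero_right {ρ : Fin n → ℕ} {u v : Pm →ₗ[k] BMinus J}
    (h : ∀ f ∈ Pre.deg (maxIdeal d) ρ, v f = 0) : canonicalSum J D ρ u v = 0 := by
  have h0 : ∑ j, u (D.F ρ j) * mK (natWeight ρ) * v (D.E ρ j) = 0 :=
    Finset.sum_eq_zero fun j _ => by rw [h _ (D.E ρ j).2, mul_zero]
  rw [canonicalSum, h0, smul_zero]

theorem canonicalSum_congr {ρ : Fin n → ℕ} {u u' v v' : Pm →ₗ[k] BMinus J}
    (h : ∀ f ∈ Pre.deg (maxIdeal d) ρ, ∀ e ∈ Pre.deg (maxIdeal d) ρ,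
      u f * mK (natWeight ρ) * v e = u' f * mK (natWeight ρ) * v' e) :
    canonicalSum J D ρ u v = canonicalSum J D ρ u' v' := by
  rw [canonicalSum, canonicalSum]
  congr 1
  exact Finset.sum_congr rfl fun j _ => h _ (D.F ρ j).2 _ (D.E ρ j).2

theorem canonicalSum_mul_left (ρ : Fin n → ℕ) (y : BMinus J) (u v : Pm →ₗ[k] BMinus J) :
    y * canonicalSum J D ρ u v = canonicalSum J D ρ (LinearMap.mulLeft k y ∘ₗ u) v := by
  simp [canonicalSum, Finset.mul_sum, mul_assoc]

/-- The linear map `x ↦ σ̄(x) ▷ y`. -/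
def twistLAt (y : BMinus J) : Pm →ₗ[k] BMinus J :=
  LinearMap.applyₗ y ∘ₗ (twistL J c).toLinearMap

/-- The linear map `e ↦ z ◁ (S⁻¹(e) K_a)`. -/
noncomputable def twistRAt (a : Fin n → ℤ) (z : BMinus J) : Pm →ₗ[k] BMinus J :=
  LinearMap.applyₗ z ∘ₗ twistR J a

@[simp] theorem twistLAt_apply (y : BMinus J) (x : Pm) : twistLAt J c y x = twistL J c x y := rfl

@[simp] theorem twistRAt_apply (a : Fin n → ℤ) (z : BMinus J) (e : Pm) :
    twistRAt J a z e = twistR J a e z := rfl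

theorem twistLAt_add (y y' : BMinus J) :
    twistLAt J c (y + y') = twistLAt J c y + twistLAt J c y' := by ext x; simp

theorem twistLAt_smul (r : k) (y : BMinus J) : twistLAt J c (r • y) = r • twistLAt J c y := by
  ext x; simp

theorem twistRAt_add (a : Fin n → ℤ) (y y' : BMinus J) :
    twistRAt J a (y + y') = twistRAt J a y + twistRAt J a y' := by ext x; simp

theorem twistRAt_smul (a : Fin n → ℤ) (r : k) (y : BMinus J) :
    twistRAt J a (r • y) = r • twistRAt J a y := by
  ext x; simp

/-- The summand of the twist product of arbitrary elements of `H ⋉ U⁻`. -/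
noncomputable def starTerm (y z : BMinus J) (ρ : Fin n → ℕ) : BMinus J :=
  canonicalSum J D ρ (twistLAt J c y) (twistRAt J (natWeight ρ) z)

theorem twistTerm_eq (f g : Pre J) (ρ : Fin n → ℕ) :
    twistTerm J c D f g ρ = starTerm J c D (mP f) (mP g) ρ := by
  simp only [twistTerm, starTerm, canonicalSum, actL_eq, actR_eq]
  rfl

theorem finite_sum_lt (N : ℕ) : {ρ : Fin n → ℕ | ∑ i, ρ i < N}.Finite := by
  refine (Set.finite_Iic (fun _ : Fin n => N)).subset fun ρ hρ i => ?_
  exact (Finset.single_le_sum (fun _ _ => Nat.zero_le _) (Finset.mem_univ i)).trans (le_of_lt hρ)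

theorem finite_support_canonicalSum {N : ℕ} {u v : (Fin n → ℕ) → Pm →ₗ[k] BMinus J}
    (h : ∀ ρ, N ≤ ∑ i, ρ i → ∀ f ∈ Pre.deg (maxIdeal d) ρ, u ρ f = 0) :
    Function.HasFiniteSupport fun ρ => canonicalSum J D ρ (u ρ) (v ρ) := by
  refine (finite_sum_lt N).subset fun ρ hρ => ?_
  by_contra hN
  exact hρ (canonicalSum_eq_zero_left J D (h ρ (not_lt.mp hN)))

theorem finite_support_starTerm (y z : BMinus J) :
    Function.HasFiniteSupport (starTerm J c D y z) := by
  obtain ⟨N, hN⟩ := exists_mem_lenLT y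
  exact finite_support_canonicalSum J D (N := N) fun ρ hρ f hf => twistL_eq_zero J c hN hρ hf

/-- The twist product of arbitrary elements of `H ⋉ U⁻`. -/
noncomputable def starB : BMinus J →ₗ[k] BMinus J →ₗ[k] BMinus J :=
  LinearMap.mk₂ k (fun y z => ∑ᶠ ρ, starTerm J c D y z ρ)
    (by
      intro y y' z
      rw [← finsum_add_distrib (finite_support_starTerm J c D _ _)
        (finite_support_starTerm J c D _ _)]
      refine finsum_congr fun ρ => ?_
      rw [starTerm, twistLAt_add, canonicalSum_add_left]
      rfl)
    (by
      intro r y z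
      rw [smul_finsum]
      refine finsum_congr fun ρ => ?_
      rw [starTerm, twistLAt_smul, canonicalSum_smul_left]
      rfl)
    (by
      intro y z z'
      rw [← finsum_add_distrib (finite_support_starTerm J c D _ _)
        (finite_support_starTerm J c D _ _)]
      refine finsum_congr fun ρ => ?_
      rw [starTerm, twistRAt_add, canonicalSum_add_right]
      rfl)
    (by
      intro r y z
      rw [smul_finsum]
      refine finsum_congr fun ρ => ?_
      rw [starTerm, twistRAt_smul, canonicalSum_smul_right]
      rfl)

theorem starB_apply (y z : BMinus J) : starB J c D y z = ∑ᶠ ρ, starTerm J c D y z ρ := rfl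

theorem twist_eq (f g : Pre J) : twist J c D f g = starB J c D (mP f) (mP g) :=
  finsum_congr fun ρ => twistTerm_eq J c D f g ρ

theorem starB_K_mul {a : Fin n → ℤ} (ha : d.tau a = -a) (y z : BMinus J) :
    starB J c D (mK a * y) z = mK a * starB J c D y z := by
  rw [starB_apply, starB_apply, mul_finsum' _ _ (finite_support_starTerm J c D _ _)]
  refine finsum_congr fun ρ => ?_
  rw [starTerm, starTerm, canonicalSum_mul_left]
  congr 1
  ext x
  exact twistL_K_mul J c ha x y

/-- In the summand of `ρ` both sides acquire the same scalar `χ(ρ, b)⁻¹`, and `K_b` commutes with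
`K_ρ` in the middle. -/
theorem starB_mul_K (b : Fin n → ℤ) (y z : BMinus J) :
    starB J c D (y * mK b) z = starB J c D y (mK b * z) := by
  rw [starB_apply, starB_apply]
  refine finsum_congr fun ρ => ?_
  have hL : ∀ f ∈ Pre.deg (maxIdeal d) ρ, twistL J c f (y * mK b) =
      (d.chi (natWeight ρ) b)⁻¹ • (twistL J c f y * mK b) := by
    intro f hf
    refine deg_induction (maxIdeal d) (p := fun f => twistL J c f (y * mK b) =
      (d.chi (natWeight ρ) b)⁻¹ • (twistL J c f y * mK b)) ?_ ?_ ?_ ?_ hf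
    · simp
    · rintro l rfl
      exact twistL_mul_K J c l b y
    · intro u v hu hv; rw [map_add, LinearMap.add_apply, hu, hv, LinearMap.add_apply, add_mul,
        smul_add]
    · intro r u hu; rw [map_smul, LinearMap.smul_apply, hu, LinearMap.smul_apply, smul_mul_assoc,
        smul_comm]
  have hR : ∀ f ∈ Pre.deg (maxIdeal d) ρ, twistR J (natWeight ρ) f (mK b * z) =
      (d.chi (natWeight ρ) b)⁻¹ • (mK b * twistR J (natWeight ρ) f z) := by
    intro f hf
    refine deg_induction (maxIdeal d) (p := fun f => twistR J (natWeight ρ) f (mK b * z) =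
      (d.chi (natWeight ρ) b)⁻¹ • (mK b * twistR J (natWeight ρ) f z)) ?_ ?_ ?_ ?_ hf
    · simp
    · rintro l rfl
      exact twistR_word_K_mul J l b z
    · intro u v hu hv; rw [map_add, LinearMap.add_apply, hu, hv, LinearMap.add_apply, mul_add,
        smul_add]
    · intro r u hu; rw [map_smul, LinearMap.smul_apply, hu, LinearMap.smul_apply, mul_smul_comm,
        smul_comm]
  refine canonicalSum_congr J D fun f hf e he => ?_
  rw [twistLAt_apply, twistRAt_apply, twistLAt_apply, twistRAt_apply, hL f hf, hR e he,
    smul_mul_assoc, smul_mul_assoc, mul_smul_comm, mul_assoc (twistL J c f y), K_comm]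
  simp only [mul_assoc]

theorem canonicalSum_zero (u v : Pm →ₗ[k] BMinus J) : canonicalSum J D 0 u v = u 1 * v 1 := by
  have := D.sum_zero ((LinearMap.mul k (BMinus J)).compl₁₂ u v)
  have hz : natWeight (0 : Fin n → ℕ) = 0 := rfl
  simpa [canonicalSum, hz, K_zero] using this

/-- The element 1 has length zero, so every summand with `ρ ≠ 0` is killed by the left action. -/
theorem starB_one_left (z : BMinus J) : starB J c D 1 z = z := by
  rw [starB_apply, finsum_eq_single _ 0]
  · rw [starTerm, canonicalSum_zero, twistLAt_apply, twistRAt_apply, twistL_one, one_mul]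
    change twistR J 0 1 z = z
    rw [twistR_zero_one]
    rfl
  · intro ρ hρ
    refine canonicalSum_eq_zero_left J D fun f hf => ?_
    refine twistL_eq_zero J c (one_mem_lenLT trivial) ?_ hf
    rw [Nat.one_le_iff_ne_zero]
    exact fun h => hρ (funext fun i => (Finset.sum_eq_zero_iff.mp h) i (Finset.mem_univ i))

theorem starB_one_right (y : BMinus J) : starB J c D y 1 = y := by
  rw [starB_apply, finsum_eq_single _ 0]
  · rw [starTerm, canonicalSum_zero, twistLAt_apply, twistRAt_apply, twistL_one]
    change y * twistR J 0 1 1 = y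
    rw [twistR_zero_one]
    exact mul_one y
  · intro ρ hρ
    refine canonicalSum_eq_zero_right J D fun e he => ?_
    refine deg_induction (maxIdeal d) (p := fun e => twistR J (natWeight ρ) e 1 = 0) ?_ ?_ ?_ ?_ he
    · simp
    · rintro l rfl
      exact twistR_word_one J (by rintro rfl; exact hρ rfl)
    · intro u v hu hv; rw [map_add, LinearMap.add_apply, hu, hv, add_zero]
    · intro r u hu; rw [map_smul, LinearMap.smul_apply, hu, smul_zero]

/-- Left multiplication by `F_i` with respect to the twist product. -/
def starGen (i : Fin n) : Module.End k (BMinus J) :=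
  LinearMap.mulLeft k (mX i) + (c i * d.q i (d.τ i)) •
    (LinearMap.mulLeft k (mK (simpleRoot (d.τ i) - simpleRoot i)) ∘ₗ CC J (d.τ i))

theorem starGen_apply (i : Fin n) (y : BMinus J) : starGen J c i y = mX i * y +
    (c i * d.q i (d.τ i)) • (mK (simpleRoot (d.τ i) - simpleRoot i) * CC J (d.τ i) y) := rfl

theorem tau_sub (i : Fin n) : d.tau (simpleRoot (d.τ i) - simpleRoot i) =
    -(simpleRoot (d.τ i) - simpleRoot i) := by
  rw [sub_eq_add_neg, d.tau_add, d.tau_neg, d.tau_simple, d.tau_simple, d.τ_involutive]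
  abel

theorem wt_cons (i : Fin n) (l : List (Fin n)) : wt (i :: l) = wt l + Pi.single i 1 := by
  funext j
  by_cases h : i = j
  · subst h; simp [wt]
  · simp [wt, h, Ne.symm h]

/-- The shift of the canonical elements that underlies the compatibility of the twist product with
left multiplications. -/
theorem canonicalSum_shift (i : Fin n) (y z : BMinus J) (l : List (Fin n)) :
    canonicalSum J D (wt (d.τ i :: l))
      (LinearMap.mulLeft k (mK (-simpleRoot i)) ∘ₗ (eta J (simpleRoot (d.τ i))).toLinearMap ∘ₗ
        twistLAt J c y ∘ₗ preDL _ (d.τ i)) (twistRAt J (natWeight (wt (d.τ i :: l))) z) =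
    canonicalSum J D (wt l)
      (LinearMap.mulLeft k (mK (simpleRoot (d.τ i) - simpleRoot i)) ∘ₗ
        (kap J (simpleRoot (d.τ i))).toLinearMap ∘ₗ twistLAt J c y)
      ((d.chi (simpleRoot (d.τ i)) (zwt l))⁻¹ • CC J (d.τ i) ∘ₗ
        twistRAt J (natWeight (wt l)) z) := by
  have h := D.sum_preDL (d.τ i) l (LinearMap.compl₁₂ (LinearMap.mul k (BMinus J))
    (LinearMap.mulRight k (mK (natWeight (wt (d.τ i :: l)))) ∘ₗ
      LinearMap.mulLeft k (mK (-simpleRoot i)) ∘ₗ (eta J (simpleRoot (d.τ i))).toLinearMap ∘ₗ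
        twistLAt J c y) (twistRAt J (natWeight (wt (d.τ i :: l))) z))
  simp only [LinearMap.compl₁₂_apply, LinearMap.mul_apply', LinearMap.comp_apply,
    LinearMap.mulRight_apply, LinearMap.mulLeft_apply, AlgHom.toLinearMap_apply] at h
  rw [canonicalSum, canonicalSum]
  simp only [LinearMap.comp_apply, LinearMap.mulLeft_apply, AlgHom.toLinearMap_apply,
    LinearMap.smul_apply]
  -- The shift raises `|ρ|` by one; the resulting sign cancels against the sign in `twistR_x_mul`.
  rw [h, ← length_eq_sum_wt, ← length_eq_sum_wt, List.length_cons, pow_succ, mul_neg_one, neg_smul,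
    ← smul_neg, ← Finset.sum_neg_distrib]
  congr 1
  refine Finset.sum_congr rfl fun j _ => ?_
  rw [← zwt_eq, ← zwt_eq, twistRAt_apply, twistRAt_apply, zwt_cons, twistR_x_mul, kap_eq,
    sub_eq_neg_add, K_add, K_add]
  simp only [neg_smul, mul_neg, neg_neg, mul_smul_comm, mul_assoc]
  congr 2
  rw [← mul_assoc (mK (simpleRoot (d.τ i))) (mK (-simpleRoot (d.τ i))), K_mul_K_neg, one_mul]

/-- The left side splits by `twistL_X_mul` into terms `P ρ` and terms `S ρ` with `∂^L_{τ(i)}`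
applied to `F_ρ`. The right side splits by the Leibniz rule of `CC` into the same `P ρ` and terms `R
ρ` in which `E_{τ(i)}` acts on the factor from `z`. The sums of the `S ρ` and the `R ρ` agree
because `S (ρ + α_{τ(i)}) = R ρ`, while `S ρ = 0` if `ρ` does not involve `α_{τ(i)}`. -/
theorem starB_starGen (i : Fin n) (y z : BMinus J) :
    starB J c D (starGen J c i y) z = starGen J c i (starB J c D y z) := by
  obtain ⟨N, hN⟩ := exists_mem_lenLT y
  set r : k := c i * d.q i (d.τ i) with hr
  let S : (Fin n → ℕ) → BMinus J := fun ρ => canonicalSum J D ρ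
    (LinearMap.mulLeft k (mK (-simpleRoot i)) ∘ₗ (eta J (simpleRoot (d.τ i))).toLinearMap ∘ₗ
        twistLAt J c y ∘ₗ preDL _ (d.τ i)) (twistRAt J (natWeight ρ) z)
  let R : (Fin n → ℕ) → BMinus J := fun ρ => canonicalSum J D ρ
    (LinearMap.mulLeft k (mK (simpleRoot (d.τ i) - simpleRoot i)) ∘ₗ
        (kap J (simpleRoot (d.τ i))).toLinearMap ∘ₗ twistLAt J c y)
    ((d.chi (simpleRoot (d.τ i)) (natWeight ρ))⁻¹ • CC J (d.τ i) ∘ₗ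
        twistRAt J (natWeight ρ) z)
  let P : (Fin n → ℕ) → BMinus J := fun ρ => canonicalSum J D ρ
    (LinearMap.mulLeft k (mX i) ∘ₗ twistLAt J c y + r •
      (LinearMap.mulLeft k (mK (simpleRoot (d.τ i) - simpleRoot i)) ∘ₗ CC J (d.τ i) ∘ₗ
        twistLAt J c y)) (twistRAt J (natWeight ρ) z)
  have hS : ∀ ρ, S (ρ + Pi.single (d.τ i) 1) = R ρ := by
    intro ρ
    obtain ⟨l, rfl⟩ := exists_word_wt ρ
    rw [← wt_cons]
    exact canonicalSum_shift J c D i y z l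
  have hS0 : ∀ ρ, ρ ∉ Set.range (fun ρ : Fin n → ℕ => ρ + Pi.single (d.τ i) 1) → S ρ = 0 := by
    intro ρ hρ
    refine canonicalSum_eq_zero_left J D fun f hf => ?_
    have h0 : ρ (d.τ i) = 0 := by
      by_contra h
      refine hρ ⟨ρ - Pi.single (d.τ i) 1, funext fun j => ?_⟩
      by_cases hj : j = d.τ i
      · subst hj
        simp
        omega
      · simp [hj]
    simp [preDL_eq_zero _ h0 hf]
  have hSR : ∑ᶠ ρ, S ρ = ∑ᶠ ρ, R ρ :=
    finsum_eq_finsum_of_injective (add_left_injective _) hS hS0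
  have hfinR : R.HasFiniteSupport := finite_support_canonicalSum J D (N := N) fun ρ hρ f hf => by
    simp [twistL_eq_zero J c hN hρ hf]
  have hfinP : P.HasFiniteSupport := finite_support_canonicalSum J D (N := N) fun ρ hρ f hf => by
    simp [twistL_eq_zero J c hN hρ hf]
  have hfinS : S.HasFiniteSupport := by
    -- The support of `S` is the translate of that of `R`.
    refine (Set.Finite.image (fun ρ => ρ + Pi.single (d.τ i) 1) hfinR).subset fun ρ hρ => ?_
    obtain ⟨ρ, rfl⟩ := not_imp_comm.mp (hS0 ρ) hρ
    exact ⟨ρ, by rwa [Function.mem_support, ← hS], rfl⟩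
  have h1 : ∀ ρ, starTerm J c D (starGen J c i y) z ρ = P ρ + r • S ρ := by
    intro ρ
    rw [starTerm, ← canonicalSum_smul_left, ← canonicalSum_add_left]
    congr 1
    ext x
    simp only [twistLAt_apply, starGen_apply, map_add, map_smul, twistL_X_mul,
      twistL_K_mul J c (tau_sub i), twistL_CC, LinearMap.add_apply, LinearMap.smul_apply,
      LinearMap.comp_apply, LinearMap.mulLeft_apply, AlgHom.toLinearMap_apply]
    abel
  have h2 : ∀ ρ, starGen J c i (starTerm J c D y z ρ) = P ρ + r • R ρ := by
    intro ρ
    simp only [starTerm, P, R, canonicalSum, map_smul, map_sum, starGen_apply,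
      LinearMap.comp_apply, LinearMap.add_apply, LinearMap.smul_apply, LinearMap.mulLeft_apply,
      AlgHom.toLinearMap_apply]
    rw [smul_comm r, ← smul_add]
    congr 1
    rw [Finset.smul_sum, ← Finset.sum_add_distrib]
    refine Finset.sum_congr rfl fun j _ => ?_
    rw [CC_mul, CC_mul_K, map_mul (kap J _), kap_K]
    simp only [add_mul, mul_add, smul_add, smul_mul_assoc, mul_smul_comm, mul_assoc, hr, add_assoc]
  rw [starB_apply, starB_apply, map_finsum _ (finite_support_starTerm J c D _ _), finsum_congr h1,
    finsum_congr h2, finsum_add_distrib hfinP, finsum_add_distrib hfinP, ← smul_finsum,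
    ← smul_finsum, hSR]
  · exact hfinR.subset (Function.support_const_smul_subset r R)
  · exact hfinS.subset (Function.support_const_smul_subset r S)

end TwistProduct

/-! ### Associativity, independence of bases and leading terms -/

section StarProduct

open Borel

variable {k : Type*} [Field k] {n : ℕ} {d : Datum k n} (J : PreNicholsIdeal d) (c : Fin n → k)

local notation "mX" => Borel.X (minusScalar d) J
local notation "mK" => Borel.K (minusScalar d) J
local notation "mE" => Borel.emb (minusScalar d) J
local notation "mP" => Borel.ofPre (minusScalar d) J

/-- The set of all `a` with `τ(a) = -a`. -/
def antiFixed (d : Datum k n) : Set (Fin n → ℤ) := {a | d.tau a = -a}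

theorem zero_mem_antiFixed : (0 : Fin n → ℤ) ∈ antiFixed d := by
  simp [antiFixed, d.tau_zero]

theorem add_mem_antiFixed {a b : Fin n → ℤ} (ha : a ∈ antiFixed d) (hb : b ∈ antiFixed d) :
    a + b ∈ antiFixed d := by
  change d.tau (a + b) = -(a + b)
  rw [d.tau_add, show d.tau a = -a from ha, show d.tau b = -b from hb, neg_add]

theorem sub_mem_antiFixed (i : Fin n) : simpleRoot (d.τ i) - simpleRoot i ∈ antiFixed d := tau_sub i

/-- The span of the elements `F_l K_a` with `a ∈ S`. -/
def wtSpan (S : Set (Fin n → ℤ)) : Submodule k (BMinus J) :=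
  Submodule.span k {y | ∃ l : List (Fin n), ∃ a ∈ S, y = mE (word k l) * mK a}

/-- The subspace `H_θ ⋉ U⁻` of `H ⋉ U⁻`. -/
abbrev bosθ : Submodule k (BMinus J) := wtSpan J (antiFixed d)

variable {J}

theorem lenLT_le_bosθ (N : ℕ) : lenLT J (antiFixed d) N ≤ bosθ J :=
  lenLT_le fun l a ha _ => Submodule.subset_span ⟨l, a, ha, rfl⟩

theorem K_mul_mem_lenLT_antiFixed {b : Fin n → ℤ} (hb : b ∈ antiFixed d) {N : ℕ} {y : BMinus J}
    (hy : y ∈ lenLT J (antiFixed d) N) : mK b * y ∈ lenLT J (antiFixed d) N :=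
  K_mul_mem_lenLT (fun _ ha => add_mem_antiFixed hb ha) hy

variable (J) in
/-- A subspace that contains `1` and is stable under the operators of left multiplication by `K_a`
and `F_i` with respect to the twist product contains `H_θ ⋉ U⁻`. -/
theorem lenLT_le_of_starGen {M : Submodule k (BMinus J)} (one : 1 ∈ M)
    (hK : ∀ a ∈ antiFixed d, ∀ y ∈ M, mK a * y ∈ M)
    (hgen : ∀ i, ∀ y ∈ M, starGen J c i y ∈ M) (N : ℕ) : lenLT J (antiFixed d) N ≤ M := by
  induction N with
  | zero => rw [lenLT_zero]; exact bot_le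
  | succ N ih =>
    refine lenLT_le fun l a ha hl => ?_
    rw [minus_word_mul_K]
    refine Submodule.smul_mem _ _ (hK a ha _ ?_)
    cases l with
    | nil => rwa [word_nil, map_one]
    | cons i l =>
      -- Solve for `F_i F_l`: it equals the value of `starGen` minus a term of smaller length, which
      -- lies in `M` by induction.
      have h := starGen_apply J c i (mE (word k l))
      rw [← sub_eq_iff_eq_add] at h
      rw [word_cons, map_mul, emb_ι, ← h]
      rw [List.length_cons, Nat.add_lt_add_iff_right] at hl
      have hw : ∀ N, l.length < N → mE (word k l) ∈ lenLT J (antiFixed d) N := by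
        intro N hN
        have := word_mul_K_mem_lenLT (J := J) (zero_mem_antiFixed (d := d)) hN
        rwa [K_zero, mul_one] at this
      refine sub_mem (hgen i _ (ih (hw N hl))) (Submodule.smul_mem _ _ (hK _ (tau_sub i) _ (ih ?_)))
      exact CC_mem_lenLT (lenLT_mono (Nat.le_succ N) (hw N hl))

variable (J) in
theorem bosθ_le_of_starGen {M : Submodule k (BMinus J)} (one : 1 ∈ M)
    (hK : ∀ a ∈ antiFixed d, ∀ y ∈ M, mK a * y ∈ M)
    (hgen : ∀ i, ∀ y ∈ M, starGen J c i y ∈ M) : bosθ J ≤ M := by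
  refine Submodule.span_le.mpr ?_
  rintro _ ⟨l, a, ha, rfl⟩
  exact lenLT_le_of_starGen J c one hK hgen (l.length + 1)
    (word_mul_K_mem_lenLT ha (Nat.lt_succ_self _))

theorem one_mem_bosθ : (1 : BMinus J) ∈ bosθ J :=
  lenLT_le_bosθ 1 (one_mem_lenLT zero_mem_antiFixed)

theorem exists_mem_lenLT_of_mem_bosθ {y : BMinus J} (hy : y ∈ bosθ J) :
    ∃ N, y ∈ lenLT J (antiFixed d) N := by
  induction hy using Submodule.span_induction with
  | mem _ h =>
    obtain ⟨l, a, ha, rfl⟩ := h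
    exact ⟨l.length + 1, word_mul_K_mem_lenLT ha (Nat.lt_succ_self _)⟩
  | zero => exact ⟨0, zero_mem _⟩
  | add u v _ _ hu hv =>
    obtain ⟨M, hM⟩ := hu
    obtain ⟨N, hN⟩ := hv
    exact ⟨max M N, add_mem (lenLT_mono (le_max_left _ _) hM) (lenLT_mono (le_max_right _ _) hN)⟩
  | smul c u _ hu =>
    obtain ⟨M, hM⟩ := hu
    exact ⟨M, Submodule.smul_mem _ _ hM⟩

theorem K_mul_mem_bosθ {a : Fin n → ℤ} (ha : a ∈ antiFixed d) {y : BMinus J} (hy : y ∈ bosθ J) :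
    mK a * y ∈ bosθ J := by
  obtain ⟨N, hN⟩ := exists_mem_lenLT_of_mem_bosθ hy
  exact lenLT_le_bosθ N (K_mul_mem_lenLT_antiFixed ha hN)

theorem starGen_mem_lenLT (i : Fin n) {N : ℕ} {y : BMinus J} (hy : y ∈ lenLT J (antiFixed d) N) :
    starGen J c i y ∈ lenLT J (antiFixed d) (N + 1) := by
  rw [starGen_apply]
  refine add_mem (X_mul_mem_lenLT hy) (Submodule.smul_mem _ _ ?_)
  -- The bound is relaxed to `N + 2` so that `CC` lowers it to the required `N + 1`.
  exact K_mul_mem_lenLT_antiFixed (tau_sub i)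
    (CC_mem_lenLT (lenLT_mono (Nat.le_add_right N 2) hy))

theorem starGen_mem_bosθ (i : Fin n) {y : BMinus J} (hy : y ∈ bosθ J) :
    starGen J c i y ∈ bosθ J := by
  obtain ⟨N, hN⟩ := exists_mem_lenLT_of_mem_bosθ hy
  exact lenLT_le_bosθ _ (starGen_mem_lenLT c i hN)

variable (D D' : DualBases d)

theorem starB_mem_bosθ {y z : BMinus J} (hy : y ∈ bosθ J) (hz : z ∈ bosθ J) :
    starB J c D y z ∈ bosθ J := by
  suffices h : bosθ J ≤ (bosθ J).comap ((starB J c D).flip z) from h hy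
  refine bosθ_le_of_starGen J c ?_ ?_ ?_
  · change starB J c D 1 z ∈ bosθ J
    rwa [starB_one_left]
  · intro a ha y hy
    change starB J c D (mK a * y) z ∈ bosθ J
    rw [starB_K_mul J c D ha]
    exact K_mul_mem_bosθ ha hy
  · intro i y hy
    change starB J c D (starGen J c i y) z ∈ bosθ J
    rw [starB_starGen]
    exact starGen_mem_bosθ c i hy

/-- Both sides, as functions of `x`, intertwine the operators `starGen i` and `K_a`, and they agree
at `x = 1`. Only the left factor has to lie in H_θ ⋉ U⁻, the part generated from 1. -/
theorem starB_assoc {x : BMinus J} (hx : x ∈ bosθ J) (y z : BMinus J) :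
    starB J c D (starB J c D x y) z = starB J c D x (starB J c D y z) := by
  suffices h : bosθ J ≤ LinearMap.ker ((starB J c D).flip z ∘ₗ (starB J c D).flip y -
      (starB J c D).flip (starB J c D y z)) from sub_eq_zero.mp (h hx)
  refine bosθ_le_of_starGen J c ?_ ?_ ?_
  · refine sub_eq_zero.mpr ?_
    change starB J c D (starB J c D 1 y) z = starB J c D 1 (starB J c D y z)
    rw [starB_one_left, starB_one_left]
  · intro a ha x hx
    replace hx : starB J c D (starB J c D x y) z = starB J c D x (starB J c D y z) :=
      sub_eq_zero.mp hx
    refine sub_eq_zero.mpr ?_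
    change starB J c D (starB J c D (mK a * x) y) z = starB J c D (mK a * x) (starB J c D y z)
    rw [starB_K_mul J c D ha, starB_K_mul J c D ha, starB_K_mul J c D ha, hx]
  · intro i x hx
    replace hx : starB J c D (starB J c D x y) z = starB J c D x (starB J c D y z) :=
      sub_eq_zero.mp hx
    refine sub_eq_zero.mpr ?_
    change starB J c D (starB J c D (starGen J c i x) y) z =
      starB J c D (starGen J c i x) (starB J c D y z)
    rw [starB_starGen, starB_starGen, starB_starGen, hx]

/-- The twist product does not depend on the choice of dual bases. -/
theorem starB_eq_starB {x : BMinus J} (hx : x ∈ bosθ J) (y : BMinus J) :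
    starB J c D x y = starB J c D' x y := by
  suffices h : bosθ J ≤ LinearMap.ker ((starB J c D).flip y - (starB J c D').flip y) from
    sub_eq_zero.mp (h hx)
  refine bosθ_le_of_starGen J c ?_ ?_ ?_
  · refine sub_eq_zero.mpr ?_
    change starB J c D 1 y = starB J c D' 1 y
    rw [starB_one_left, starB_one_left]
  · intro a ha x hx
    replace hx : starB J c D x y = starB J c D' x y := sub_eq_zero.mp hx
    refine sub_eq_zero.mpr ?_
    change starB J c D (mK a * x) y = starB J c D' (mK a * x) y
    rw [starB_K_mul J c D ha, starB_K_mul J c D' ha, hx]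
  · intro i x hx
    replace hx : starB J c D x y = starB J c D' x y := sub_eq_zero.mp hx
    refine sub_eq_zero.mpr ?_
    change starB J c D (starGen J c i x) y = starB J c D' (starGen J c i x) y
    rw [starB_starGen, starB_starGen, hx]

theorem starB_X (i : Fin n) (y : BMinus J) : starB J c D (mX i) y = starGen J c i y := by
  have : mX i = starGen J c i 1 := by rw [starGen_apply, CC_one]; simp
  rw [this, starB_starGen, starB_one_left]

theorem starB_K {a : Fin n → ℤ} (ha : a ∈ antiFixed d) (y : BMinus J) :
    starB J c D (mK a) y = mK a * y := by
  have := starB_K_mul J c D ha 1 y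
  rwa [mul_one, starB_one_left] at this

theorem starB_mul_K' (y : BMinus J) (a : Fin n → ℤ) : starB J c D y (mK a) = y * mK a := by
  have := starB_mul_K J c D a y 1
  rw [mul_one, starB_one_right] at this
  exact this.symm

theorem word_mul_mem_lenLT {S : Set (Fin n → ℤ)} (l : List (Fin n)) {N : ℕ} {y : BMinus J}
    (hy : y ∈ lenLT J S N) : mE (word k l) * y ∈ lenLT J S (l.length + N) := by
  induction l with
  | nil => simpa [word_nil] using hy
  | cons i l ih =>
    rw [word_cons, map_mul, emb_ι, mul_assoc]
    have := X_mul_mem_lenLT (i := i) ih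
    rwa [List.length_cons, add_right_comm]

/-- Splitting off the first letter writes `F_i F_l ⋆ z` as `F_i (F_l ⋆ z)` plus two corrections, one
with `CC` applied to `F_l ⋆ z` and one with `CC` applied to `F_l`. Each lowers the length. The
second involves words other than `l`, hence the strong induction. Membership with bound `m + 1`
means degree at most `m`. -/
theorem starB_word_sub_mem (l : List (Fin n)) {m : ℕ} {z : BMinus J}
    (hz : z ∈ lenLT J (antiFixed d) (m + 1)) :
    starB J c D (mE (word k l)) z - mE (word k l) * z ∈ lenLT J (antiFixed d) (l.length + m) := by
  induction hN : l.length using Nat.strong_induction_on generalizing l with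
  | _ N ih =>
    subst hN
    have hmem : ∀ l' : List (Fin n), l'.length < l.length →
        starB J c D (mE (word k l')) z ∈ lenLT J (antiFixed d) (l'.length + (m + 1)) := by
      intro l' hl'
      have h1 := lenLT_mono (by omega : l'.length + m ≤ l'.length + (m + 1)) (ih _ hl' l' rfl)
      have h2 := add_mem h1 (word_mul_mem_lenLT l' hz)
      rwa [sub_add_cancel] at h2
    cases l with
    | nil => simp [word_nil, starB_one_left]
    | cons i l =>
      have hl : l.length < (i :: l).length := Nat.lt_succ_self _
      have h := starGen_apply J c i (mE (word k l))
      rw [← sub_eq_iff_eq_add] at h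
      have h1 : mE (word k (i :: l)) = mX i * mE (word k l) := by rw [word_cons, map_mul, emb_ι]
      have h2 : starB J c D (mE (word k (i :: l))) z = starGen J c i (starB J c D (mE (word k l)) z)
          - (c i * d.q i (d.τ i)) • (mK (simpleRoot (d.τ i) - simpleRoot i) *
            starB J c D (CC J (d.τ i) (mE (word k l))) z) := by
        rw [h1, ← h, map_sub, LinearMap.sub_apply, starB_starGen, map_smul, LinearMap.smul_apply,
          starB_K_mul J c D (tau_sub i)]
      have h3 : starB J c D (mE (word k (i :: l))) z - mE (word k (i :: l)) * z =
          mX i * (starB J c D (mE (word k l)) z - mE (word k l) * z) +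
          (c i * d.q i (d.τ i)) • (mK (simpleRoot (d.τ i) - simpleRoot i) *
            CC J (d.τ i) (starB J c D (mE (word k l)) z)) -
          (c i * d.q i (d.τ i)) • (mK (simpleRoot (d.τ i) - simpleRoot i) *
            starB J c D (CC J (d.τ i) (mE (word k l))) z) := by
        rw [h2, h1, starGen_apply, mul_sub, mul_assoc]
        abel
      rw [h3, List.length_cons]
      refine sub_mem (add_mem ?_ ?_) ?_
      · have := X_mul_mem_lenLT (i := i) (ih _ hl l rfl)
        rwa [add_right_comm]
      · refine Submodule.smul_mem _ _ (K_mul_mem_lenLT_antiFixed (tau_sub i) (CC_mem_lenLT ?_))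
        exact lenLT_mono (by omega) (hmem l hl)
      · refine Submodule.smul_mem _ _ (K_mul_mem_lenLT_antiFixed (tau_sub i) ?_)
        rw [CC_emb]
        have hd := dL_word_mem d (d.τ i) l
        generalize dL d (d.τ i) (word k l) = u at hd ⊢
        induction hd using Submodule.span_induction with
        | mem _ h =>
          obtain ⟨l', hl', rfl⟩ := h
          have := hl'.length_eq
          rw [List.length_cons] at this
          exact lenLT_mono (by omega) (hmem l' (by rw [List.length_cons]; omega))
        | zero => simp
        | add u v _ _ hu hv => rw [map_add, map_add, LinearMap.add_apply]; exact add_mem hu hv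
        | smul r u _ hu =>
          rw [map_smul, map_smul, LinearMap.smul_apply]; exact Submodule.smul_mem _ _ hu

end StarProduct

/-! ### Subspaces with prescribed group-like weights -/

section WeightSpan

open Borel

variable {k : Type*} [Field k] {n : ℕ} {d : Datum k n} {J : PreNicholsIdeal d}

local notation "mX" => Borel.X (minusScalar d) J
local notation "mK" => Borel.K (minusScalar d) J
local notation "mE" => Borel.emb (minusScalar d) J
local notation "mP" => Borel.ofPre (minusScalar d) J

variable {S T : Set (Fin n → ℤ)}

theorem word_mul_K_mem_wtSpan (l : List (Fin n)) {a : Fin n → ℤ} (ha : a ∈ S) :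
    mE (word k l) * mK a ∈ wtSpan J S := Submodule.subset_span ⟨l, a, ha, rfl⟩

theorem wtSpan_le {M : Submodule k (BMinus J)}
    (h : ∀ l : List (Fin n), ∀ a ∈ S, mE (word k l) * mK a ∈ M) : wtSpan J S ≤ M := by
  refine Submodule.span_le.mpr ?_
  rintro _ ⟨l, a, ha, rfl⟩
  exact h l a ha

theorem emb_mul_K_mem_wtSpan (u : Tens k n) {a : Fin n → ℤ} (ha : a ∈ S) :
    mE u * mK a ∈ wtSpan J S := by
  have hu : u ∈ Submodule.span k (Set.range (word k (n := n))) := by rw [span_words]; trivial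
  induction hu using Submodule.span_induction with
  | mem _ h => obtain ⟨l, rfl⟩ := h; exact word_mul_K_mem_wtSpan l ha
  | zero => simp
  | add u v _ _ hu hv => rw [map_add, add_mul]; exact add_mem hu hv
  | smul c u _ hu => rw [map_smul, smul_mul_assoc]; exact Submodule.smul_mem _ _ hu

theorem X_mul_mem_wtSpan (i : Fin n) {y : BMinus J} (hy : y ∈ wtSpan J S) :
    mX i * y ∈ wtSpan J S := by
  suffices h : wtSpan J S ≤ (wtSpan J S).comap (LinearMap.mulLeft k (mX i)) from h hy
  refine wtSpan_le fun l a ha => ?_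
  change mX i * _ ∈ wtSpan J S
  rw [← mul_assoc, ← emb_ι, ← map_mul]
  exact emb_mul_K_mem_wtSpan _ ha

theorem K_mul_mem_wtSpan {b : Fin n → ℤ} (hb : ∀ a ∈ S, b + a ∈ T) {y : BMinus J}
    (hy : y ∈ wtSpan J S) : mK b * y ∈ wtSpan J T := by
  suffices h : wtSpan J S ≤ (wtSpan J T).comap (LinearMap.mulLeft k (mK b)) from h hy
  refine wtSpan_le fun l a ha => ?_
  change mK b * _ ∈ wtSpan J T
  rw [← mul_assoc, minus_K_mul_word, smul_mul_assoc, mul_assoc, ← K_add]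
  exact Submodule.smul_mem _ _ (word_mul_K_mem_wtSpan l (hb a ha))

theorem CC_mem_wtSpan (i : Fin n) {y : BMinus J} (hy : y ∈ wtSpan J S) :
    CC J i y ∈ wtSpan J S := by
  suffices h : wtSpan J S ≤ (wtSpan J S).comap (CC J i) from h hy
  refine wtSpan_le fun l a ha => ?_
  change CC J i _ ∈ wtSpan J S
  rw [CC_mul_K, CC_emb]
  exact emb_mul_K_mem_wtSpan _ ha

theorem RR_mem_wtSpan (i : Fin n) (hb : ∀ a ∈ S, -simpleRoot i + a ∈ T) {y : BMinus J}
    (hy : y ∈ wtSpan J S) : RR J i y ∈ wtSpan J T := by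
  suffices h : wtSpan J S ≤ (wtSpan J T).comap (RR J i) from h hy
  refine wtSpan_le fun l a ha => ?_
  change RR J i _ ∈ wtSpan J T
  rw [RR_mul_K, RR_emb, mul_assoc, ← K_add]
  exact emb_mul_K_mem_wtSpan _ (hb a ha)

theorem coeff_eq_zero_of_mem_wtSpan {a : Fin n → ℤ} (ha : a ∉ S) {y : BMinus J}
    (hy : y ∈ wtSpan J S) : coeff J a y = 0 := by
  suffices h : wtSpan J S ≤ LinearMap.ker (coeff J a) from h hy
  refine wtSpan_le fun l b hb => ?_
  rw [LinearMap.mem_ker, coeff_emb_mul_K, if_neg]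
  rintro rfl
  exact ha hb

theorem eq_zero_of_mem_wtSpan (hST : Disjoint S T) {y : BMinus J} (hS : y ∈ wtSpan J S)
    (hT : y ∈ wtSpan J T) : y = 0 := by
  refine eq_zero_of_coeff J fun a => ?_
  by_cases ha : a ∈ S
  · exact coeff_eq_zero_of_mem_wtSpan (Set.disjoint_left.mp hST ha) hT
  · exact coeff_eq_zero_of_mem_wtSpan ha hS

theorem K_mul_ofPre (a : Fin n → ℤ) (f : Pre J) : mK a * mP f = mP (preTheta J a f) * mK a := by
  induction f using Pre.induction with
  | zero => simp
  | one => simp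
  | x_mul i u hu =>
    have hx : mP (Pre.x J i) = mX i := by rw [← Pre.mk_ι, ofPre_mk, emb_ι]
    rw [map_mul, map_mul, preTheta_x, map_mul, map_smul, hx, ← mul_assoc, K_mul_X, smul_mul_assoc,
      mul_assoc, hu, smul_mul_assoc, smul_mul_assoc, mul_assoc]
  | add u v hu hv => simp only [map_add, mul_add, add_mul, hu, hv]
  | smul c u hu => simp only [map_smul, mul_smul_comm, smul_mul_assoc, hu]

end WeightSpan

/-! ### The grading of H ⋉ U⁻ by length -/

section Degree

open Borel Polynomial

variable {k : Type*} [Field k] {n : ℕ} {d : Datum k n} (J : PreNicholsIdeal d)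

local notation "mX" => Borel.X (minusScalar d) J
local notation "mK" => Borel.K (minusScalar d) J
local notation "mE" => Borel.emb (minusScalar d) J

/-- The homomorphism that encodes the grading of `H ⋉ U⁻` with `deg K_a = 0` and `deg F_i = 1`. -/
noncomputable def degHom : BMinus J →ₐ[k] (BMinus J)[X] :=
  Borel.lift _ J (fun i => Polynomial.X * C (mX i)) (fun a => C (mK a))
    (by rw [K_zero, map_one])
    (by intro a b; rw [K_add, map_mul])
    (by
      intro a i
      rw [← mul_assoc, ← X_mul, mul_assoc, mul_assoc, ← map_mul, K_mul_X, ← map_mul,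
        ← Polynomial.smul_C, mul_smul_comm])
    (by
      intro p hp
      refine lift_mul_eq_zero J.biideal (fun _ => Polynomial.X) (fun i => C (mX i))
        (fun _ _ => 1) (fun _ _ => rfl) (by simp [X_mul]) (by simp) (fun p hp => ?_) hp
      have h : FreeAlgebra.lift k (fun i => C (mX i)) =
          (CAlgHom (R := k) (A := BMinus J)).comp (FreeAlgebra.lift k mX) := by
        ext i
        simp
      rw [h, AlgHom.comp_apply, lift_X _ _ hp, map_zero])

theorem degHom_word_mul_K (l : List (Fin n)) (a : Fin n → ℤ) :
    degHom J (mE (word k l) * mK a) = Polynomial.X ^ l.length * C (mE (word k l) * mK a) := by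
  induction l with
  | nil => simp [word_nil, degHom]
  | cons i l ih =>
    rw [word_cons, map_mul (Borel.emb _ J), emb_ι, mul_assoc, map_mul (degHom J), ih, List.length_cons, pow_succ']
    have hx : degHom J (mX i) = Polynomial.X * C (mX i) := by simp [degHom]
    rw [hx, map_mul C (mX i), mul_assoc, mul_assoc, ← mul_assoc (C (mX i)),
      ← X_pow_mul (p := C (mX i)), mul_assoc]

/-- The component of degree `m` of an element of `H ⋉ U⁻`. -/
noncomputable def degComp (m : ℕ) : BMinus J →ₗ[k] BMinus J :=
  (Polynomial.lcoeff (BMinus J) m).restrictScalars k ∘ₗ (degHom J).toLinearMap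

theorem degComp_word_mul_K (m : ℕ) (l : List (Fin n)) (a : Fin n → ℤ) :
    degComp J m (mE (word k l) * mK a) = if l.length = m then mE (word k l) * mK a else 0 := by
  simp only [degComp, LinearMap.comp_apply, AlgHom.toLinearMap_apply, degHom_word_mul_K,
    LinearMap.restrictScalars_apply, Polynomial.lcoeff_apply, coeff_X_pow_mul', coeff_C]
  split_ifs with h1 h2 h3
  · rfl
  · omega
  · omega
  · rfl
  · omega
  · rfl

theorem degComp_eq_zero {S : Set (Fin n → ℤ)} {m : ℕ} {y : BMinus J} (hy : y ∈ lenLT J S m) :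
    degComp J m y = 0 := by
  suffices h : lenLT J S m ≤ LinearMap.ker (degComp J m) from h hy
  refine lenLT_le fun l a _ hl => ?_
  rw [LinearMap.mem_ker, degComp_word_mul_K, if_neg hl.ne]

end Degree

/-! ### A Verma-type representation of U(χ) -/

section Verma

open Borel

variable {k : Type*} [Field k] {n : ℕ} {d : Datum k n} (J : PreNicholsIdeal d)

local notation "mX" => Borel.X (minusScalar d) J
local notation "mK" => Borel.K (minusScalar d) J
local notation "mE" => Borel.emb (minusScalar d) J
local notation "mP" => Borel.ofPre (minusScalar d) J

/-- The operators `LL_i = K_i CC_i` and `-RR_i` satisfy the relations separately, since `J` lies in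
the maximal biideal, and they q-commute by `LL_RR`; hence so does their sum. -/
theorem lift_LL_sub_RR {p : Tens k n} (hp : p ∈ J.carrier) :
    FreeAlgebra.lift k (fun i => LL J i - RR J i) p = 0 := by
  have hRR : ∀ p ∈ J.carrier, FreeAlgebra.lift k (fun i => -RR J i) p = 0 := by
    intro p hp
    have := lift_mul_eq_zero J.biideal (fun _ => (-1 : Module.End k (BMinus J))) (RR J)
      (fun _ _ => 1) (fun _ _ => rfl) (fun _ _ => LinearMap.ext fun y => by simp)
      (fun _ _ => rfl) (fun p hp => lift_RR_of_mem_max J (J.le_max hp)) hp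
    have h : (fun i => -RR J i) = fun i => -1 * RR J i :=
      funext fun i => LinearMap.ext fun y => by simp
    rwa [h]
  have hLL : ∀ p ∈ J.carrier, FreeAlgebra.lift k (LL J) p = 0 := by
    intro p hp
    have := lift_mul_eq_zero J.biideal (fun i => LinearMap.mulLeft k (mK (simpleRoot i))) (CC J)
      (fun i j => (d.q i j)⁻¹) (fun i j => by rw [d.q_symm])
      (fun i j => LinearMap.ext fun y => by
        simp [CC_K_mul, d.chi_simple, d.q_symm j i])
      (fun i j => LinearMap.ext fun y => by
        simp only [Module.End.mul_apply, LinearMap.mulLeft_apply]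
        rw [← mul_assoc, K_comm, mul_assoc])
      (fun p hp => lift_CC_of_mem_max J (J.le_max hp)) hp
    have h : LL J = fun i => LinearMap.mulLeft k (mK (simpleRoot i)) * CC J i := by
      funext i
      exact LinearMap.ext fun y => LL_eq J i y
    rwa [h]
  have := lift_add_eq_zero J.biideal (fun i => -RR J i) (LL J)
    (fun i j => LinearMap.ext fun y => by simp [LL_RR]) hRR hLL hp
  simpa [neg_add_eq_sub] using this

/-- The Verma-type representation of `U(χ)` on `H ⋉ U⁻`. -/
def verma : Double J →ₐ[k] Module.End k (BMinus J) :=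
  Presented.lift (FreeAlgebra.lift k fun
      | .E i => LL J i - RR J i
      | .F i => LinearMap.mulLeft k (mX i)
      | .K a => LinearMap.mulLeft k (mK a)) (by
    rintro _ _ (_ | ⟨a, b⟩ | ⟨a, i⟩ | ⟨a, i⟩ | ⟨i, j⟩ | ⟨p, hp⟩ | ⟨p, hp⟩)
    · refine LinearMap.ext fun y => ?_
      simp [K_zero]
    · refine LinearMap.ext fun y => ?_
      simp [K_add]
    · refine LinearMap.ext fun y => ?_
      simp [LL_K_mul, RR_K_mul, d.plusScalar_eq, mul_sub, smul_sub, smul_smul, d.chi_ne_zero]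
    · refine LinearMap.ext fun y => ?_
      have h : mK a * (mX i * y) = minusScalar d a i • (mX i * (mK a * y)) := by
        rw [← mul_assoc, K_mul_X, smul_mul_assoc, mul_assoc]
      simp [h]
    · refine LinearMap.ext fun y => ?_
      by_cases h : i = j
      · subst h
        simp [LL_X_mul, RR_X_mul, mul_sub]
        abel
      · simp [LL_X_mul, RR_X_mul, mul_sub, h]
    · rw [map_zero, ← lift_LL_sub_RR J hp, ← AlgHom.comp_apply]
      congr 1
      ext i
      simp
    · have h : (FreeAlgebra.lift k (fun
          | .E i => LL J i - RR J i
          | .F i => LinearMap.mulLeft k (mX i)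
          | .K a => LinearMap.mulLeft k (mK a))).comp
          (FreeAlgebra.lift k (fun i => FreeAlgebra.ι k (DoubleGen.F i))) =
          (Algebra.lmul k (BMinus J)).comp (FreeAlgebra.lift k mX) := by
        ext i
        simp
      rw [map_zero, ← AlgHom.comp_apply, h, AlgHom.comp_apply, lift_X _ _ hp, map_zero])

@[simp] theorem verma_E (i : Fin n) : verma J (Double.E J i) = LL J i - RR J i := by
  simp [verma, Double.E, Presented.lift_mk]

@[simp] theorem verma_F (i : Fin n) : verma J (Double.F J i) = LinearMap.mulLeft k (mX i) := by
  simp [verma, Double.F, Presented.lift_mk]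

@[simp] theorem verma_K (a : Fin n → ℤ) : verma J (Double.K J a) = LinearMap.mulLeft k (mK a) := by
  simp [verma, Double.K, Presented.lift_mk]

@[simp] theorem ofBMinus_X (i : Fin n) : Double.ofBMinus J (mX i) = Double.F J i := by
  simp [Double.ofBMinus]

@[simp] theorem ofBMinus_K (a : Fin n → ℤ) : Double.ofBMinus J (mK a) = Double.K J a := by
  simp [Double.ofBMinus]

theorem verma_ofBMinus (y z : BMinus J) : verma J (Double.ofBMinus J y) z = y * z := by
  have : (verma J).comp (Double.ofBMinus J) = Algebra.lmul k (BMinus J) :=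
    hom_ext (by intro i; ext z; simp) (by intro i; ext z; simp)
  exact congrArg (fun f => f y z) this

/-- Acting on 1 recovers the element of H ⋉ U⁻. -/
theorem ofBMinus_injective : Function.Injective (Double.ofBMinus J) := by
  intro y z h
  have := congrArg (fun x => verma J x 1) h
  simpa [verma_ofBMinus] using this

theorem double_K_add (a b : Fin n → ℤ) : Double.K J (a + b) = Double.K J a * Double.K J b := by
  rw [← ofBMinus_K, K_add, map_mul, ofBMinus_K, ofBMinus_K]

theorem double_K_zero : Double.K J 0 = 1 := by
  rw [← ofBMinus_K, K_zero, map_one]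

theorem double_K_mul_E (a : Fin n → ℤ) (i : Fin n) : Double.K J a * Double.E J i =
    d.chi a (simpleRoot i) • (Double.E J i * Double.K J a) := by
  rw [Double.K, Double.E, ← map_mul, Presented.mk_rel (DoubleRel.K_E a i), map_smul, map_mul]
  rfl

theorem double_E_mul_F (i j : Fin n) : Double.E J i * Double.F J j =
    Double.F J j * Double.E J i +
      if i = j then Double.K J (simpleRoot i) - Double.K J (-simpleRoot i) else 0 := by
  rw [← sub_eq_iff_eq_add', Double.E, Double.F, ← map_mul, ← map_mul, ← map_sub,
    Presented.mk_rel (DoubleRel.E_F i j)]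
  split_ifs
  · rw [map_sub]; rfl
  · rw [map_zero]

theorem double_E_mul_K (a : Fin n → ℤ) (i : Fin n) : Double.E J i * Double.K J a =
    (d.chi a (simpleRoot i))⁻¹ • (Double.K J a * Double.E J i) := by
  rw [double_K_mul_E, smul_smul, inv_mul_cancel₀ (d.chi_ne_zero _ _), one_smul]

/-- The commutation relation of `E_i` with `H ⋉ U⁻`. -/
theorem double_E_mul (i : Fin n) (y : BMinus J) : Double.E J i * Double.ofBMinus J y =
    Double.ofBMinus J (eta J (simpleRoot i) y) * Double.E J i + Double.ofBMinus J (LL J i y) -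
      Double.ofBMinus J (RR J i y) := by
  induction y using Borel.induction with
  | zero => simp
  | one => simp [LL_one, RR_one]
  | X_mul j u hu =>
    rw [map_mul, ofBMinus_X, ← mul_assoc, double_E_mul_F, add_mul, mul_assoc, hu, map_mul, eta_X,
      map_mul, ofBMinus_X, LL_X_mul, RR_X_mul]
    split_ifs
    · simp only [map_add, map_mul, ofBMinus_X, ofBMinus_K, mul_add, mul_sub, sub_mul, mul_assoc]
      abel
    · simp only [map_mul, ofBMinus_X, mul_add, mul_sub, zero_mul, add_zero,
        mul_assoc]
  | K_mul a u hu =>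
    rw [map_mul, ofBMinus_K, ← mul_assoc, double_E_mul_K, smul_mul_assoc, mul_assoc, hu, map_mul,
      eta_K, LL_K_mul, RR_K_mul, d.chi_comm a]
    simp only [map_smul, map_mul, ofBMinus_K, mul_add, mul_sub, smul_add, smul_sub, smul_mul_assoc,
      mul_assoc]
  | add u v hu hv => simp only [map_add, hu, hv, mul_add, add_mul]; abel
  | smul c u hu => simp only [map_smul, hu, mul_smul_comm, smul_mul_assoc, smul_add, smul_sub]

theorem eta_ofPre (a : Fin n → ℤ) (f : Pre J) : eta J a (mP f) = mP f := by
  obtain ⟨u, rfl⟩ := Pre.mk_surjective J f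
  rw [ofPre_mk]
  have : (eta J a).comp (Borel.emb (minusScalar d) J) = Borel.emb (minusScalar d) J := by
    ext i
    simp
  exact congrArg (fun f => f u) this

theorem isSkewDerivations_preD : Double.IsSkewDerivations J (preDL J, preDR J) := by
  intro i f
  simp only [Double.ofUMinus, AlgHom.comp_apply]
  rw [double_E_mul, eta_ofPre, LL_eq, CC_ofPre, RR_ofPre, map_mul, map_mul, ofBMinus_K, ofBMinus_K]
  abel

theorem ofPre_injective : Function.Injective mP := by
  intro f g h
  rw [← coeff_ofPre J f, h, coeff_ofPre]

/-- As `α_i ≠ -α_i`, the two terms of the commutator belong to different group-like elements and can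
be read off as coefficients. -/
theorem Double.IsSkewDerivations.eq {δ : (Fin n → Pre J →ₗ[k] Pre J) × (Fin n → Pre J →ₗ[k] Pre J)}
    (h : Double.IsSkewDerivations J δ) : δ = (preDL J, preDR J) := by
  have key : ∀ i f, δ.1 i f = preDL J i f ∧ δ.2 i f = preDR J i f := by
    intro i f
    have h1 := (h i f).symm.trans (isSkewDerivations_preD J i f)
    simp only [Double.ofUMinus, AlgHom.comp_apply, ← ofBMinus_K, ← map_mul, ← map_sub] at h1
    have h2 := ofBMinus_injective J h1
    have hne : simpleRoot i ≠ -simpleRoot i := by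
      intro h
      have := congrFun h i
      simp [simpleRoot] at this
    have hR : δ.2 i f = preDR J i f := by
      have := congrArg (coeff J (-simpleRoot i)) h2
      simpa [K_mul_ofPre, coeff_ofPre_mul_K, hne.symm] using this
    refine ⟨?_, hR⟩
    rw [hR, sub_left_inj] at h2
    have h3 := congrArg (fun y => mK (-simpleRoot i) * y) h2
    simp only [← mul_assoc, K_neg_mul_K, one_mul] at h3
    exact ofPre_injective J h3
  exact Prod.ext (funext fun i => LinearMap.ext fun f => (key i f).1)
    (funext fun i => LinearMap.ext fun f => (key i f).2)

end Verma

/-! ### The partial bosonization and its star product -/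

section PartialBos

open Borel

variable {k : Type*} [Field k] {n : ℕ} {d : Datum k n} (J : PreNicholsIdeal d)

local notation "mX" => Borel.X (minusScalar d) J
local notation "mK" => Borel.K (minusScalar d) J
local notation "mE" => Borel.emb (minusScalar d) J
local notation "mP" => Borel.ofPre (minusScalar d) J
local notation "oB" => Double.ofBMinus J

theorem sub_tau_mem_antiFixed (i : Fin n) :
    simpleRoot i - simpleRoot (d.τ i) ∈ antiFixed d := by
  change d.tau _ = _
  rw [sub_eq_add_neg, d.tau_add, d.tau_neg, d.tau_simple, d.tau_simple, d.τ_involutive]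
  abel

theorem antiFixed_le_closure {a : Fin n → ℤ} (ha : a ∈ antiFixed d) :
    a ∈ AddSubgroup.closure (Set.range fun i => simpleRoot i - simpleRoot (d.τ i)) := by
  -- Each two-element orbit of `τ` contributes once, through its smaller element; at a fixed point
  -- `a_i = -a_i` forces `a_i = 0`.
  have h : a = ∑ i, (if i < d.τ i then a i else 0) • (simpleRoot i - simpleRoot (d.τ i)) := by
    funext j
    have hj : a (d.τ j) = -a j := congrFun ha j
    have h1 : ∀ i, (simpleRoot (d.τ i) : Fin n → ℤ) j = if d.τ j = i then 1 else 0 := by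
      intro i
      simp only [simpleRoot, Pi.single_apply]
      congr 1
      exact propext ⟨fun h => by rw [h, d.τ_involutive], fun h => by rw [← h, d.τ_involutive]⟩
    simp only [Finset.sum_apply, Pi.smul_apply, Pi.sub_apply, h1, smul_eq_mul, mul_sub,
      Finset.sum_sub_distrib]
    simp only [simpleRoot, Pi.single_apply, mul_ite, mul_one, mul_zero, Finset.sum_ite_eq,
      Finset.mem_univ, if_true, d.τ_involutive, hj]
    rcases lt_trichotomy j (d.τ j) with h | h | h
    · simp [h, h.le.not_gt]
    · rw [← h] at hj
      rw [← h]
      simp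
      omega
    · simp [h, h.le.not_gt]
  rw [h]
  exact sum_mem fun i _ => AddSubgroup.zsmul_mem _ (AddSubgroup.subset_closure (Set.mem_range_self i)) _

theorem K_mem_Hθ {a : Fin n → ℤ} (ha : a ∈ antiFixed d) : Double.K J a ∈ Double.Hθ J := by
  -- A subalgebra need not contain inverses, so they are carried through the induction; the inverse
  -- of the generator for `i` is the generator for `τ(i)`.
  suffices h : Double.K J a ∈ Double.Hθ J ∧ Double.K J (-a) ∈ Double.Hθ J from h.1
  have hgen : ∀ i, Double.K J (simpleRoot i - simpleRoot (d.τ i)) ∈ Double.Hθ J :=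
    fun i => Algebra.subset_adjoin ⟨i, rfl⟩
  have ha' := antiFixed_le_closure ha
  clear ha
  induction ha' using AddSubgroup.closure_induction with
  | mem x hx =>
    obtain ⟨i, rfl⟩ := hx
    refine ⟨hgen i, ?_⟩
    have := hgen (d.τ i)
    rwa [d.τ_involutive, ← neg_sub] at this
  | zero => rw [neg_zero, double_K_zero]; exact ⟨one_mem _, one_mem _⟩
  | add a b _ _ ha hb =>
    rw [neg_add, double_K_add, double_K_add]
    exact ⟨mul_mem ha.1 hb.1, mul_mem ha.2 hb.2⟩
  | neg a _ ha => rw [neg_neg]; exact ha.symm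

variable {J} in
theorem bosθ_mul_mem {y z : BMinus J} (hy : y ∈ bosθ J) (hz : z ∈ bosθ J) : y * z ∈ bosθ J := by
  suffices h : bosθ J ≤ (bosθ J).comap (LinearMap.mulRight k z) from h hy
  refine wtSpan_le fun l a ha => ?_
  change mE (word k l) * mK a * z ∈ bosθ J
  rw [mul_assoc]
  have hKz := K_mul_mem_bosθ ha hz
  generalize mK a * z = w at hKz
  induction l with
  | nil => rwa [word_nil, map_one, one_mul]
  | cons i l ih =>
    rw [word_cons, map_mul, emb_ι, mul_assoc]
    exact X_mul_mem_wtSpan i ih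

/-- The span of the `K_a` with `τ(a) = -a`, as a subalgebra of `U(χ)`. -/
def spanK : Subalgebra k (Double J) :=
  Submodule.toSubalgebra (Submodule.span k (Double.K J '' antiFixed d))
    (Submodule.subset_span ⟨0, zero_mem_antiFixed, double_K_zero J⟩)
    (by
      intro x y hx hy
      have := Submodule.mul_mem_mul hx hy
      rw [Submodule.span_mul_span] at this
      refine Submodule.span_mono ?_ this
      rintro _ ⟨_, ⟨a, ha, rfl⟩, _, ⟨b, hb, rfl⟩, rfl⟩
      exact ⟨a + b, add_mem_antiFixed ha hb, double_K_add J a b⟩)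

theorem Hθ_le_spanK : Double.Hθ J ≤ spanK J := by
  refine Algebra.adjoin_le ?_
  rintro _ ⟨i, rfl⟩
  exact Submodule.subset_span ⟨_, sub_tau_mem_antiFixed i, rfl⟩

theorem Hθ_induction {p : Double J → Prop} (zero : p 0)
    (K : ∀ a ∈ antiFixed d, p (Double.K J a)) (add : ∀ x y, p x → p y → p (x + y))
    (smul : ∀ (r : k) x, p x → p (r • x)) {h : Double J} (hh : h ∈ Double.Hθ J) : p h := by
  have := Hθ_le_spanK J hh
  change h ∈ Submodule.span k _ at this
  clear hh
  induction this using Submodule.span_induction with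
  | mem _ h => obtain ⟨a, ha, rfl⟩ := h; exact K a ha
  | zero => exact zero
  | add x y _ _ hx hy => exact add x y hx hy
  | smul r x _ hx => exact smul r x hx

/-- The image of `H_θ ⋉ U⁻` in `U(χ)`. -/
def bosθAlg : Subalgebra k (Double J) :=
  (Submodule.toSubalgebra (bosθ J) one_mem_bosθ fun _ _ => bosθ_mul_mem).map oB

theorem ofBMinus_word (l : List (Fin n)) : oB (mE (word k l)) = Double.Fword J l := by
  induction l with
  | nil => simp [word_nil, Double.Fword]
  | cons i l ih => simp [word_cons, Double.Fword, ih]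

theorem F_mem_partialBos (i : Fin n) : Double.F J i ∈ Double.partialBos J :=
  Algebra.subset_adjoin (Or.inr ⟨i, rfl⟩)

theorem Fword_mem_partialBos (l : List (Fin n)) : Double.Fword J l ∈ Double.partialBos J := by
  induction l with
  | nil => exact one_mem _
  | cons i l ih => exact mul_mem (F_mem_partialBos J i) ih

theorem Hθ_le_partialBos : Double.Hθ J ≤ Double.partialBos J :=
  fun _ hx => Algebra.subset_adjoin (Or.inl hx)

theorem partialBos_eq : Double.partialBos J = bosθAlg J := by
  refine le_antisymm (Algebra.adjoin_le ?_) ?_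
  · rintro _ (hx | ⟨i, rfl⟩)
    · refine Hθ_induction J (p := fun x => x ∈ bosθAlg J) (zero_mem _) (fun a ha => ?_)
        (fun _ _ => add_mem) (fun r _ h => Subalgebra.smul_mem _ h r) hx
      refine ⟨mK a, ?_, by simp⟩
      have := K_mul_mem_bosθ ha (one_mem_bosθ (J := J))
      rwa [mul_one] at this
    · refine ⟨mX i, ?_, by simp⟩
      have := X_mul_mem_wtSpan i (one_mem_bosθ (J := J))
      rwa [mul_one] at this
  · rintro _ ⟨y, hy, rfl⟩
    suffices h : bosθ J ≤ (Subalgebra.toSubmodule (Double.partialBos J)).comap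
      (oB).toLinearMap from h hy
    refine wtSpan_le fun l a ha => ?_
    change oB _ ∈ Double.partialBos J
    rw [map_mul, ofBMinus_word, ofBMinus_K]
    exact mul_mem (Fword_mem_partialBos J l) (Hθ_le_partialBos J (K_mem_Hθ J ha))

theorem ofBMinus_mem_partialBos {y : BMinus J} (hy : y ∈ bosθ J) : oB y ∈ Double.partialBos J := by
  rw [partialBos_eq]; exact ⟨y, hy, rfl⟩

/-- The element of `H ⋉ U⁻` given by an element of its subalgebra `H_θ ⋉ U⁻` inside `U(χ)`. -/
def toBMinus : Double.partialBos J →ₗ[k] BMinus J :=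
  LinearMap.applyₗ 1 ∘ₗ (verma J).toLinearMap ∘ₗ (Double.partialBos J).val.toLinearMap

variable {J}

theorem toBMinus_eq {x : Double.partialBos J} {y : BMinus J} (h : (x : Double J) = oB y) :
    toBMinus J x = y := by
  change verma J (x : Double J) 1 = y
  rw [h, verma_ofBMinus, mul_one]

theorem toBMinus_mem (x : Double.partialBos J) : toBMinus J x ∈ bosθ J := by
  obtain ⟨y, hy, h⟩ : (x : Double J) ∈ bosθAlg J := by rw [← partialBos_eq]; exact x.2
  rwa [toBMinus_eq h.symm]

@[simp] theorem ofBMinus_toBMinus (x : Double.partialBos J) : oB (toBMinus J x) = x := by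
  obtain ⟨y, hy, h⟩ : (x : Double J) ∈ bosθAlg J := by rw [← partialBos_eq]; exact x.2
  rw [toBMinus_eq h.symm, ← h]
  rfl

variable (J)

/-- The linear map to `H_θ ⋉ U⁻` that sends elements of `H ⋉ U⁻` to themselves. -/
def ofBosθ : bosθ J →ₗ[k] Double.partialBos J :=
  LinearMap.codRestrict (Subalgebra.toSubmodule (Double.partialBos J))
    ((oB).toLinearMap ∘ₗ (bosθ J).subtype) fun y => ofBMinus_mem_partialBos J y.2

theorem toBMinus_ofBosθ (y : bosθ J) : toBMinus J (ofBosθ J y) = y := toBMinus_eq rfl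

theorem toBMinus_mul (x y : Double.partialBos J) :
    toBMinus J (x * y) = toBMinus J x * toBMinus J y :=
  toBMinus_eq (by rw [map_mul, ofBMinus_toBMinus, ofBMinus_toBMinus]; rfl)

theorem toBMinus_injective : Function.Injective (toBMinus J) := by
  intro x y h
  refine Subtype.ext ?_
  rw [← ofBMinus_toBMinus x, h, ofBMinus_toBMinus]

theorem grade_le {m : ℕ} {M : Submodule k (Double.partialBos J)}
    (h : ∀ a ∈ antiFixed d, ∀ l : List (Fin n), l.length = m → ∀ x : Double.partialBos J,
      toBMinus J x = mK a * mE (word k l) → x ∈ M) : Double.grade J m ≤ M := by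
  refine Submodule.span_le.mpr ?_
  rintro x ⟨g, hg, l, hl, hx⟩
  have key : verma J (g * Double.Fword J l) 1 ∈ M.map (toBMinus J) := by
    refine Hθ_induction J (p := fun g => verma J (g * Double.Fword J l) 1 ∈ M.map (toBMinus J))
      ?_ ?_ ?_ ?_ hg
    · rw [zero_mul, map_zero]
      exact zero_mem _
    · intro a ha
      let y : Double.partialBos J :=
        ⟨_, Hθ_le_partialBos J (K_mem_Hθ J ha)⟩ * ⟨_, Fword_mem_partialBos J l⟩
      refine ⟨y, h a ha l hl y (toBMinus_eq ?_), rfl⟩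
      rw [map_mul, ofBMinus_word, ofBMinus_K]
      rfl
    · intro x y hx hy
      rw [add_mul, map_add]
      exact add_mem hx hy
    · intro r x hx
      rw [smul_mul_assoc, map_smul]
      exact Submodule.smul_mem _ _ hx
  rw [← hx] at key
  obtain ⟨y, hy, hxy⟩ := key
  rwa [← toBMinus_injective J hxy]

theorem mem_grade {a : Fin n → ℤ} (ha : a ∈ antiFixed d) (l : List (Fin n))
    {x : Double.partialBos J} (hx : toBMinus J x = mK a * mE (word k l)) :
    x ∈ Double.grade J l.length := by
  refine Submodule.subset_span ⟨_, K_mem_Hθ J ha, l, rfl, ?_⟩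
  rw [← ofBMinus_toBMinus x, hx, map_mul, ofBMinus_K, ofBMinus_word]

theorem mem_iSup_grade {N : ℕ} {x : Double.partialBos J}
    (hx : toBMinus J x ∈ lenLT J (antiFixed d) N) : x ∈ ⨆ j < N, Double.grade J j := by
  suffices h : lenLT J (antiFixed d) N ≤ (⨆ j < N, Double.grade J j).map (toBMinus J) by
    obtain ⟨y, hy, hxy⟩ := h hx
    rwa [← toBMinus_injective J hxy]
  refine lenLT_le fun l a ha hl => ?_
  rw [minus_word_mul_K]
  refine Submodule.smul_mem _ _ ?_
  have hm : mK a * mE (word k l) ∈ bosθ J := by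
    have := K_mul_mem_bosθ ha (word_mul_K_mem_wtSpan (J := J) l (zero_mem_antiFixed (d := d)))
    rwa [K_zero, mul_one] at this
  refine ⟨ofBosθ J ⟨_, hm⟩, ?_, toBMinus_ofBosθ J _⟩
  exact Submodule.mem_iSup_of_mem l.length (Submodule.mem_iSup_of_mem hl
    (mem_grade J ha l (toBMinus_ofBosθ J _)))

variable (c : Fin n → k) (D : DualBases d)

/-- The twist product on `H_θ ⋉ U⁻`. -/
noncomputable def starA : Double.partialBos J →ₗ[k] Double.partialBos J →ₗ[k] Double.partialBos J :=
  LinearMap.mk₂ k (fun x y => ofBosθ J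
      ⟨starB J c D (toBMinus J x) (toBMinus J y),
        starB_mem_bosθ c D (toBMinus_mem x) (toBMinus_mem y)⟩)
    (fun x y z => by
      rw [← map_add]; congr 1; exact Subtype.ext (by simp))
    (fun r x z => by
      rw [← map_smul]; congr 1; exact Subtype.ext (by simp))
    (fun x y z => by
      rw [← map_add]; congr 1; exact Subtype.ext (by simp))
    (fun r x z => by
      rw [← map_smul]; congr 1; exact Subtype.ext (by simp))

theorem toBMinus_starA (x y : Double.partialBos J) :
    toBMinus J (starA J c D x y) = starB J c D (toBMinus J x) (toBMinus J y) :=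
  toBMinus_ofBosθ J _

theorem isStarProduct_starA : IsStarProduct (Double.grade J) (starA J c D) where
  assoc x y z := by
    refine toBMinus_injective J ?_
    simp only [toBMinus_starA]
    exact starB_assoc c D (toBMinus_mem x) _ _
  sub_mem m m' x hx y hy := by
    have hy' : toBMinus J y ∈ lenLT J (antiFixed d) (m' + 1) := by
      suffices h : Double.grade J m' ≤ (lenLT J (antiFixed d) (m' + 1)).comap (toBMinus J) from h hy
      refine grade_le J fun a ha l hl x hx => ?_
      rw [Submodule.mem_comap, hx]
      have := word_mul_K_mem_lenLT (J := J) (zero_mem_antiFixed (d := d))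
        (hl.trans_lt (Nat.lt_succ_self m'))
      rw [K_zero, mul_one] at this
      exact K_mul_mem_lenLT_antiFixed ha this
    suffices h : Double.grade J m ≤ (⨆ j < m + m', Double.grade J j).comap
        ((starA J c D).flip y - LinearMap.mulRight k y) from h hx
    refine grade_le J fun a ha l hl x hx => ?_
    change starA J c D x y - x * y ∈ ⨆ j < m + m', Double.grade J j
    refine mem_iSup_grade J ?_
    rw [map_sub, toBMinus_starA, toBMinus_mul, hx, starB_K_mul J c D ha, mul_assoc, ← mul_sub, ← hl]
    exact K_mul_mem_lenLT_antiFixed ha (starB_word_sub_mem c D l hy')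

theorem isZeroEquivariant_starA : IsZeroEquivariant (Double.grade J) (starA J c D) := by
  intro h hh x
  constructor
  · suffices hle : Double.grade J 0 ≤ LinearMap.ker (starA J c D x - LinearMap.mulLeft k x) from
      sub_eq_zero.mp (hle hh)
    refine grade_le J fun a ha l hl y hy => sub_eq_zero.mpr (toBMinus_injective J ?_)
    rw [List.length_eq_zero_iff.mp hl, word_nil, map_one, mul_one] at hy
    rw [LinearMap.mulLeft_apply, toBMinus_starA, toBMinus_mul, hy, starB_mul_K']
  · suffices hle : Double.grade J 0 ≤ LinearMap.ker ((starA J c D).flip x - LinearMap.mulRight k x)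
      from sub_eq_zero.mp (hle hh)
    refine grade_le J fun a ha l hl y hy => sub_eq_zero.mpr (toBMinus_injective J ?_)
    rw [List.length_eq_zero_iff.mp hl, word_nil, map_one, mul_one] at hy
    rw [LinearMap.mulRight_apply, LinearMap.flip_apply, toBMinus_starA, toBMinus_mul, hy,
      starB_K c D ha]

theorem ofPre_mul_K_of_mem_deg (b : Fin n → ℤ) {α : Fin n → ℕ} {f : Pre J} (hf : f ∈ Pre.deg J α) :
    mP f * mK b = d.chi (natWeight α) b • (mK b * mP f) := by
  refine deg_induction J (p := fun f => mP f * mK b = d.chi (natWeight α) b • (mK b * mP f))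
    ?_ ?_ ?_ ?_ hf
  · simp
  · rintro l rfl
    rw [ofPre_mk, minus_word_mul_K, zwt_eq, d.chi_comm]
  · intro u v hu hv; rw [map_add, add_mul, hu, hv, mul_add, smul_add]
  · intro r u hu; rw [map_smul, smul_mul_assoc, hu, mul_smul_comm, smul_comm]

theorem toBMinus_K_mul {a : Fin n → ℤ} {f : Pre J} {x : Double.partialBos J}
    (hx : (x : Double J) = Double.K J a * Double.ofUMinus J f) :
    toBMinus J x = mK a * mP f :=
  toBMinus_eq (by rw [hx, map_mul, ofBMinus_K]; rfl)

/-- `K_b` is transferred from the right factor to the left one by `starB_mul_K` and then moved past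
`f`, which produces `χ(α, b)`; then `K_a` and `K_b` leave on the left by `starB_K_mul`. -/
theorem isTwistProduct_starA (D' : DualBases d) : Double.IsTwistProduct J c D' (starA J c D) := by
  intro a ha b hb α f hf g x y hx hy
  rw [mem_Zθ_iff] at ha hb
  rw [← ofBMinus_toBMinus (starA J c D x y), toBMinus_starA,
    starB_eq_starB c D D' (toBMinus_mem x), toBMinus_K_mul J hx, toBMinus_K_mul J hy, twist_eq,
    starB_K_mul J c D' ha, ← starB_mul_K, ofPre_mul_K_of_mem_deg J b hf, map_smul,
    LinearMap.smul_apply, starB_K_mul J c D' hb, mul_smul_comm, map_smul, map_mul, map_mul,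
    ofBMinus_K, ofBMinus_K, double_K_add, mul_assoc]
  rfl

theorem span_K_mul_word {M : Submodule k (Double.partialBos J)}
    (h : ∀ a ∈ antiFixed d, ∀ l : List (Fin n), ∀ x : Double.partialBos J,
      toBMinus J x = mK a * mE (word k l) → x ∈ M) (x : Double.partialBos J) : x ∈ M := by
  suffices hle : bosθ J ≤ M.map (toBMinus J) by
    obtain ⟨y, hy, hxy⟩ := hle (toBMinus_mem x)
    rwa [← toBMinus_injective J hxy]
  refine wtSpan_le fun l a ha => ?_
  have hm := word_mul_K_mem_wtSpan (J := J) l ha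
  refine ⟨ofBosθ J ⟨_, hm⟩, ?_, toBMinus_ofBosθ J _⟩
  -- The spanning vectors of `bosθ` have `K_a` on the right; after rescaling they become `K_a F_l`.
  have h2 : ofBosθ J ⟨_, hm⟩ = d.chi a (zwt l) • (ofBosθ J ⟨(d.chi a (zwt l))⁻¹ •
      (mE (word k l) * mK a), Submodule.smul_mem _ _ hm⟩) := by
    refine Subtype.ext ?_
    change _ = d.chi a (zwt l) • oB ((d.chi a (zwt l))⁻¹ • _)
    rw [map_smul, smul_smul, mul_inv_cancel₀ (d.chi_ne_zero _ _), one_smul]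
    rfl
  rw [h2]
  refine Submodule.smul_mem _ _ (h a ha l _ ?_)
  rw [toBMinus_ofBosθ, minus_K_mul_word]

theorem eq_starA_of_isTwistProduct {star : Double.partialBos J →ₗ[k] Double.partialBos J →ₗ[k]
    Double.partialBos J} (h : Double.IsTwistProduct J c D star) : star = starA J c D := by
  have key : ∀ a ∈ antiFixed d, ∀ l : List (Fin n), ∀ x : Double.partialBos J,
      toBMinus J x = mK a * mE (word k l) →
      (x : Double J) = Double.K J a * Double.ofUMinus J (Pre.mk J (word k l)) := by
    intro a ha l x hx
    rw [← ofBMinus_toBMinus x, hx, map_mul, ofBMinus_K, ← ofPre_mk]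
    rfl
  refine LinearMap.ext fun x => LinearMap.ext fun y => ?_
  suffices hx : x ∈ LinearMap.ker (star.flip y - (starA J c D).flip y) from sub_eq_zero.mp hx
  refine span_K_mul_word J (fun a ha l x hx => ?_) x
  change star x y - starA J c D x y = 0
  suffices hy : y ∈ LinearMap.ker (star x - starA J c D x) from hy
  refine span_K_mul_word J (fun b hb l' y hy => ?_) y
  refine sub_eq_zero.mpr (Subtype.ext ?_)
  have ha' := (mem_Zθ_iff d a).mpr ha
  have hb' := (mem_Zθ_iff d b).mpr hb
  rw [h a ha' b hb' (wt l) _ (mem_deg_word J l) _ x y (key a ha l x hx) (key b hb l' y hy),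
    isTwistProduct_starA J c D D a ha' b hb' (wt l) _ (mem_deg_word J l) _ x y (key a ha l x hx)
      (key b hb l' y hy)]

theorem coe_starA_F_sub {i : Fin n} {u : Pre J} {x y : Double.partialBos J}
    (hx : (x : Double J) = Double.F J i) (hy : (y : Double J) = Double.ofUMinus J u) :
    ((starA J c D x y - x * y : Double.partialBos J) : Double J) = (c i * d.q i (d.τ i)) •
      (Double.K J (simpleRoot (d.τ i) - simpleRoot i) *
        Double.ofUMinus J (preDL J (d.τ i) u)) := by
  have hx' : toBMinus J x = mX i := toBMinus_eq (by rw [hx, ofBMinus_X])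
  have hy' : toBMinus J y = mP u := toBMinus_eq hy
  rw [← ofBMinus_toBMinus, map_sub, toBMinus_starA, toBMinus_mul, hx', hy', starB_X, starGen_apply,
    add_sub_cancel_left, CC_ofPre, map_smul, map_mul, ofBMinus_K]
  rfl

end PartialBos

/-! ### The subalgebra U(χ)^poly and the projection ψ -/

section Poly

open Borel

variable {k : Type*} [Field k] {n : ℕ} {d : Datum k n} (J : PreNicholsIdeal d)

local notation "mX" => Borel.X (minusScalar d) J
local notation "mK" => Borel.K (minusScalar d) J
local notation "mE" => Borel.emb (minusScalar d) J
local notation "oB" => Double.ofBMinus J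
local notation "dE" => Double.E J
local notation "dF" => Double.F J
local notation "dK" => Double.K J

theorem F_mem_poly (i : Fin n) : dF i ∈ Double.poly J :=
  Algebra.subset_adjoin (Or.inl (Or.inl (Or.inl ⟨i, rfl⟩)))

theorem E_mul_K_mem_poly (i : Fin n) : dE i * dK (-simpleRoot i) ∈ Double.poly J :=
  Algebra.subset_adjoin (Or.inl (Or.inl (Or.inr ⟨i, rfl⟩)))

theorem K_neg_mem_poly (i : Fin n) : dK (-simpleRoot i) ∈ Double.poly J :=
  Algebra.subset_adjoin (Or.inl (Or.inr ⟨i, rfl⟩))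

theorem Hθ_le_poly : Double.Hθ J ≤ Double.poly J :=
  Algebra.adjoin_mono fun _ h => Or.inr h

theorem partialBos_le_poly : Double.partialBos J ≤ Double.poly J := by
  refine Algebra.adjoin_le ?_
  rintro _ (hx | ⟨i, rfl⟩)
  · exact Hθ_le_poly J hx
  · exact F_mem_poly J i

theorem ofBMinus_mem_poly {y : BMinus J} (hy : y ∈ bosθ J) : oB y ∈ Double.poly J :=
  partialBos_le_poly J (ofBMinus_mem_partialBos J hy)

variable {J} in
theorem mul_mem_polyKer {x y : Double J} (hx : x ∈ Double.poly J) (hy : y ∈ Double.polyKer J) :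
    x * y ∈ Double.polyKer J := by
  suffices h : Double.polyKer J ≤ (Double.polyKer J).comap (LinearMap.mulLeft k x) from h hy
  refine Submodule.span_le.mpr ?_
  rintro _ ⟨u, hu, i, h⟩
  refine Submodule.subset_span ⟨x * u, mul_mem hx hu, i, ?_⟩
  rcases h with rfl | rfl
  · exact Or.inl (mul_assoc _ _ _).symm
  · exact Or.inr (mul_assoc _ _ _).symm

variable {J} in
theorem mul_E_mem_polyKer {x : Double J} (hx : x ∈ Double.poly J) (i : Fin n) :
    x * (dE i * dK (-simpleRoot i)) ∈ Double.polyKer J :=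
  Submodule.subset_span ⟨x, hx, i, Or.inl rfl⟩

variable {J} in
theorem mul_K_mem_polyKer {x : Double J} (hx : x ∈ Double.poly J) (i : Fin n) :
    x * dK (-simpleRoot i) ∈ Double.polyKer J :=
  Submodule.subset_span ⟨x, hx, i, Or.inr rfl⟩

variable {J} in
-- The difference `b - b'` is absorbed into H_θ. This trades `K_i⁻¹` for `K_{τ(i)}⁻¹`, the factor
-- that occurs with `E_{τ(i)}` in the left ideal.
theorem exists_K_mul_eq {b b' : Fin n → ℤ} (hb : b - b' ∈ antiFixed d) {y : BMinus J}
    (hy : y ∈ bosθ J) : ∃ z ∈ bosθ J, mK b * y = z * mK b' := by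
  suffices h : bosθ J ≤ ((bosθ J).map (LinearMap.mulRight k (mK b'))).comap
      (LinearMap.mulLeft k (mK b)) by
    obtain ⟨z, hz, h⟩ := h hy
    exact ⟨z, hz, h.symm⟩
  refine wtSpan_le fun l a ha => ?_
  refine ⟨(d.chi b (zwt l))⁻¹ • (mE (word k l) * mK (a + (b - b'))),
    Submodule.smul_mem _ _ (word_mul_K_mem_wtSpan l (add_mem_antiFixed ha hb)), ?_⟩
  rw [LinearMap.mulLeft_apply, LinearMap.mulRight_apply, ← mul_assoc, minus_K_mul_word,
    smul_mul_assoc, smul_mul_assoc, mul_assoc, mul_assoc, ← K_add, ← K_add]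
  congr 3
  abel

variable {J} in
theorem exists_RR_eq (i : Fin n) {y : BMinus J} (hy : y ∈ bosθ J) :
    ∃ z ∈ bosθ J, RR J i y = z * mK (-simpleRoot i) := by
  suffices h : bosθ J ≤ ((bosθ J).map (LinearMap.mulRight k (mK (-simpleRoot i)))).comap
      (RR J i) by
    obtain ⟨z, hz, h⟩ := h hy
    exact ⟨z, hz, h.symm⟩
  refine wtSpan_le fun l a ha => ?_
  refine ⟨mE (dR d i (word k l)) * mK a, emb_mul_K_mem_wtSpan _ ha, ?_⟩
  rw [LinearMap.mulRight_apply, RR_mul_K, RR_emb, mul_assoc, mul_assoc, K_comm]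

theorem K_mul_mem_polyKer (i : Fin n) {y : BMinus J} (hy : y ∈ bosθ J) :
    dK (-simpleRoot i) * oB y ∈ Double.polyKer J := by
  obtain ⟨z, hz, h⟩ := exists_K_mul_eq (b := -simpleRoot i) (b' := -simpleRoot i)
    (by rw [sub_self]; exact zero_mem_antiFixed) hy
  rw [← ofBMinus_K, ← map_mul, h, map_mul, ofBMinus_K]
  exact mul_K_mem_polyKer (ofBMinus_mem_poly J hz) i

theorem neg_sub_neg_mem_antiFixed (i : Fin n) :
    -simpleRoot i - -simpleRoot (d.τ i) ∈ antiFixed d := by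
  have := sub_mem_antiFixed (d := d) i
  rwa [neg_sub_neg]

theorem K_mul_mul_E_mem_polyKer (i : Fin n) {y : BMinus J} (hy : y ∈ bosθ J) :
    oB (mK (-simpleRoot i) * y) * dE (d.τ i) ∈ Double.polyKer J := by
  obtain ⟨z, hz, h⟩ := exists_K_mul_eq (neg_sub_neg_mem_antiFixed i) hy
  rw [h, map_mul, ofBMinus_K, mul_assoc, double_K_mul_E, mul_smul_comm]
  exact Submodule.smul_mem _ _ (mul_E_mem_polyKer (ofBMinus_mem_poly J hz) _)

theorem RR_mul_mem_polyKer (i : Fin n) {y : BMinus J} (hy : y ∈ bosθ J) :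
    oB (RR J (d.τ i) (mK (-simpleRoot i) * y)) ∈ Double.polyKer J := by
  obtain ⟨z, hz, h⟩ := exists_K_mul_eq (neg_sub_neg_mem_antiFixed i) hy
  obtain ⟨z', hz', h'⟩ := exists_RR_eq (d.τ i) hz
  rw [h, RR_mul_K, h', map_mul, map_mul, ofBMinus_K]
  exact mul_K_mem_polyKer (mul_mem (ofBMinus_mem_poly J hz') (K_neg_mem_poly J _)) _

/-- Left multiplication by `E_{τ(i)} K_i⁻¹` modulo the left ideal. -/
theorem E_mul_K_mul_sub_mem_polyKer (i : Fin n) {y : BMinus J} (hy : y ∈ bosθ J) :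
    dE (d.τ i) * dK (-simpleRoot i) * oB y -
      d.q i (d.τ i) • oB (mK (simpleRoot (d.τ i) - simpleRoot i) * CC J (d.τ i) y) ∈
        Double.polyKer J := by
  have h1 : LL J (d.τ i) (mK (-simpleRoot i) * y) =
      d.q i (d.τ i) • (mK (simpleRoot (d.τ i) - simpleRoot i) * CC J (d.τ i) y) := by
    rw [LL_K_mul, LL_eq, d.chi_neg_left, inv_inv, d.chi_simple, ← mul_assoc, ← K_add]
    congr 3
    abel
  have h2 : eta J (simpleRoot (d.τ i)) y ∈ bosθ J := by
    obtain ⟨N, hN⟩ := exists_mem_lenLT_of_mem_bosθ hy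
    exact lenLT_le_bosθ N (eta_mem_lenLT hN)
  -- Commuting `E_{τ(i)}` to the right gives three terms. Those ending in `E_{τ(i)}` and those from
  -- `RR` lie in the left ideal, and the `LL` term is the one subtracted.
  rw [mul_assoc, ← ofBMinus_K, ← map_mul, double_E_mul, h1, map_smul, map_mul (eta J _), eta_K,
    smul_mul_assoc, map_smul, smul_mul_assoc, add_sub_right_comm, add_sub_cancel_right]
  exact sub_mem (Submodule.smul_mem _ _ (K_mul_mul_E_mem_polyKer J i h2))
    (RR_mul_mem_polyKer J i hy)

theorem E_mul_mem_sup (i : Fin n) {y : BMinus J} (hy : y ∈ bosθ J) :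
    dE i * dK (-simpleRoot i) * oB y ∈
      Subalgebra.toSubmodule (Double.partialBos J) ⊔ Double.polyKer J := by
  -- Write `E_i K_i⁻¹ y` as `E_i K_{τ(i)}⁻¹` times `K_{τ(i)} K_i⁻¹ y`, which is the previous lemma
  -- for `τ(i)`.
  have h := E_mul_K_mul_sub_mem_polyKer J (d.τ i)
    (K_mul_mem_bosθ (sub_mem_antiFixed (d := d) i) hy)
  rw [d.τ_involutive, map_mul, ofBMinus_K, mul_assoc, ← mul_assoc (dK (-simpleRoot (d.τ i))),
    ← double_K_add, neg_add_eq_sub, sub_sub_cancel_left, ← mul_assoc] at h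
  have h2 := (bosθ J).smul_mem (d.q (d.τ i) i) (K_mul_mem_bosθ (sub_tau_mem_antiFixed (d := d) i)
    (CC_mem_wtSpan i (K_mul_mem_bosθ (sub_mem_antiFixed (d := d) i) hy)))
  have h3 := Submodule.add_mem_sup (show oB _ ∈ Subalgebra.toSubmodule (Double.partialBos J) from
    ofBMinus_mem_partialBos J h2) h
  rwa [map_smul, add_sub_cancel] at h3

/-- The right side contains 1 and is stable under left multiplication by the generators. -/
theorem poly_le_sup : Subalgebra.toSubmodule (Double.poly J) ≤
    Subalgebra.toSubmodule (Double.partialBos J) ⊔ Double.polyKer J := by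
  set M := Subalgebra.toSubmodule (Double.partialBos J) ⊔ Double.polyKer J with hM
  have hmul : ∀ g ∈ Double.poly J, (∀ y ∈ bosθ J, g * oB y ∈ M) → ∀ z ∈ M, g * z ∈ M := by
    intro g hg h z hz
    obtain ⟨a, ha, b, hb, rfl⟩ := Submodule.mem_sup.mp hz
    rw [mul_add]
    refine add_mem ?_ (Submodule.mem_sup_right (mul_mem_polyKer hg hb))
    have ha' : a ∈ bosθAlg J := by rw [← partialBos_eq]; exact ha
    obtain ⟨y, hy, rfl⟩ := ha'
    exact h y hy
  have key : ∀ x ∈ Double.poly J, ∀ z ∈ M, x * z ∈ M := by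
    intro x hx
    induction hx using Algebra.adjoin_induction with
    | mem g hg =>
      have hgp : g ∈ Double.poly J := Algebra.subset_adjoin hg
      refine hmul g hgp fun y hy => ?_
      rcases hg with ((⟨i, rfl⟩ | ⟨i, rfl⟩) | ⟨i, rfl⟩) | ⟨i, rfl⟩
      · exact Submodule.mem_sup_left
          ((Double.partialBos J).mul_mem (F_mem_partialBos J i) (ofBMinus_mem_partialBos J hy))
      · exact E_mul_mem_sup J i hy
      · exact Submodule.mem_sup_right (K_mul_mem_polyKer J i hy)
      · exact Submodule.mem_sup_left ((Double.partialBos J).mul_mem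
          (Hθ_le_partialBos J (K_mem_Hθ J (sub_tau_mem_antiFixed i)))
          (ofBMinus_mem_partialBos J hy))
    | algebraMap r =>
      intro z hz
      rw [← Algebra.smul_def]
      exact Submodule.smul_mem _ _ hz
    | add x y _ _ hx hy => intro z hz; rw [add_mul]; exact add_mem (hx z hz) (hy z hz)
    | mul x y _ _ hx hy => intro z hz; rw [mul_assoc]; exact hx _ (hy z hz)
  intro x hx
  have := key x hx 1 (Submodule.mem_sup_left (one_mem (Double.partialBos J)))
  rwa [mul_one] at this

/-- The weights `a` for which `a + τ(a)` is nonzero with nonpositive entries. -/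
def negWeights (d : Datum k n) : Set (Fin n → ℤ) := {a | a + d.tau a < 0}

theorem disjoint_antiFixed_negWeights : Disjoint (antiFixed d) (negWeights d) := by
  refine Set.disjoint_left.mpr fun a ha h => ?_
  change a + d.tau a < 0 at h
  rw [show d.tau a = -a from ha, add_neg_cancel] at h
  exact lt_irrefl _ h

theorem simpleRoot_pos (i : Fin n) : (0 : Fin n → ℤ) < simpleRoot i := by
  simp [simpleRoot]

theorem neg_mem_negWeights (i : Fin n) : -simpleRoot i ∈ negWeights d := by
  change -simpleRoot i + d.tau (-simpleRoot i) < 0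
  rw [d.tau_neg, d.tau_simple, ← neg_add, neg_lt_zero]
  exact add_pos (simpleRoot_pos i) (simpleRoot_pos _)

theorem add_mem_negWeights {a b : Fin n → ℤ} (ha : a ∈ negWeights d) (hb : b ∈ negWeights d) :
    a + b ∈ negWeights d := by
  change a + b + d.tau (a + b) < 0
  rw [d.tau_add, add_add_add_comm]
  exact add_neg ha hb

theorem antiFixed_add_mem_negWeights {a b : Fin n → ℤ} (ha : a ∈ antiFixed d)
    (hb : b ∈ negWeights d) : a + b ∈ negWeights d := by
  change a + b + d.tau (a + b) < 0
  rw [d.tau_add, add_add_add_comm, show d.tau a = -a from ha, add_neg_cancel, zero_add]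
  exact hb

/-- The generators of U(χ)^poly never raise `a + τ(a)`: the only positive shift is the `K_i` in
`LL_i`, and it is compensated by the `K_i⁻¹` in `E_i K_i⁻¹`. -/
theorem verma_mem_wtSpan {x : Double J} (hx : x ∈ Double.poly J) {y : BMinus J}
    (hy : y ∈ wtSpan J (negWeights d)) : verma J x y ∈ wtSpan J (negWeights d) := by
  induction hx using Algebra.adjoin_induction generalizing y with
  | mem g hg =>
    have hKneg : ∀ (i : Fin n) {y : BMinus J}, y ∈ wtSpan J (negWeights d) →
        mK (-simpleRoot i) * y ∈ wtSpan J (negWeights d) := fun i y hy =>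
      K_mul_mem_wtSpan (fun a ha => add_mem_negWeights (neg_mem_negWeights i) ha) hy
    rcases hg with ((⟨i, rfl⟩ | ⟨i, rfl⟩) | ⟨i, rfl⟩) | ⟨i, rfl⟩
    · simpa using X_mul_mem_wtSpan i hy
    · have h1 : LL J i (mK (-simpleRoot i) * y) ∈ wtSpan J (negWeights d) := by
        rw [LL_K_mul, LL_eq, ← mul_assoc, K_neg_mul_K, one_mul]
        exact Submodule.smul_mem _ _ (CC_mem_wtSpan i hy)
      have h2 := RR_mem_wtSpan i (fun a ha => add_mem_negWeights (neg_mem_negWeights i) ha)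
        (hKneg i hy)
      simpa using sub_mem h1 h2
    · simpa using hKneg i hy
    · simpa using K_mul_mem_wtSpan
        (fun a ha => antiFixed_add_mem_negWeights (sub_tau_mem_antiFixed i) ha) hy
  | algebraMap r =>
    rw [AlgHom.commutes, Module.algebraMap_end_apply]
    exact Submodule.smul_mem _ _ hy
  | add x z _ _ hx hz => rw [map_add, LinearMap.add_apply]; exact add_mem (hx hy) (hz hy)
  | mul x z _ _ hx hz => rw [map_mul, Module.End.mul_apply]; exact hx (hz hy)

/-- The generators of the left ideal send 1 to zero or to `K_i⁻¹`, and the rest of U(χ)^poly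
preserves the span of negative weights. -/
theorem verma_polyKer {x : Double J} (hx : x ∈ Double.polyKer J) :
    verma J x 1 ∈ wtSpan J (negWeights d) := by
  suffices h : Double.polyKer J ≤ (wtSpan J (negWeights d)).comap
    (LinearMap.applyₗ 1 ∘ₗ (verma J).toLinearMap) from h hx
  refine Submodule.span_le.mpr ?_
  rintro _ ⟨u, hu, i, rfl | rfl⟩
  · change verma J (u * _) 1 ∈ wtSpan J (negWeights d)
    rw [map_mul, Module.End.mul_apply]
    refine verma_mem_wtSpan J hu ?_
    have : verma J (dE i * dK (-simpleRoot i)) 1 = 0 := by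
      have hL : LL J i (mK (-simpleRoot i)) = 0 := by
        rw [LL_eq, CC_K, mul_zero]
      simp [hL, RR_K]
    rw [this]
    exact zero_mem _
  · change verma J (u * _) 1 ∈ wtSpan J (negWeights d)
    rw [map_mul, Module.End.mul_apply]
    refine verma_mem_wtSpan J hu ?_
    have := word_mul_K_mem_wtSpan (J := J) [] (neg_mem_negWeights (d := d) i)
    rw [word_nil, map_one, one_mul] at this
    simpa using this

/-- Applied to 1, such an element has weights with `a + τ(a) = 0` and also weights with `a + τ(a) <
0`; the coefficients of group-like elements being well defined, it vanishes. -/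
theorem eq_zero_of_mem_polyKer {a : Double.partialBos J} (ha : (a : Double J) ∈ Double.polyKer J) :
    a = 0 := by
  have h := eq_zero_of_mem_wtSpan disjoint_antiFixed_negWeights (toBMinus_mem a)
    (verma_polyKer J ha)
  exact toBMinus_injective J (by rw [h, map_zero])

theorem existsUnique_sub_mem_polyKer {x : Double J} (hx : x ∈ Double.poly J) :
    ∃! a : Double.partialBos J, x - (a : Double J) ∈ Double.polyKer J := by
  obtain ⟨a, ha, b, hb, rfl⟩ := Submodule.mem_sup.mp (poly_le_sup J hx)
  refine ⟨⟨a, ha⟩, ?_, fun a' ha' => sub_eq_zero.mp (eq_zero_of_mem_polyKer J ?_)⟩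
  · change a + b - a ∈ Double.polyKer J
    rwa [add_sub_cancel_left]
  · have h := sub_mem hb ha'
    have h2 : b - (a + b - (a' : Double J)) = a' - a := by abel
    rwa [h2] at h

theorem sub_psi_mem {x : Double J} (hx : x ∈ Double.poly J) :
    x - (Double.psi J x : Double J) ∈ Double.polyKer J :=
  Classical.epsilon_spec (existsUnique_sub_mem_polyKer J hx).exists

theorem psi_eq {x : Double J} (hx : x ∈ Double.poly J) {a : Double.partialBos J}
    (h : x - (a : Double J) ∈ Double.polyKer J) : Double.psi J x = a :=
  (existsUnique_sub_mem_polyKer J hx).unique (sub_psi_mem J hx) h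

end Poly

/-! ### The coideal subalgebra and the comparison of the two products -/

section Coideal

open Borel

variable {k : Type*} [Field k] {n : ℕ} {d : Datum k n} (J : PreNicholsIdeal d) (c : Fin n → k)

local notation "mX" => Borel.X (minusScalar d) J
local notation "mK" => Borel.K (minusScalar d) J
local notation "mE" => Borel.emb (minusScalar d) J
local notation "oB" => Double.ofBMinus J
local notation "dE" => Double.E J
local notation "dF" => Double.F J
local notation "dK" => Double.K J

theorem B_mem_poly (i : Fin n) : Double.B J c i ∈ Double.poly J := by
  refine add_mem (F_mem_poly J i) (Subalgebra.smul_mem _ ?_ _)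
  -- The factor `K_i⁻¹` differs by an element of H_θ from the `K_{τ(i)}⁻¹` that accompanies
  -- `E_{τ(i)}` in U(χ)^poly.
  have h : dE (d.τ i) * dK (-simpleRoot i) =
      dE (d.τ i) * dK (-simpleRoot (d.τ i)) * dK (simpleRoot (d.τ i) - simpleRoot i) := by
    rw [mul_assoc, ← double_K_add]
    congr 2
    abel
  rw [h]
  exact mul_mem (E_mul_K_mem_poly J _) (Hθ_le_poly J (K_mem_Hθ J (sub_mem_antiFixed i)))

theorem coideal_le_poly : Double.coideal J c ≤ Double.poly J := by
  refine Algebra.adjoin_le ?_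
  rintro _ (hx | ⟨i, rfl⟩)
  · exact Hθ_le_poly J hx
  · exact B_mem_poly J c i

theorem B_mem_coideal (i : Fin n) : Double.B J c i ∈ Double.coideal J c :=
  Algebra.subset_adjoin (Or.inr ⟨i, rfl⟩)

theorem Hθ_le_coideal : Double.Hθ J ≤ Double.coideal J c :=
  fun _ hx => Algebra.subset_adjoin (Or.inl hx)

variable {J}

/-- This is the bridge between the two constructions: modulo the left ideal, `B_i` acts by the same
operator as `F_i ⋆`. -/
theorem B_mul_sub_mem_polyKer {x : Double J} {y : BMinus J} (hy : y ∈ bosθ J)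
    (h : x - oB y ∈ Double.polyKer J) (i : Fin n) :
    Double.B J c i * x - oB (starGen J c i y) ∈ Double.polyKer J := by
  have h1 := mul_mem_polyKer (B_mem_poly J c i) h
  have h2 := (Double.polyKer J).smul_mem (c i) (E_mul_K_mul_sub_mem_polyKer J i hy)
  have h3 := add_mem h1 h2
  have h4 : Double.B J c i * (x - oB y) + c i • (dE (d.τ i) * dK (-simpleRoot i) * oB y -
      d.q i (d.τ i) • oB (mK (simpleRoot (d.τ i) - simpleRoot i) * CC J (d.τ i) y)) =
      Double.B J c i * x - oB (starGen J c i y) := by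
    rw [starGen_apply, Double.B, map_add, map_smul, map_mul oB (mX i), ofBMinus_X, smul_sub,
      smul_smul, mul_sub, add_mul _ _ (oB y), smul_mul_assoc]
    abel
  rwa [h4] at h3

theorem K_mul_sub_mem_polyKer {x : Double J} {y : BMinus J} {a : Fin n → ℤ} (ha : a ∈ antiFixed d)
    (h : x - oB y ∈ Double.polyKer J) : dK a * x - oB (mK a * y) ∈ Double.polyKer J := by
  have := mul_mem_polyKer (Hθ_le_poly J (K_mem_Hθ J ha)) h
  rw [mul_sub] at this
  rwa [map_mul, ofBMinus_K]

theorem one_sub_mem_polyKer : (1 : Double J) - oB 1 ∈ Double.polyKer J := by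
  rw [map_one, sub_self]
  exact zero_mem _

theorem exists_coideal_sub_mem {y : BMinus J} (hy : y ∈ bosθ J) :
    ∃ b ∈ Double.coideal J c, b - oB y ∈ Double.polyKer J := by
  -- `M` consists of the elements of H_θ ⋉ U⁻ that are congruent to some element of `B_c` modulo the
  -- left ideal.
  let M : Submodule k (BMinus J) := Submodule.map (LinearMap.snd k (Double J) (BMinus J))
    (((Subalgebra.toSubmodule (Double.coideal J c)).comap (LinearMap.fst k _ _)) ⊓
      (Double.polyKer J).comap (LinearMap.fst k _ _ - (oB).toLinearMap ∘ₗ LinearMap.snd k _ _) ⊓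
      (bosθ J).comap (LinearMap.snd k _ _))
  suffices h : bosθ J ≤ M by
    obtain ⟨⟨b, y⟩, ⟨⟨hb, hby⟩, -⟩, rfl⟩ := h hy
    exact ⟨b, hb, hby⟩
  refine bosθ_le_of_starGen J c ?_ ?_ ?_
  · exact ⟨(1, 1), ⟨⟨one_mem (Double.coideal J c), one_sub_mem_polyKer⟩, one_mem_bosθ⟩, rfl⟩
  · rintro a ha _ ⟨⟨b, y⟩, ⟨⟨hb, hby⟩, hy⟩, rfl⟩
    exact ⟨(dK a * b, mK a * y), ⟨⟨(Double.coideal J c).mul_mem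
      (Hθ_le_coideal J c (K_mem_Hθ J ha)) hb, K_mul_sub_mem_polyKer ha hby⟩,
      K_mul_mem_bosθ ha hy⟩, rfl⟩
  · rintro i _ ⟨⟨b, y⟩, ⟨⟨hb, hby⟩, hy⟩, rfl⟩
    exact ⟨(Double.B J c i * b, starGen J c i y), ⟨⟨(Double.coideal J c).mul_mem
      (B_mem_coideal J c i) hb, B_mul_sub_mem_polyKer c hy hby i⟩, starGen_mem_bosθ c i hy⟩, rfl⟩

variable (J)

theorem psiB_surjective : Function.Surjective (Double.psiB J c) := by
  intro a
  obtain ⟨b, hb, h⟩ := exists_coideal_sub_mem c (toBMinus_mem a)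
  rw [ofBMinus_toBMinus] at h
  exact ⟨⟨b, hb⟩, psi_eq J (coideal_le_poly J c hb) h⟩

theorem sub_psiB_mem (b : Double.coideal J c) :
    (b : Double J) - (Double.psiB J c b : Double J) ∈ Double.polyKer J :=
  sub_psi_mem J (coideal_le_poly J c b.2)

theorem psiB_eq {b : Double.coideal J c} {a : Double.partialBos J}
    (h : (b : Double J) - (a : Double J) ∈ Double.polyKer J) : Double.psiB J c b = a :=
  psi_eq J (coideal_le_poly J c b.2) h

variable (D : DualBases d)

/-- The claim is made for every `y` congruent to `b`, so that it can be iterated: in the product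
step it is applied to `y` first and to `x` afterwards, and associativity of `⋆` combines the
results. -/
theorem mul_sub_starA_mem {x : Double J} (hx : x ∈ Double.coideal J c) :
    ∃ a : Double.partialBos J, x - a ∈ Double.polyKer J ∧ ∀ (y : Double J)
      (b : Double.partialBos J), y - b ∈ Double.polyKer J →
        x * y - (starA J c D a b : Double.partialBos J) ∈ Double.polyKer J := by
  induction hx using Algebra.adjoin_induction with
  | mem g hg =>
    rcases hg with hg | ⟨i, rfl⟩
    · refine ⟨⟨g, Hθ_le_partialBos J hg⟩, by rw [sub_self]; exact zero_mem _, fun y b h => ?_⟩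
      have h0 : (⟨g, Hθ_le_partialBos J hg⟩ : Double.partialBos J) ∈ Double.grade J 0 :=
        Submodule.subset_span ⟨g, hg, [], rfl, by simp [Double.Fword]⟩
      rw [(isZeroEquivariant_starA J c D _ h0 b).2]
      have := mul_mem_polyKer (Hθ_le_poly J hg) h
      rwa [mul_sub] at this
    · refine ⟨⟨dF i, F_mem_partialBos J i⟩, ?_, fun y b h => ?_⟩
      · have := B_mul_sub_mem_polyKer c one_mem_bosθ (one_sub_mem_polyKer (J := J)) i
        rwa [mul_one, starGen_apply, CC_one, mul_zero, smul_zero, add_zero, mul_one,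
          ofBMinus_X] at this
      · rw [← ofBMinus_toBMinus b] at h
        have := B_mul_sub_mem_polyKer c (toBMinus_mem b) h i
        have hX : toBMinus J ⟨dF i, F_mem_partialBos J i⟩ = mX i :=
          toBMinus_eq (ofBMinus_X J i).symm
        rwa [← ofBMinus_toBMinus (starA J c D _ b), toBMinus_starA, hX, starB_X]
  | algebraMap r =>
    refine ⟨algebraMap k _ r, by
      rw [Subalgebra.coe_algebraMap, sub_self]; exact zero_mem _, fun y b h => ?_⟩
    have h1 : starA J c D (algebraMap k _ r) b = r • b := by
      have hone : toBMinus J 1 = 1 := toBMinus_eq (map_one _).symm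
      refine toBMinus_injective J ?_
      rw [toBMinus_starA, Algebra.algebraMap_eq_smul_one, map_smul, hone, map_smul,
        LinearMap.smul_apply, starB_one_left, map_smul]
    rw [h1, ← Algebra.smul_def]
    have := (Double.polyKer J).smul_mem r h
    rwa [smul_sub] at this
  | add x y _ _ hx hy =>
    obtain ⟨a, ha, hx⟩ := hx
    obtain ⟨b, hb, hy⟩ := hy
    refine ⟨a + b, ?_, fun z w h => ?_⟩
    · have := add_mem ha hb
      rwa [← add_sub_add_comm] at this
    · have := add_mem (hx z w h) (hy z w h)
      rw [map_add, LinearMap.add_apply, add_mul]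
      rwa [← add_sub_add_comm] at this
  | mul x y _ _ hx hy =>
    obtain ⟨a, ha, hx⟩ := hx
    obtain ⟨b, hb, hy⟩ := hy
    refine ⟨starA J c D a b, hx y b hb, fun z w h => ?_⟩
    rw [(isStarProduct_starA J c D).assoc, mul_assoc]
    exact hx _ _ (hy z w h)

theorem psiB_mul (x y : Double.coideal J c) :
    Double.psiB J c (x * y) = starA J c D (Double.psiB J c x) (Double.psiB J c y) := by
  obtain ⟨a, ha, h⟩ := mul_sub_starA_mem J c D x.2
  rw [psiB_eq J c ha]
  exact psiB_eq J c (h _ _ (sub_psiB_mem J c y))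

/-- As `psiB` is surjective, `invFun` is a right inverse, and `psiB` is multiplicative with respect
to `⋆`. -/
theorem firstStar_eq (a b : Double.partialBos J) :
    Double.firstStar J c a b = starA J c D a b := by
  rw [Double.firstStar, psiB_mul J c D, Function.rightInverse_invFun (psiB_surjective J c) a,
    Function.rightInverse_invFun (psiB_surjective J c) b]

/-- The two summands of `B_i` have weights `-α_i` and `τ(α_i)`, which cannot be distinguished by an
`a` with `τ(a) = -a`. -/
theorem B_mul_K {a : Fin n → ℤ} (ha : a ∈ antiFixed d) (i : Fin n) :
    Double.B J c i * dK a = d.chi a (simpleRoot i) • (dK a * Double.B J c i) := by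
  have hF : dF i * dK a = d.chi a (simpleRoot i) • (dK a * dF i) := by
    rw [← ofBMinus_K, ← ofBMinus_X, ← map_mul, ← map_mul, K_mul_X, d.minusScalar_eq, map_smul,
      smul_smul, mul_inv_cancel₀ (d.chi_ne_zero _ _), one_smul]
  have hE : dE (d.τ i) * dK (-simpleRoot i) * dK a =
      d.chi a (simpleRoot i) • (dK a * (dE (d.τ i) * dK (-simpleRoot i))) := by
    rw [mul_assoc, ← double_K_add, add_comm (-simpleRoot i), double_K_add, ← mul_assoc,
      double_E_mul_K, ← d.tau_simple, d.chi_comm a (d.tau _), d.chi_θ ha, inv_inv,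
      d.chi_comm (simpleRoot i), smul_mul_assoc, mul_assoc]
  rw [Double.B, add_mul, mul_add, smul_add, hF, smul_mul_assoc, hE, mul_smul_comm, smul_comm (c i)]

/-- The filtration of the coideal subalgebra is exhaustive. -/
theorem exists_mem_filtLT {x : Double J} (hx : x ∈ Double.coideal J c) :
    ∃ m, x ∈ Double.filtLT J c m := by
  let M : Submodule k (Double J) :=
    Submodule.span k {x | ∃ h ∈ Double.Hθ J, ∃ l : List (Fin n), x = h * Double.Bword J c l}
  have hM : x ∈ M := by
    have key : ∀ x ∈ Double.coideal J c, ∀ z ∈ M, x * z ∈ M := by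
      intro x hx
      induction hx using Algebra.adjoin_induction with
      | mem g hg =>
        suffices h : M ≤ M.comap (LinearMap.mulLeft k g) from fun z hz => h hz
        refine Submodule.span_le.mpr ?_
        rintro _ ⟨h, hh, l, rfl⟩
        change g * (h * _) ∈ M
        rw [← mul_assoc]
        rcases hg with hg | ⟨i, rfl⟩
        · exact Submodule.subset_span ⟨g * h, mul_mem hg hh, l, rfl⟩
        · refine Hθ_induction J (p := fun h => Double.B J c i * h * Double.Bword J c l ∈ M)
            (by simp) (fun a ha => ?_) (fun x y hx hy => ?_) (fun r x hx => ?_) hh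
          · rw [B_mul_K J c ha, smul_mul_assoc, mul_assoc]
            exact Submodule.smul_mem _ _ (Submodule.subset_span ⟨_, K_mem_Hθ J ha, i :: l, rfl⟩)
          · rw [mul_add, add_mul]; exact add_mem hx hy
          · rw [mul_smul_comm, smul_mul_assoc]; exact Submodule.smul_mem _ _ hx
      | algebraMap r =>
        intro z hz
        rw [← Algebra.smul_def]
        exact Submodule.smul_mem _ _ hz
      | add x y _ _ hx hy => intro z hz; rw [add_mul]; exact add_mem (hx z hz) (hy z hz)
      | mul x y _ _ hx hy => intro z hz; rw [mul_assoc]; exact hx _ (hy z hz)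
    have := key x hx 1 (Submodule.subset_span ⟨1, one_mem _, [], by simp [Double.Bword]⟩)
    rwa [mul_one] at this
  have hmono : ∀ {m m' : ℕ}, m ≤ m' → Double.filtLT J c m ≤ Double.filtLT J c m' := by
    intro m m' hm
    refine Submodule.span_mono ?_
    rintro _ ⟨h, hh, l, hl, rfl⟩
    exact ⟨h, hh, l, hl.trans_le hm, rfl⟩
  clear hx
  induction hM using Submodule.span_induction with
  | mem _ hx =>
    obtain ⟨h, hh, l, rfl⟩ := hx
    exact ⟨l.length + 1, Submodule.subset_span ⟨h, hh, l, Nat.lt_succ_self _, rfl⟩⟩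
  | zero => exact ⟨0, zero_mem _⟩
  | add x y _ _ hx hy =>
    obtain ⟨m, hm⟩ := hx
    obtain ⟨m', hm'⟩ := hy
    exact ⟨max m m', add_mem (hmono (le_max_left _ _) hm) (hmono (le_max_right _ _) hm')⟩
  | smul r x _ hx =>
    obtain ⟨m, hm⟩ := hx
    exact ⟨m, Submodule.smul_mem _ r hm⟩

variable {J}

theorem word_mem_lenLT (l : List (Fin n)) :
    mE (word k l) ∈ lenLT J (antiFixed d) (l.length + 1) := by
  have := word_mul_K_mem_lenLT (J := J) (zero_mem_antiFixed (d := d)) (Nat.lt_succ_self l.length)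
  rwa [K_zero, mul_one] at this

/-- The element `y` arises from 1 by applying the operators `starGen` along `l`; each of them is
multiplication by `F_i` up to terms of smaller length. -/
theorem exists_Bword_sub_ofBMinus_mem (l : List (Fin n)) :
    ∃ y ∈ lenLT J (antiFixed d) (l.length + 1),
      Double.Bword J c l - oB y ∈ Double.polyKer J ∧
      y - mE (word k l) ∈ lenLT J (antiFixed d) l.length := by
  induction l with
  | nil =>
    refine ⟨1, one_mem_lenLT zero_mem_antiFixed, one_sub_mem_polyKer, ?_⟩
    rw [word_nil, map_one, sub_self]
    exact zero_mem _
  | cons i l ih =>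
    obtain ⟨y, hy, hB, hw⟩ := ih
    refine ⟨starGen J c i y, starGen_mem_lenLT c i hy,
      B_mul_sub_mem_polyKer c (lenLT_le_bosθ _ hy) hB i, ?_⟩
    rw [word_cons, map_mul, emb_ι, starGen_apply, add_sub_right_comm, ← mul_sub]
    refine add_mem (X_mul_mem_lenLT hw) (Submodule.smul_mem _ _ ?_)
    exact K_mul_mem_lenLT_antiFixed (tau_sub i)
      (lenLT_mono (Nat.le_succ _) (CC_mem_lenLT hy))

theorem verma_K_mul_Fword (a : Fin n → ℤ) (l : List (Fin n)) :
    verma J (dK a * Double.Fword J l) 1 = mK a * mE (word k l) := by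
  rw [← ofBMinus_K, ← ofBMinus_word, ← map_mul, verma_ofBMinus, mul_one]

theorem verma_mul_Fword_mem_lenLT {h : Double J} (hh : h ∈ Double.Hθ J) (l : List (Fin n)) :
    verma J (h * Double.Fword J l) 1 ∈ lenLT J (antiFixed d) (l.length + 1) := by
  refine Hθ_induction J
    (p := fun h => verma J (h * Double.Fword J l) 1 ∈ lenLT J (antiFixed d) (l.length + 1))
    (by simp) (fun a ha => ?_) (fun x y hx hy => ?_) (fun r x hx => ?_) hh
  · rw [verma_K_mul_Fword]
    exact K_mul_mem_lenLT_antiFixed ha (word_mem_lenLT l)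
  · rw [add_mul, map_add]; exact add_mem hx hy
  · rw [smul_mul_assoc, map_smul]; exact Submodule.smul_mem _ _ hx

/-- The element of `H_θ ⋉ U⁻` congruent to `h B_l` is `h F_l` up to terms of lower degree. -/
theorem exists_Bword_sub_mem {h : Double J} (hh : h ∈ Double.Hθ J) (l : List (Fin n)) :
    ∃ a : Double.partialBos J, h * Double.Bword J c l - a ∈ Double.polyKer J ∧
      verma J (h * Double.Fword J l) 1 - toBMinus J a ∈ lenLT J (antiFixed d) l.length := by
  obtain ⟨y, hy, hB, hw⟩ := exists_Bword_sub_ofBMinus_mem c l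
  refine Hθ_induction J (p := fun h => ∃ a : Double.partialBos J,
    h * Double.Bword J c l - a ∈ Double.polyKer J ∧
      verma J (h * Double.Fword J l) 1 - toBMinus J a ∈ lenLT J (antiFixed d) l.length)
    ⟨0, by simp, by simp⟩ (fun a ha => ?_) (fun x x' hx hx' => ?_) (fun r x hx => ?_) hh
  · refine ⟨ofBosθ J ⟨mK a * y, K_mul_mem_bosθ ha (lenLT_le_bosθ _ hy)⟩,
      K_mul_sub_mem_polyKer ha hB, ?_⟩
    rw [toBMinus_ofBosθ, verma_K_mul_Fword, ← mul_sub, ← neg_sub y, mul_neg]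
    exact neg_mem (K_mul_mem_lenLT_antiFixed ha hw)
  · obtain ⟨a, ha, h1⟩ := hx
    obtain ⟨b, hb, h2⟩ := hx'
    refine ⟨a + b, ?_, ?_⟩
    · have := add_mem ha hb
      rwa [← add_sub_add_comm, ← add_mul] at this
    · have := add_mem h1 h2
      rwa [← add_sub_add_comm, ← map_add, ← LinearMap.add_apply, ← map_add, ← add_mul] at this
  · obtain ⟨a, ha, h1⟩ := hx
    refine ⟨r • a, ?_, ?_⟩
    · have := Submodule.smul_mem _ r ha
      rwa [smul_sub, ← smul_mul_assoc] at this
    · rw [smul_mul_assoc, map_smul, LinearMap.smul_apply, map_smul, ← smul_sub]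
      exact Submodule.smul_mem _ r h1

variable (J)

theorem degComp_toBMinus {m : ℕ} {x : Double.partialBos J} (hx : x ∈ Double.grade J m) :
    degComp J m (toBMinus J x) = toBMinus J x := by
  suffices h : Double.grade J m ≤
      LinearMap.eqLocus (degComp J m ∘ₗ toBMinus J) (toBMinus J) from h hx
  refine grade_le J fun a _ l hl x hx => ?_
  rw [LinearMap.mem_eqLocus, LinearMap.comp_apply, hx, minus_K_mul_word, map_smul,
    degComp_word_mul_K, if_pos hl]

theorem eq_zero_of_mem_grade {m : ℕ} {x : Double.partialBos J} (hx : x ∈ Double.grade J m)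
    {S : Set (Fin n → ℤ)} (h : toBMinus J x ∈ lenLT J S m) : x = 0 :=
  toBMinus_injective J (by rw [← degComp_toBMinus J hx, degComp_eq_zero J h, map_zero])

variable {J c}

/-- The leading term of `ψ(x)` is the image under `φ` of the class of `x`. -/
theorem exists_sub_leadingTerm_mem {m : ℕ} (φ : Double.Gr J c m →ₗ[k] Double.grade J m)
    (hφ : ∀ h ∈ Double.Hθ J, ∀ l : List (Fin n), l.length = m →
      ∀ x : Double.filtLE J c m, (x : Double J) = h * Double.Bword J c l →
        ((φ (Submodule.Quotient.mk x) : Double.partialBos J) : Double J) = h * Double.Fword J l)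
    (x : Double.filtLE J c m) :
    ∃ a : Double.partialBos J, (x : Double J) - a ∈ Double.polyKer J ∧
      toBMinus J (φ (Submodule.Quotient.mk x) : Double.partialBos J) - toBMinus J a ∈
        lenLT J (antiFixed d) m := by
  obtain ⟨x, hx⟩ := x
  induction hx using Submodule.span_induction with
  | mem x hx' =>
    obtain ⟨h, hh, l, hl, rfl⟩ := hx'
    obtain ⟨a, ha, hw⟩ := exists_Bword_sub_mem c hh l
    refine ⟨a, ha, ?_⟩
    rcases hl.lt_or_eq with hlt | rfl
    -- A word shorter than `m` has zero class, and its representative in H_θ ⋉ U⁻ is itself of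
    -- length less than `m`.
    · have h0 : (Submodule.Quotient.mk ⟨h * Double.Bword J c l, Submodule.subset_span
          ⟨h, hh, l, hl, rfl⟩⟩ : Double.Gr J c m) = 0 :=
        (Submodule.Quotient.mk_eq_zero _).mpr (Submodule.subset_span ⟨h, hh, l, hlt, rfl⟩)
      rw [h0, map_zero, ZeroMemClass.coe_zero, map_zero]
      have := sub_mem (lenLT_mono (Nat.le_succ _) hw) (verma_mul_Fword_mem_lenLT hh l)
      rw [sub_sub_cancel_left] at this
      rw [zero_sub]
      exact lenLT_mono hlt this
    · have := hφ h hh l rfl ⟨_, Submodule.subset_span ⟨h, hh, l, hl, rfl⟩⟩ rfl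
      rw [← this] at hw
      exact hw
  | zero =>
    refine ⟨0, by simp, ?_⟩
    have h0 : (Submodule.Quotient.mk ⟨0, zero_mem _⟩ : Double.Gr J c m) = 0 :=
      Submodule.Quotient.mk_zero _
    rw [h0, map_zero, ZeroMemClass.coe_zero, sub_self]
    exact zero_mem _
  | add x y hx hy ihx ihy =>
    obtain ⟨a, ha, h1⟩ := ihx
    obtain ⟨b, hb, h2⟩ := ihy
    refine ⟨a + b, ?_, ?_⟩
    · have := add_mem ha hb
      rwa [← add_sub_add_comm] at this
    · have := add_mem h1 h2
      rwa [← add_sub_add_comm, ← map_add, ← map_add, ← Submodule.coe_add, ← map_add,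
        ← Submodule.Quotient.mk_add] at this
  | smul r x hx ihx =>
    obtain ⟨a, ha, h1⟩ := ihx
    refine ⟨r • a, ?_, ?_⟩
    · have := Submodule.smul_mem _ r ha
      rwa [smul_sub] at this
    · have := Submodule.smul_mem _ r h1
      rwa [smul_sub, ← map_smul, ← map_smul, ← Submodule.coe_smul, ← map_smul,
        ← Submodule.Quotient.mk_smul] at this

/-- Descent on the filtration degree: since `ψ(x) = 0`, the leading term of `x` is both homogeneous
of degree `m` and of lower degree, hence zero. Injectivity of `φ` then puts `x` into the next
smaller part of the filtration. -/
theorem eq_zero_of_mem_filtLT (hφ : Double.PhiIsIso J c) {m : ℕ} {x : Double J}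
    (hx : x ∈ Double.filtLT J c m) (hker : x ∈ Double.polyKer J) : x = 0 := by
  obtain ⟨φ, hφ⟩ := hφ
  induction m with
  | zero =>
    have h0 : Double.filtLT J c 0 ≤ ⊥ := by
      refine Submodule.span_le.mpr ?_
      rintro _ ⟨h, hh, l, hl, rfl⟩
      exact absurd hl (Nat.not_lt_zero _)
    exact h0 hx
  | succ m ih =>
    have hx' : x ∈ Double.filtLE J c m := by
      simpa only [Double.filtLT, Double.filtLE, Nat.lt_succ_iff] using hx
    obtain ⟨a, ha, hw⟩ := exists_sub_leadingTerm_mem (φ m).toLinearMap (hφ m) ⟨x, hx'⟩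
    have ha0 : a = 0 := eq_zero_of_mem_polyKer J (by
      have := sub_mem hker ha
      rwa [sub_sub_cancel] at this)
    rw [ha0, map_zero, sub_zero] at hw
    have h1 := (φ m).map_eq_zero_iff.mp (Subtype.ext (eq_zero_of_mem_grade J (Subtype.prop _) hw))
    exact ih ((Submodule.Quotient.mk_eq_zero
      ((Double.filtLT J c m).comap (Double.filtLE J c m).subtype)).mp h1)

theorem psiB_bijective (hφ : Double.PhiIsIso J c) : Function.Bijective (Double.psiB J c) := by
  refine ⟨fun x y hxy => Subtype.ext (sub_eq_zero.mp ?_), psiB_surjective J c⟩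
  obtain ⟨m, hm⟩ := exists_mem_filtLT J c (sub_mem x.2 y.2)
  refine eq_zero_of_mem_filtLT hφ hm ?_
  have := sub_mem (sub_psiB_mem J c x) (sub_psiB_mem J c y)
  rwa [hxy, sub_sub_sub_cancel_right] at this

end Coideal

end PartialBosonization

theorem theorem3p6 {k : Type*} [Field k] {n : ℕ} (d : Datum k n) (J : PreNicholsIdeal d)
    (c : Fin n → k) :
    -- the objects entering the formula exist and are unique
    (IsSkewHopfPairing d (pairing d) ∧ ∀ P, IsSkewHopfPairing d P → P = pairing d) ∧
    (IsAntipodeInv d (antipodeInv d) ∧ ∀ T, IsAntipodeInv d T → T = antipodeInv d) ∧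
    Nonempty (DualBases d) ∧
    (∃! δ, Double.IsSkewDerivations J δ) ∧
    (∀ x ∈ Double.poly J, ∃! a : Double.partialBos J, x - (a : Double J) ∈ Double.polyKer J) ∧
    -- the sum defining the twist product is finite
    (∀ (D : DualBases d) (f g : Pre J), {ρ | twistTerm J c D f g ρ ≠ 0}.Finite) ∧
    -- the twist product is a well-defined bilinear operation, independent of the dual bases
    (∃! star : Double.partialBos J →ₗ[k] Double.partialBos J →ₗ[k] Double.partialBos J,
      ∀ D : DualBases d, Double.IsTwistProduct J c D star) ∧
    ∀ star : Double.partialBos J →ₗ[k] Double.partialBos J →ₗ[k] Double.partialBos J,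
      (∀ D : DualBases d, Double.IsTwistProduct J c D star) →
      -- it is associative and a 0-equivariant star product
      IsStarProduct (Double.grade J) star ∧
      IsZeroEquivariant (Double.grade J) star ∧
      -- the left multiplication by the generators
      (∀ δ, Double.IsSkewDerivations J δ → ∀ (i : Fin n) (u : Pre J) (x y : Double.partialBos J),
        (x : Double J) = Double.F J i → (y : Double J) = Double.ofUMinus J u →
        ((star x y - x * y : Double.partialBos J) : Double J) =
          (c i * d.q i (d.τ i)) •
            (Double.K J (simpleRoot (d.τ i) - simpleRoot i) *
              Double.ofUMinus J (δ.1 (d.τ i) u))) ∧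
      -- it coincides with the first star product whenever the latter is defined
      (Double.PhiIsIso J c → Function.Bijective (Double.psiB J c)) ∧
      (Function.Bijective (Double.psiB J c) → ∀ a b, Double.firstStar J c a b = star a b) := by
  obtain ⟨D⟩ := nonempty_dualBases d
  refine ⟨⟨isSkewHopfPairing_pairing d, fun P h => h.eq (isSkewHopfPairing_pairing d)⟩,
    ⟨isAntipodeInv_antipodeInv d, fun T h => h.eq (isAntipodeInv_antipodeInv d)⟩,
    ⟨D⟩,
    ⟨(preDL J, preDR J), isSkewDerivations_preD J, fun δ h => Double.IsSkewDerivations.eq J h⟩,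
    fun x hx => existsUnique_sub_mem_polyKer J hx, fun D f g => ?_,
    ⟨starA J c D, fun D' => isTwistProduct_starA J c D D',
      fun star h => eq_starA_of_isTwistProduct J c D (h D)⟩, fun star h => ?_⟩
  · simp only [twistTerm_eq]
    exact finite_support_starTerm J c D _ _
  · obtain rfl := eq_starA_of_isTwistProduct J c D (h D)
    refine ⟨isStarProduct_starA J c D, isZeroEquivariant_starA J c D, fun δ hδ i u x y hx hy => ?_,
      psiB_bijective, fun _ a b => firstStar_eq J c D a b⟩
    rw [Double.IsSkewDerivations.eq J hδ]
    exact coe_starA_F_sub J c D hx hy
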